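/- Let $\tau\in\mathbb C$ with $\operatorname{Im}\tau>0$, and let $[u]=c\,e^{\kappa u^2}\theta_{11}(u\,|\,\tau)$ with $c\in\mathbb C^\times$, $\kappa\in\mathbb C$, where $\theta_{11}(u\,|\,\tau)=\sum_{n\in\mathbb Z}e^{\pi i\tau(n+1/2)^2+2\pi i(n+1/2)(u+1/2)}$ is the odd theta function (for suitable $c,\kappa$ this is the Weierstrass $\sigma$-function of $\mathbb Z+\mathbb Z\tau$). For parameters $a=(h_x,h_y,e_1,\dots,e_8)\in\mathbb C^{10}$ (representatives of points of $\mathbb T=\mathbb C/(\mathbb Z+\mathbb Z\tau)$) put $$F_{ij}(u)=\frac{[u-e_j][u+e_j-h_x]}{[u-e_i][u+e_i-h_x]},\qquad G_{ij}(u)=\frac{[u-e_j][u+e_j-h_y]}{[u-e_i][u+e_i-h_y]}.$$ Call $a$ generic if $[\,l_xh_x+l_yh_y+\sum_i m_ie_i\,]\neq0$ for all integers $l_x,l_y,m_1,\dots,m_8$ with $2l_xl_y-\sum_i m_i^2=-2$ and $2l_x+2l_y+\sum_i m_i=0$ (the real roots of $E_8^{(1)}$). Let $W(D_6^{(1)})$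 be the affine Weyl group with simple reflections $w_{\beta_0},\dots,w_{\beta_6}$ and Dynkin diagram with edges $\beta_0\beta_2,\beta_1\beta_2,\beta_2\beta_3,\beta_3\beta_4,\beta_4\beta_5,\beta_4\beta_6$, and let $\widetilde W(D_6^{(1)})=\operatorname{Aut}(D_6^{(1)})\ltimes W(D_6^{(1)})$. The group $\operatorname{Aut}(D_6^{(1)})$ is dihedral of order $8$, generated by $\sigma_1=(\beta_0\beta_5\beta_1\beta_6)(\beta_2\beta_4)$ and $\sigma_2=(\beta_0\beta_1)$. (1) The following transformations $a\mapsto\bar a$ (parameters not mentioned are unchanged) define an action $a\mapsto g\cdot a$ of $\widetilde W(D_6^{(1)})$ on $\mathbb C^{10}$: $$\begin{aligned} w_{\beta_0}&:\ \bar e_1=e_2,\ \bar e_2=e_1;\qquad w_{\beta_1}:\ \bar e_5=e_6,\ \bar e_6=e_5;\\ w_{\beta_2}&:\ \bar h_x=h_x+h_y-e_1-e_5,\ \bar e_1=h_y-e_5,\ \bar e_5=h_y-e_1;\\ w_{\beta_3}&:\ \bar h_x=h_y,\ \bar h_y=h_x;\\ w_{\beta_4}&:\ \bar h_x=h_x+h_y-e_3-e_7,\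 \bar e_3=h_y-e_7,\ \bar e_7=h_y-e_3;\\ w_{\beta_5}&:\ \bar e_3=e_4,\ \bar e_4=e_3;\qquad w_{\beta_6}:\ \bar e_7=e_8,\ \bar e_8=e_7;\\ \sigma_1&:\ (\bar e_1,\dots,\bar e_8)=(e_7,e_8,e_1,e_2,e_3,e_4,e_5,e_6);\\ \sigma_2&:\ (\bar e_1,\dots,\bar e_8)=(e_5,e_6,e_3,e_4,e_1,e_2,e_7,e_8). \end{aligned}$$ The action preserves the set of generic parameters and the constraints $e_1+e_2-e_5-e_6=0$, $e_3+e_4-e_7-e_8=0$ on $\mathbb T$. (2) Over this action there is a birational representation of $\widetilde W(D_6^{(1)})$: for every $g$ and every generic $a$ (in particular, every generic $a$ satisfying the constraints) a birational map $\varphi_{g,a}:(x,y)\mapsto(\bar x,\bar y)$ of $\mathbb P^1\times\mathbb P^1$, with $\varphi_{1,a}=\mathrm{id}$ and $\varphi_{gh,a}=\varphi_{g,h\cdot a}\circ\varphi_{h,a}$, which on the generators is $$\begin{aligned} w_{\beta_i}&:\ \bar x=x,\ \bar y=y\quad(i=1,5,6);\qquad w_{\beta_0}:\ \bar x=\tfrac1x,\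 \bar y=\tfrac1y;\\ w_{\beta_2}&:\ \bar x-\bar F_{12}(\bar e_5)=-\frac{\bar F_{12}(\bar e_5)G_{12}(e_5)}{F_{12}(e_5)}\cdot\frac{x-F_{12}(e_5)}{y-G_{12}(e_5)},\quad \bar y=\frac{G_{52}(e_1)\,y}{y-G_{12}(e_5)};\\ w_{\beta_3}&:\ \bar x=y,\ \bar y=x;\\ w_{\beta_4}&:\ \frac{\bar x-\bar F_{12}(\bar e_3)}{\bar x-\bar F_{12}(\bar e_7)}=\frac{(x-F_{12}(e_3))(y-G_{12}(e_7))}{(x-F_{12}(e_7))(y-G_{12}(e_3))},\quad \bar y=y;\\ \sigma_1&:\ \bar x=F_{78}(e_1)\frac{x-F_{12}(e_8)}{x-F_{12}(e_7)},\quad \bar y=G_{78}(e_1)\frac{y-G_{12}(e_8)}{y-G_{12}(e_7)};\\ \sigma_2&:\ \bar x=F_{56}(e_1)\frac{x-F_{12}(e_6)}{x-F_{12}(e_5)},\quad \bar y=G_{56}(e_1)\frac{y-G_{12}(e_6)}{y-G_{12}(e_5)}, \end{aligned}$$ where $\bar F_{12},\bar G_{12}$ are $F_{12},G_{12}$ with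 $\bar a$ in place of $a$. Moreover $\varphi_{g,a}(F_{12}(u),G_{12}(u))=(\bar F_{12}(u),\bar G_{12}(u))$ with $\bar a=g\cdot a$, as an identity in $u$ (off the poles). (3) The element $\sigma_1^2=(\beta_0\beta_1)(\beta_5\beta_6)$ acts on the parameters by $(\bar e_1,\dots,\bar e_8)=(e_5,e_6,e_7,e_8,e_1,e_2,e_3,e_4)$ and on $(x,y)$ by the same formula as $\sigma_2$. -/

import Mathlib

noncomputable section

namespace EllipticD6

/-! ### The extended affine Weyl group of type `D₆⁽¹⁾` -/

/-- Two distinct nodes `i`, `j` of the affine Dynkin diagram `D₆⁽¹⁾` are joined: the nodes are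
`0, …, 6` and the edges are `0-2`, `1-2`, `2-3`, `3-4`, `4-5`, `4-6`. -/
def d6Edge (i j : Fin 7) : Bool :=
  (s(i, j) ∈ [s((0 : Fin 7), 2), s(1, 2), s(2, 3), s(3, 4), s(4, 5), s(4, 6)])

/-- The entries of the Coxeter matrix of type `D₆⁽¹⁾`. -/
def d6Entry (i j : Fin 7) : ℕ := if i = j then 1 else if d6Edge i j then 3 else 2

/-- The Coxeter matrix of the affine Dynkin diagram `D₆⁽¹⁾`. -/
def affineD6 : CoxeterMatrix (Fin 7) where
  M := Matrix.of d6Entry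
  isSymm := by
    ext i j
    change d6Entry j i = d6Entry i j
    revert i j
    decide
  diagonal := by
    change ∀ i, d6Entry i i = 1
    decide
  off_diagonal := by
    change ∀ i j, i ≠ j → d6Entry i j ≠ 1
    decide

/-- The group `Aut(D₆⁽¹⁾)` of automorphisms of the Dynkin diagram. -/
def diagramAut : Subgroup (Equiv.Perm (Fin 7)) where
  carrier := {π | ∀ i j, affineD6 (π i) (π j) = affineD6 i j}
  one_mem' := fun _ _ => rfl
  mul_mem' := fun {π ρ} hπ hρ i j => (hπ (ρ i) (ρ j)).trans (hρ i j)
  inv_mem' := fun {π} hπ i j => by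
    have h := hπ (π⁻¹ i) (π⁻¹ j)
    simpa using h.symm

/-- The endomorphism `s_i ↦ s_{π i}` of the affine Weyl group `W(D₆⁽¹⁾)`. -/
def diagramEndo (π : diagramAut) : affineD6.Group →* affineD6.Group :=
  affineD6.toCoxeterSystem.lift ⟨fun i => affineD6.simple (π.1 i), fun i j => by
    have h := affineD6.toCoxeterSystem.simple_mul_simple_pow (π.1 i) (π.1 j)
    rw [π.2 i j] at h
    exact h⟩

theorem diagramEndo_simple (π : diagramAut) (i : Fin 7) :
    diagramEndo π (affineD6.simple i) = affineD6.simple (π.1 i) :=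
  affineD6.toCoxeterSystem.lift_apply_simple _ i

theorem diagramEndo_comp (π ρ : diagramAut) :
    (diagramEndo π).comp (diagramEndo ρ) = diagramEndo (π * ρ) := by
  apply affineD6.toCoxeterSystem.ext_simple
  intro i
  change diagramEndo π (diagramEndo ρ (affineD6.simple i)) =
    diagramEndo (π * ρ) (affineD6.simple i)
  simp only [diagramEndo_simple]
  rfl

theorem diagramEndo_one : diagramEndo 1 = MonoidHom.id _ := by
  apply affineD6.toCoxeterSystem.ext_simple
  intro i
  exact diagramEndo_simple 1 i

/-- The action of `Aut(D₆⁽¹⁾)` on `W(D₆⁽¹⁾)` by permuting the simple reflections. -/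
def diagramAction : diagramAut →* MulAut affineD6.Group where
  toFun π := MonoidHom.toMulEquiv (diagramEndo π) (diagramEndo π⁻¹)
    (by rw [diagramEndo_comp, inv_mul_cancel, diagramEndo_one])
    (by rw [diagramEndo_comp, mul_inv_cancel, diagramEndo_one])
  map_one' := by
    ext x
    exact DFunLike.congr_fun diagramEndo_one x
  map_mul' π ρ := by
    ext x
    exact (DFunLike.congr_fun (diagramEndo_comp π ρ) x).symm

/-- The extended affine Weyl group `W̃(D₆⁽¹⁾) = Aut(D₆⁽¹⁾) ⋉ W(D₆⁽¹⁾)`. -/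
abbrev ExtW : Type := affineD6.Group ⋊[diagramAction] diagramAut

/-- The simple reflection `w_{β_i}`. -/
def wβ (i : Fin 7) : ExtW := SemidirectProduct.inl (affineD6.simple i)

/-- The diagram automorphism `σ₁ = (β₀ β₅ β₁ β₆)(β₂ β₄)`. -/
def σ₁ : ExtW :=
  SemidirectProduct.inr ⟨c[(0 : Fin 7), 5, 1, 6] * c[(2 : Fin 7), 4], by
    change ∀ i j : Fin 7, d6Entry _ _ = d6Entry _ _
    decide⟩

/-- The diagram automorphism `σ₂ = (β₀ β₁)`. -/
def σ₂ : ExtW :=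
  SemidirectProduct.inr ⟨Equiv.swap (0 : Fin 7) 1, by
    change ∀ i j : Fin 7, d6Entry _ _ = d6Entry _ _
    decide⟩

/-! ### The odd theta function -/

/-- The odd theta function
`θ₁₁(u | τ) = ∑ n : ℤ, exp (π i τ (n + 1/2)² + 2 π i (n + 1/2) (u + 1/2))`. -/
def oddTheta (τ u : ℂ) : ℂ :=
  Complex.exp (Real.pi * Complex.I * (τ / 4 + u + 1 / 2)) *
    jacobiTheta₂ (u + 1 / 2 + τ / 2) τ

/-- The function `[u] = c · exp (κ u²) · θ₁₁(u | τ)`: the odd theta function for `c = 1`, `κ = 0`,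
and the Weierstrass `σ`-function of the lattice `ℤ + ℤ τ` for suitable `c` and `κ`. -/
def bracket (τ κ c u : ℂ) : ℂ := c * Complex.exp (κ * u ^ 2) * oddTheta τ u

/-! ### Parameters -/

/-- Parameters `h_x, h_y, e₁, …, e₈`, as complex representatives of points of `ℂ / (ℤ + ℤ τ)`. -/
@[ext]
structure Params where
  hx : ℂ
  hy : ℂ
  e1 : ℂ
  e2 : ℂ
  e3 : ℂ
  e4 : ℂ
  e5 : ℂ
  e6 : ℂ
  e7 : ℂ
  e8 : ℂ

/-- The lattice `ℤ + ℤ τ`. -/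
def inLattice (τ z : ℂ) : Prop := ∃ m n : ℤ, z = m + n * τ

/-- The constraints `e₁ + e₂ - e₅ - e₆ = 0` and `e₃ + e₄ - e₇ - e₈ = 0`
on the torus `ℂ / (ℤ + ℤ τ)`. -/
def Constraints (τ : ℂ) (a : Params) : Prop :=
  inLattice τ (a.e1 + a.e2 - a.e5 - a.e6) ∧ inLattice τ (a.e3 + a.e4 - a.e7 - a.e8)

/-- The value `l_x h_x + l_y h_y + ∑ m_i e_i` of the pull-back of the divisor class
`l_x H_x + l_y H_y + ∑ m_i E_i`. -/
def pullback (a : Params) (lx ly : ℤ) (m : Fin 8 → ℤ) : ℂ :=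
  lx * a.hx + ly * a.hy +
    ∑ i, (m i : ℂ) * (![a.e1, a.e2, a.e3, a.e4, a.e5, a.e6, a.e7, a.e8] : Fin 8 → ℂ) i

/-- Generic parameters: no class `α = l_x H_x + l_y H_y + ∑ m_i E_i` with `α • α = -2` and
`α • K = 0` (a real root of the lattice `E₈⁽¹⁾`) pulls back to a zero of `[·]`. Here
`α • α = 2 l_x l_y - ∑ m_i²` and `α • (-K) = 2 l_x + 2 l_y + ∑ m_i`. -/
def Generic (br : ℂ → ℂ) (a : Params) : Prop :=
  ∀ (lx ly : ℤ) (m : Fin 8 → ℤ),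
    2 * lx * ly - ∑ i, m i ^ 2 = -2 → 2 * lx + 2 * ly + ∑ i, m i = 0 →
      br (pullback a lx ly m) ≠ 0

/-- The function `[u - q] [u + q - h] / ([u - p] [u + p - h])`. -/
def thetaQuot (br : ℂ → ℂ) (h p q u : ℂ) : ℂ :=
  (br (u - q) * br (u + q - h)) / (br (u - p) * br (u + p - h))

/-- `F₁₂(u)`. -/
def F12 (br : ℂ → ℂ) (a : Params) (u : ℂ) : ℂ := thetaQuot br a.hx a.e1 a.e2 u
/-- `G₁₂(u)`. -/
def G12 (br : ℂ → ℂ) (a : Params) (u : ℂ) : ℂ := thetaQuot br a.hy a.e1 a.e2 u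
/-- `G₅₂(u)`. -/
def G52 (br : ℂ → ℂ) (a : Params) (u : ℂ) : ℂ := thetaQuot br a.hy a.e5 a.e2 u
/-- `F₇₈(u)`. -/
def F78 (br : ℂ → ℂ) (a : Params) (u : ℂ) : ℂ := thetaQuot br a.hx a.e7 a.e8 u
/-- `G₇₈(u)`. -/
def G78 (br : ℂ → ℂ) (a : Params) (u : ℂ) : ℂ := thetaQuot br a.hy a.e7 a.e8 u
/-- `F₅₆(u)`. -/
def F56 (br : ℂ → ℂ) (a : Params) (u : ℂ) : ℂ := thetaQuot br a.hx a.e5 a.e6 u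
/-- `G₅₆(u)`. -/
def G56 (br : ℂ → ℂ) (a : Params) (u : ℂ) : ℂ := thetaQuot br a.hy a.e5 a.e6 u

/-- The transformations of the parameters by the generators (parameters that are not mentioned
do not change). -/
def ParameterAction (A : ExtW →* Equiv.Perm Params) : Prop :=
  ∀ a : Params,
    A (wβ 0) a = { a with e1 := a.e2, e2 := a.e1 } ∧
    A (wβ 1) a = { a with e5 := a.e6, e6 := a.e5 } ∧
    A (wβ 2) a = { a with
      hx := a.hx + a.hy - a.e1 - a.e5, e1 := a.hy - a.e5, e5 := a.hy - a.e1 } ∧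
    A (wβ 3) a = { a with hx := a.hy, hy := a.hx } ∧
    A (wβ 4) a = { a with
      hx := a.hx + a.hy - a.e3 - a.e7, e3 := a.hy - a.e7, e7 := a.hy - a.e3 } ∧
    A (wβ 5) a = { a with e3 := a.e4, e4 := a.e3 } ∧
    A (wβ 6) a = { a with e7 := a.e8, e8 := a.e7 } ∧
    A σ₁ a = { a with e1 := a.e7, e2 := a.e8, e3 := a.e1, e4 := a.e2,
                      e5 := a.e3, e6 := a.e4, e7 := a.e5, e8 := a.e6 } ∧
    A σ₂ a = { a with e1 := a.e5, e2 := a.e6, e5 := a.e1, e6 := a.e2 }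

/-! ### Birational maps -/

/-- The field `ℂ(x, y)`. A birational self-map of `ℙ¹ × ℙ¹` is the same as a `ℂ`-automorphism of
this field, its pull-back; it is given by the images `x̄`, `ȳ` of `x`, `y`. -/
abbrev RatXY : Type := FractionRing (MvPolynomial (Fin 2) ℂ)

/-- The coordinate function `x`. -/
def coordX : RatXY := algebraMap (MvPolynomial (Fin 2) ℂ) RatXY (MvPolynomial.X 0)
/-- The coordinate function `y`. -/
def coordY : RatXY := algebraMap (MvPolynomial (Fin 2) ℂ) RatXY (MvPolynomial.X 1)
/-- A constant as a rational function. -/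
def const (z : ℂ) : RatXY := algebraMap ℂ RatXY z

/-- Birational maps `φ_{g,a} : X_a ⇢ X_{A g a}`, given by their pull-backs `ρ g a`, form a
representation: `φ_{1,a} = id` and `φ_{gh,a} = φ_{g,A h a} ∘ φ_{h,a}`, that is,
`φ_{gh,a}^* = φ_{h,a}^* ∘ φ_{g,A h a}^*`. -/
def IsRepresentation (br : ℂ → ℂ) (A : ExtW →* Equiv.Perm Params)
    (ρ : ExtW → Params → (RatXY ≃ₐ[ℂ] RatXY)) : Prop :=
  ∀ a, Generic br a →
    (∀ f, ρ 1 a f = f) ∧ ∀ g h f, ρ (g * h) a f = ρ h a (ρ g (A h a) f)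

/-- The formula `x̄ = F₅₆(e₁) (x - F₁₂(e₆)) / (x - F₁₂(e₅))`,
`ȳ = G₅₆(e₁) (y - G₁₂(e₆)) / (y - G₁₂(e₅))`. -/
def IsMap56 (br : ℂ → ℂ) (a : Params) (φ : RatXY ≃ₐ[ℂ] RatXY) : Prop :=
  φ coordX = const (F56 br a a.e1) *
      ((coordX - const (F12 br a a.e6)) / (coordX - const (F12 br a a.e5))) ∧
    φ coordY = const (G56 br a a.e1) *
      ((coordY - const (G12 br a a.e6)) / (coordY - const (G12 br a a.e5)))

/-- The birational maps of the generators; barred functions are taken at the transformed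
parameters. -/
def GeneratorMaps (br : ℂ → ℂ) (A : ExtW →* Equiv.Perm Params)
    (ρ : ExtW → Params → (RatXY ≃ₐ[ℂ] RatXY)) : Prop :=
  ∀ a, Generic br a →
    (ρ (wβ 1) a coordX = coordX ∧ ρ (wβ 1) a coordY = coordY) ∧
    (ρ (wβ 5) a coordX = coordX ∧ ρ (wβ 5) a coordY = coordY) ∧
    (ρ (wβ 6) a coordX = coordX ∧ ρ (wβ 6) a coordY = coordY) ∧
    (ρ (wβ 0) a coordX = 1 / coordX ∧ ρ (wβ 0) a coordY = 1 / coordY) ∧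
    (ρ (wβ 2) a coordX - const (F12 br (A (wβ 2) a) (A (wβ 2) a).e5) =
        -const (F12 br (A (wβ 2) a) (A (wβ 2) a).e5 * G12 br a a.e5 / F12 br a a.e5) *
          ((coordX - const (F12 br a a.e5)) / (coordY - const (G12 br a a.e5))) ∧
      ρ (wβ 2) a coordY = const (G52 br a a.e1) * coordY / (coordY - const (G12 br a a.e5))) ∧
    (ρ (wβ 3) a coordX = coordY ∧ ρ (wβ 3) a coordY = coordX) ∧
    ((ρ (wβ 4) a coordX - const (F12 br (A (wβ 4) a) (A (wβ 4) a).e3)) /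
          (ρ (wβ 4) a coordX - const (F12 br (A (wβ 4) a) (A (wβ 4) a).e7)) =
        ((coordX - const (F12 br a a.e3)) * (coordY - const (G12 br a a.e7))) /
          ((coordX - const (F12 br a a.e7)) * (coordY - const (G12 br a a.e3))) ∧
      ρ (wβ 4) a coordY = coordY) ∧
    (ρ σ₁ a coordX = const (F78 br a a.e1) *
        ((coordX - const (F12 br a a.e8)) / (coordX - const (F12 br a a.e7))) ∧
      ρ σ₁ a coordY = const (G78 br a a.e1) *
        ((coordY - const (G12 br a a.e8)) / (coordY - const (G12 br a a.e7)))) ∧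
    IsMap56 br a (ρ σ₂ a)

/-- No bracket in the denominators of `F₁₂(u)` and `G₁₂(u)` vanishes. -/
def FiniteAt (br : ℂ → ℂ) (a : Params) (u : ℂ) : Prop :=
  br (u - a.e1) ≠ 0 ∧ br (u + a.e1 - a.hx) ≠ 0 ∧ br (u + a.e1 - a.hy) ≠ 0

/-- The rational function `f`, restricted to the curve `ι(u) = (F₁₂(u), G₁₂(u))` with parameters
`a`, has the value `v` at `ι(u)`: every representation `f = P / Q` satisfies
`P(ι(u)) = v Q(ι(u))`. -/
def HasValueOnCurve (br : ℂ → ℂ) (a : Params) (f : RatXY) (u v : ℂ) : Prop :=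
  ∀ P Q : MvPolynomial (Fin 2) ℂ,
    algebraMap (MvPolynomial (Fin 2) ℂ) RatXY P =
        f * algebraMap (MvPolynomial (Fin 2) ℂ) RatXY Q →
      MvPolynomial.eval ![F12 br a u, G12 br a u] P =
        v * MvPolynomial.eval ![F12 br a u, G12 br a u] Q

/-- The birational maps carry the parametrized curves to each other: `φ_{g,a} ∘ ι = ῑ` with
`ῑ(u) = (F̄₁₂(u), Ḡ₁₂(u))`. -/
def RespectsCurves (br : ℂ → ℂ) (A : ExtW →* Equiv.Perm Params)
    (ρ : ExtW → Params → (RatXY ≃ₐ[ℂ] RatXY)) : Prop :=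
  ∀ a, Generic br a → ∀ g u, FiniteAt br a u → FiniteAt br (A g a) u →
    HasValueOnCurve br a (ρ g a coordX) u (F12 br (A g a) u) ∧
    HasValueOnCurve br a (ρ g a coordY) u (G12 br (A g a) u)

end EllipticD6

end

open EllipticD6

noncomputable section

namespace EllipticD6

/-! ### The addition formula for the odd theta function -/

/-! The addition formula exhibits `[v + p] [v - p]` as the determinant of the vectors `(f v, g v)`
and `(f p, g p)`, with `f`, `g` even. So `(f / g)(u - h / 2)` is a coordinate on `ℙ¹` invariant
under `u ↦ h - u`, and `[u - e] [u + e - h]` is, up to a factor independent of `e`, a linear form in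
it (`etaForm`). Hence `F₁₂`, `G₁₂` are fractional linear functions of "intrinsic" coordinates `((f /
g)(u - h_x / 2), (f / g)(u - h_y / 2))`, which depend on `h_x`, `h_y` only.

In intrinsic coordinates little remains. The diagram automorphisms and `w_{β_i}` for `i = 0, 1, 5,
6` are the identity, `w_{β_3}` exchanges `x` and `y`, and `w_{β_2}`, `w_{β_4}` are elementary
transformations: they fix `y` and act on `x` by a matrix over `ℂ[y]` (`elemMat`). The stated
formulas arise by conjugating with the change of coordinates `frameAut` and using the Plücker
relation `sub_thetaQuot`.

Relations are checked on the curve. By `elemMat_mulVec` the matrix carries the curve for `h_x` to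
the one for `h_x + h_y - p - q`, up to an explicit scalar. By `polyMatrix_eq_zero` a polynomial
matrix that kills the curve is zero, since `u` and `h_y - u` have the same `y` but in general
different `x` when `[h_x - h_y] ≠ 0`. This reduces involutivity, commutation and the braid relation
of `β₀`, `β₂` to products of brackets. The braid relation of `β₂`, `β₃` involves the exchange of `x`
and `y` and is verified directly (`elemAut_swapXY_braid`). Diagram symmetry gives the other Coxeter
relations (`isLiftable_simpleGen`).

Permutations with a cocycle form a group `CocyclePerm`, so parameter action and birational maps
together are one homomorphism `extHom`, obtained from the universal properties of Coxeter groups and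
semidirect products. Generic parameters stay generic because each generator acts on the root
conditions by an integral change of coefficients. The statement on curves is proved for generators
off a discrete set, composed, and extended to all finite points by continuity. -/

/-- The even part `∑ k, exp (2 π i τ k² + 4 π i k v)`. -/
def thetaEven (τ v : ℂ) : ℂ := jacobiTheta₂ (2 * v) (2 * τ)

/-- The odd part `∑ k, exp (2 π i τ (k + 1/2)² + 4 π i (k + 1/2) v)`. -/
def thetaOdd (τ v : ℂ) : ℂ :=
  Complex.exp (Real.pi * Complex.I * (τ / 2 + 2 * v)) * jacobiTheta₂ (2 * v + τ) (2 * τ)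

open Complex in
/-- The exponential `(-1) ^ s * exp (π i τ (s² + d²) / 2 + 2 π i (s v + d p))`. -/
def thetaTerm (τ v p : ℂ) (s d : ℤ) : ℂ :=
  cexp (Real.pi * I * τ * (s ^ 2 + d ^ 2) / 2 + 2 * Real.pi * I * (s * v + d * p + s / 2))

theorem thetaEven_neg (τ v : ℂ) : thetaEven τ (-v) = thetaEven τ v := by
  unfold thetaEven
  rw [mul_neg, jacobiTheta₂_neg_left]

/-- Reflection turns the argument `2 v + τ` into `2 v - τ`. Quasi-periodicity under `2 τ` moves it
back, and its multiplier is absorbed by the exponential prefactor. -/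
theorem thetaOdd_neg (τ v : ℂ) : thetaOdd τ (-v) = thetaOdd τ v := by
  unfold thetaOdd
  have h : jacobiTheta₂ (2 * -v + τ) (2 * τ) = jacobiTheta₂ (2 * v - τ) (2 * τ) := by
    rw [← jacobiTheta₂_neg_left]
    congr 1
    ring
  have h2 := jacobiTheta₂_add_left' (2 * v - τ) (2 * τ)
  rw [show 2 * v - τ + 2 * τ = 2 * v + τ by ring] at h2
  rw [h, h2, ← mul_assoc, ← Complex.exp_add]
  congr 2
  ring

open Complex in
theorem summable_norm_jacobiTheta₂_term (z : ℂ) {τ : ℂ} (hτ : 0 < τ.im) :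
    Summable fun n : ℤ => ‖jacobiTheta₂_term n z τ‖ :=
  ((summable_jacobiTheta₂_term_iff z τ).2 hτ).norm

/-- Pairs of integers `(n, m)`, sorted by the parity of `n + m + 1`. -/
def intPairEquiv : (ℤ × ℤ) ⊕ (ℤ × ℤ) ≃ ℤ × ℤ where
  -- With `s = n + m + 1` and `d = n - m`, the first summand gives `s = 2 j`, `d = 2 k + 1`, the
  -- second `s = 2 j + 1`, `d = 2 k`.
  toFun := Sum.elim (fun x => (x.1 + x.2, x.1 - x.2 - 1)) (fun x => (x.1 + x.2, x.1 - x.2))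
  invFun x := if (x.1 + x.2) % 2 = 0 then Sum.inr ((x.1 + x.2) / 2, (x.1 - x.2) / 2)
    else Sum.inl ((x.1 + x.2 + 1) / 2, (x.1 - x.2 - 1) / 2)
  left_inv := by
    rintro (⟨j, k⟩ | ⟨j, k⟩)
    · have h : ¬ ((j + k) + (j - k - 1)) % 2 = 0 := by omega
      simp only [Sum.elim_inl, h, if_false]
      congr 2 <;> omega
    · have h : ((j + k) + (j - k)) % 2 = 0 := by omega
      simp only [Sum.elim_inr, h, if_true]
      congr 2 <;> omega
  right_inv := by
    rintro ⟨n, m⟩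
    by_cases h : (n + m) % 2 = 0
    · simp only [h, if_true, Sum.elim_inr, Prod.mk.injEq]
      omega
    · simp only [h, if_false, Sum.elim_inl, Prod.mk.injEq]
      omega

/-- Absolute convergence turns a product of two theta series into one double series, whose terms can
then be regrouped. -/
theorem hasSum_jacobiTheta₂_mul {z w τ C s : ℂ} (hτ : 0 < τ.im) {F : ℤ × ℤ → ℂ}
    (hF : ∀ n m, F (n, m) = C * (jacobiTheta₂_term n z τ * jacobiTheta₂_term m w τ))
    (hs : s = C * (jacobiTheta₂ z τ * jacobiTheta₂ w τ)) : HasSum F s := by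
  have h1 := hasSum_jacobiTheta₂_term z hτ
  have h2 := hasSum_jacobiTheta₂_term w hτ
  have h3 : Summable fun x : ℤ × ℤ => jacobiTheta₂_term x.1 z τ * jacobiTheta₂_term x.2 w τ :=
    summable_mul_of_summable_norm (f := fun n => jacobiTheta₂_term n z τ)
      (g := fun n => jacobiTheta₂_term n w τ)
      (summable_norm_jacobiTheta₂_term z hτ) (summable_norm_jacobiTheta₂_term w hτ)
  have h4 := (HasSum.mul h1 h2 h3).mul_left C
  rw [hs]
  exact h4.congr_fun fun x => hF x.1 x.2

-- The exponents combine through `(n + 1/2)² + (m + 1/2)² = (s² + d²) / 2` and `(n + 1/2)(v + p) +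
-- (m + 1/2)(v - p) = s v + d p`.
open Complex in
theorem hasSum_oddTheta_mul (τ v p : ℂ) (hτ : 0 < τ.im) :
    HasSum (fun x : ℤ × ℤ => thetaTerm τ v p (x.1 + x.2 + 1) (x.1 - x.2))
      (oddTheta τ (v + p) * oddTheta τ (v - p)) := by
  refine hasSum_jacobiTheta₂_mul (z := v + p + 1 / 2 + τ / 2) (w := v - p + 1 / 2 + τ / 2)
    (C := cexp (Real.pi * I * (τ / 4 + (v + p) + 1 / 2)) *
      cexp (Real.pi * I * (τ / 4 + (v - p) + 1 / 2))) hτ (fun n m => ?_) ?_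
  · simp only [thetaTerm, jacobiTheta₂_term, ← Complex.exp_add]
    congr 1
    push_cast
    ring
  · simp only [oddTheta]
    ring

open Complex in
theorem hasSum_thetaEven_mul_thetaOdd (τ v p : ℂ) (hτ : 0 < τ.im) :
    HasSum (fun x : ℤ × ℤ => thetaTerm τ v p (2 * x.1) (2 * x.2 + 1))
      (thetaEven τ v * thetaOdd τ p) := by
  have hτ2 : 0 < (2 * τ).im := by simpa using hτ
  refine hasSum_jacobiTheta₂_mul (z := 2 * v) (w := 2 * p + τ)
    (C := cexp (Real.pi * I * (τ / 2 + 2 * p))) hτ2 (fun n m => ?_) ?_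
  · simp only [thetaTerm, jacobiTheta₂_term, ← Complex.exp_add]
    rw [Complex.exp_eq_exp_iff_exists_int]
    -- The sign factor `exp (π i s)` with `s = 2 n` amounts to `n` full periods of the exponential.
    refine ⟨n, ?_⟩
    push_cast
    ring
  · simp only [thetaEven, thetaOdd]
    ring

open Complex in
theorem hasSum_thetaOdd_mul_thetaEven (τ v p : ℂ) (hτ : 0 < τ.im) :
    HasSum (fun x : ℤ × ℤ => thetaTerm τ v p (2 * x.1 + 1) (2 * x.2))
      (-(thetaOdd τ v * thetaEven τ p)) := by
  have hτ2 : 0 < (2 * τ).im := by simpa using hτ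
  -- For odd `s` the factor `exp (π i s)` is `-1`. It is kept as `exp (π i)` in the constant and is
  -- the source of the minus sign in the addition formula.
  refine hasSum_jacobiTheta₂_mul (z := 2 * v + τ) (w := 2 * p)
    (C := cexp (Real.pi * I) * cexp (Real.pi * I * (τ / 2 + 2 * v))) hτ2 (fun n m => ?_) ?_
  · simp only [thetaTerm, jacobiTheta₂_term, ← Complex.exp_add]
    rw [Complex.exp_eq_exp_iff_exists_int]
    refine ⟨n, ?_⟩
    push_cast
    ring
  · simp only [thetaEven, thetaOdd, Complex.exp_pi_mul_I]
    ring

/-- The addition formula: `θ₁₁(v + p) θ₁₁(v - p)` is a wedge of vectors depending on `v`, `p`. -/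
theorem oddTheta_add_mul_oddTheta_sub (τ v p : ℂ) (hτ : 0 < τ.im) :
    oddTheta τ (v + p) * oddTheta τ (v - p) =
      thetaEven τ v * thetaOdd τ p - thetaOdd τ v * thetaEven τ p := by
  have h := (Equiv.hasSum_iff intPairEquiv).2 (hasSum_oddTheta_mul τ v p hτ)
  refine h.unique ?_
  rw [sub_eq_add_neg]
  refine HasSum.sum (f := _) ?_ ?_
  · convert hasSum_thetaEven_mul_thetaOdd τ v p hτ using 1
    ext x
    simp only [Function.comp_apply, intPairEquiv, Equiv.coe_fn_mk, Sum.elim_inl]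
    congr 1 <;> ring
  · convert hasSum_thetaOdd_mul_thetaEven τ v p hτ using 1
    ext x
    simp only [Function.comp_apply, intPairEquiv, Equiv.coe_fn_mk, Sum.elim_inr]
    congr 1 <;> ring

theorem differentiable_oddTheta (τ : ℂ) (hτ : 0 < τ.im) : Differentiable ℂ (oddTheta τ) := by
  unfold oddTheta
  refine Differentiable.mul (by fun_prop) fun u => ?_
  exact DifferentiableAt.comp u (differentiableAt_jacobiTheta₂_fst _ hτ)
    (by fun_prop : DifferentiableAt ℂ (fun u : ℂ => u + 1 / 2 + τ / 2) u)

/-- An entire function `[u]` and even functions `f`, `g` with the addition formula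
`[v + p] [v - p] = f(v) g(p) - g(v) f(p)`. -/
structure AddFormula (br f g : ℂ → ℂ) : Prop where
  diff : Differentiable ℂ br
  f_neg : ∀ v, f (-v) = f v
  g_neg : ∀ v, g (-v) = g v
  mul_eq : ∀ v p, br (v + p) * br (v - p) = f v * g p - g v * f p

/-- The Gaussian factor preserves the determinantal form because `(v + p)² + (v - p)² = 2 v² + 2
p²`. -/
theorem addFormula_bracket (τ κ c : ℂ) (hτ : 0 < τ.im) :
    AddFormula (bracket τ κ c) (fun v => c * Complex.exp (2 * κ * v ^ 2) * thetaEven τ v)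
      (fun v => c * Complex.exp (2 * κ * v ^ 2) * thetaOdd τ v) where
  diff := by
    unfold bracket
    exact Differentiable.mul (by fun_prop) (differentiable_oddTheta τ hτ)
  f_neg v := by rw [thetaEven_neg, neg_sq]
  g_neg v := by rw [thetaOdd_neg, neg_sq]
  mul_eq v p := by
    have h := oddTheta_add_mul_oddTheta_sub τ v p hτ
    have e : Complex.exp (κ * (v + p) ^ 2) * Complex.exp (κ * (v - p) ^ 2) =
        Complex.exp (2 * κ * v ^ 2) * Complex.exp (2 * κ * p ^ 2) := by
      rw [← Complex.exp_add, ← Complex.exp_add]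
      congr 1
      ring
    calc _ = c ^ 2 * (Complex.exp (κ * (v + p) ^ 2) * Complex.exp (κ * (v - p) ^ 2)) *
          (oddTheta τ (v + p) * oddTheta τ (v - p)) := by unfold bracket; ring
      _ = _ := by rw [h, e]; ring

/-! ### Automorphisms of the field `ℂ(x, y)` -/

theorem isTranscendenceBasis_coord :
    IsTranscendenceBasis ℂ (algebraMap (MvPolynomial (Fin 2) ℂ) RatXY ∘ MvPolynomial.X) :=
  have : Algebra.IsAlgebraic (MvPolynomial (Fin 2) ℂ) RatXY :=
    IsLocalization.isAlgebraic _ (nonZeroDivisors _)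
  (IsTranscendenceBasis.mvPolynomial (Fin 2) ℂ).algebraMap_comp

theorem trdeg_ratXY : Algebra.trdeg ℂ RatXY = 2 := by
  have h := isTranscendenceBasis_coord.lift_cardinalMk_eq_trdeg
  simpa using h.symm

theorem coord_mem_imp_top {F : IntermediateField ℂ RatXY} (hx : coordX ∈ F) (hy : coordY ∈ F) :
    F = ⊤ := by
  have hpoly : ∀ P : MvPolynomial (Fin 2) ℂ, algebraMap _ RatXY P ∈ F := by
    intro P
    induction P using MvPolynomial.induction_on with
    | C a => exact F.algebraMap_mem a
    | add p q hp hq => rw [map_add]; exact F.add_mem hp hq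
    | mul_X p i hp =>
      rw [map_mul]
      refine F.mul_mem hp ?_
      fin_cases i
      · exact hx
      · exact hy
  rw [eq_top_iff]
  intro z _
  obtain ⟨P, Q, -, rfl⟩ := IsFractionRing.div_surjective (A := MvPolynomial (Fin 2) ℂ) z
  exact F.div_mem (hpoly P) (hpoly Q)

/-- The transcendence degree is two, so a generating pair has no room for an algebraic relation. -/
theorem algebraicIndependent_of_adjoin_eq_top {p q : RatXY}
    (h : IntermediateField.adjoin ℂ {p, q} = ⊤) : AlgebraicIndependent ℂ ![p, q] := by
  have hr : Set.range ![p, q] = {p, q} := by simp [Set.pair_comm]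
  have : Algebra.IsAlgebraic (Algebra.adjoin ℂ (Set.range ![p, q])) RatXY := by
    refine ⟨fun z => ?_⟩
    have hz : z ∈ IntermediateField.adjoin ℂ (Set.range ![p, q]) := by
      rw [hr, h]
      trivial
    obtain ⟨r, hr, s, hs, rfl⟩ := IntermediateField.mem_adjoin_iff_div.1 hz
    rw [div_eq_mul_inv]
    exact (isAlgebraic_algebraMap (⟨r, hr⟩ : Algebra.adjoin ℂ (Set.range ![p, q]))).mul
      (isAlgebraic_algebraMap (⟨s, hs⟩ : Algebra.adjoin ℂ (Set.range ![p, q]))).inv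
  refine (Algebra.IsAlgebraic.isTranscendenceBasis_of_lift_le_trdeg_of_finite ℂ ![p, q] ?_).1
  simp [trdeg_ratXY]

/-- Two generators of `ℂ(x, y)` are the images of `x`, `y` under an automorphism. -/
theorem exists_algEquiv {p q : RatXY} (hx : coordX ∈ IntermediateField.adjoin ℂ {p, q})
    (hy : coordY ∈ IntermediateField.adjoin ℂ {p, q}) :
    ∃ φ : RatXY ≃ₐ[ℂ] RatXY, φ coordX = p ∧ φ coordY = q := by
  have h := coord_mem_imp_top hx hy
  have hinj : Function.Injective (MvPolynomial.aeval ![p, q] : MvPolynomial (Fin 2) ℂ →ₐ[ℂ] RatXY) :=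
    algebraicIndependent_of_adjoin_eq_top h
  let φ : RatXY →ₐ[ℂ] RatXY := IsFractionRing.liftAlgHom hinj
  have hφ : ∀ P : MvPolynomial (Fin 2) ℂ, φ (algebraMap _ RatXY P) = MvPolynomial.aeval ![p, q] P :=
    fun P => IsFractionRing.lift_algebraMap hinj P
  have hpx : φ coordX = p := by
    rw [coordX, hφ]
    simp
  have hqy : φ coordY = q := by
    rw [coordY, hφ]
    simp
  have hsurj : Function.Surjective φ := by
    rw [← AlgHom.fieldRange_eq_top, eq_top_iff, ← h, IntermediateField.adjoin_le_iff]
    rintro z (rfl | rfl)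
    · exact ⟨_, hpx⟩
    · exact ⟨_, hqy⟩
  exact ⟨AlgEquiv.ofBijective φ ⟨φ.toRingHom.injective, hsurj⟩, hpx, hqy⟩

theorem algHom_ext_coord {L : Type*} [Field L] [Algebra ℂ L] {φ ψ : RatXY →ₐ[ℂ] L}
    (hx : φ coordX = ψ coordX) (hy : φ coordY = ψ coordY) : φ = ψ := by
  have hpoly : φ.comp (IsScalarTower.toAlgHom ℂ (MvPolynomial (Fin 2) ℂ) RatXY) =
      ψ.comp (IsScalarTower.toAlgHom ℂ (MvPolynomial (Fin 2) ℂ) RatXY) := by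
    apply MvPolynomial.algHom_ext
    intro i
    fin_cases i
    · exact hx
    · exact hy
  refine DFunLike.ext _ _ fun z => ?_
  obtain ⟨P, Q, -, rfl⟩ := IsFractionRing.div_surjective (A := MvPolynomial (Fin 2) ℂ) z
  have hP : φ (algebraMap _ RatXY P) = ψ (algebraMap _ RatXY P) := DFunLike.congr_fun hpoly P
  have hQ : φ (algebraMap _ RatXY Q) = ψ (algebraMap _ RatXY Q) := DFunLike.congr_fun hpoly Q
  rw [map_div₀, map_div₀, hP, hQ]

theorem algEquiv_ext_coord {φ ψ : RatXY ≃ₐ[ℂ] RatXY}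
    (hx : φ coordX = ψ coordX) (hy : φ coordY = ψ coordY) : φ = ψ := by
  have h : (φ : RatXY →ₐ[ℂ] RatXY) = ψ := algHom_ext_coord hx hy
  ext z
  exact DFunLike.congr_fun h z

/-- Exchange of `x` and `y`. -/
theorem exists_swapXY : ∃ φ : RatXY ≃ₐ[ℂ] RatXY, φ coordX = coordY ∧ φ coordY = coordX :=
  exists_algEquiv (IntermediateField.subset_adjoin _ _ (by simp))
    (IntermediateField.subset_adjoin _ _ (by simp))

/-- Exchange of `x` and `y`. -/
def swapXY : RatXY ≃ₐ[ℂ] RatXY := exists_swapXY.choose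

@[simp] theorem swapXY_coordX : swapXY coordX = coordY := exists_swapXY.choose_spec.1
@[simp] theorem swapXY_coordY : swapXY coordY = coordX := exists_swapXY.choose_spec.2

theorem swapXY_mul_self : swapXY * swapXY = 1 := by
  apply algEquiv_ext_coord <;> simp

theorem algEquiv_const (φ : RatXY ≃ₐ[ℂ] RatXY) (z : ℂ) : φ (const z) = const z := φ.commutes z

/-- Powers of `x` are linearly independent over `ℂ(y)`. -/
theorem eq_zero_of_mul_coordX_add {u v : RatXY}
    (hu : u ∈ IntermediateField.adjoin ℂ {coordY}) (hv : v ∈ IntermediateField.adjoin ℂ {coordY})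
    (h : u * coordX + v = 0) : u = 0 ∧ v = 0 := by
  have hmem : coordY ∈ IntermediateField.adjoin ℂ {coordX + 1, coordY} :=
    IntermediateField.subset_adjoin _ _ (by simp)
  -- The translation `x ↦ x + 1` fixes `ℂ(y)`. Subtracting the relation from its translate isolates
  -- the coefficient of `x`.
  obtain ⟨φ, hx, hy⟩ := exists_algEquiv (p := coordX + 1) (q := coordY) (by
    have h1 : coordX + 1 ∈ IntermediateField.adjoin ℂ {coordX + 1, coordY} :=
      IntermediateField.subset_adjoin _ _ (by simp)
    simpa using sub_mem h1 (one_mem _)) hmem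
  have hfix : ∀ w ∈ IntermediateField.adjoin ℂ {coordY}, φ w = w := by
    intro w hw
    have : IntermediateField.adjoin ℂ {coordY} ≤
        IntermediateField.fixedField (Subgroup.zpowers φ) := by
      rw [IntermediateField.adjoin_le_iff]
      rintro z rfl
      rw [SetLike.mem_coe, IntermediateField.mem_fixedField_iff]
      intro f hf
      have : Subgroup.zpowers φ ≤ MulAction.stabilizer (RatXY ≃ₐ[ℂ] RatXY) coordY := by
        rw [Subgroup.zpowers_le]
        exact hy
      exact this hf
    exact (IntermediateField.mem_fixedField_iff _ _).1 (this hw) φ (Subgroup.mem_zpowers φ)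
  have h2 := congrArg φ h
  rw [map_add, map_mul, hx, hfix u hu, hfix v hv, map_zero] at h2
  have hu0 : u = 0 := by linear_combination h2 - h
  subst hu0
  refine ⟨rfl, ?_⟩
  simpa using h

theorem eq_zero_of_const_mul_coordX_add {a b : ℂ} (h : const a * coordX + const b = 0) :
    a = 0 ∧ b = 0 := by
  have := eq_zero_of_mul_coordX_add (IntermediateField.algebraMap_mem _ a)
    (IntermediateField.algebraMap_mem _ b) h
  simpa [const] using this

theorem eq_zero_of_const_mul_coordY_add {a b : ℂ} (h : const a * coordY + const b = 0) :
    a = 0 ∧ b = 0 := by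
  have h2 := congrArg swapXY h
  rw [map_add, map_mul, swapXY_coordY, algEquiv_const, algEquiv_const, map_zero] at h2
  exact eq_zero_of_const_mul_coordX_add h2

/-! ### Permutations with a cocycle -/

/-- A permutation of `X` that preserves the subset `S`, with a family of elements of `H`
over `S`. -/
@[ext]
structure CocyclePerm {X : Type} (S : X → Prop) (H : Type) where
  perm : Equiv.Perm X
  map_iff : ∀ a, S (perm a) ↔ S a
  coc : {a // S a} → H

namespace CocyclePerm

variable {X : Type} {S : X → Prop} {H : Type}

/-- The action on the subset `S`. -/
def act (s : CocyclePerm S H) (a : {a // S a}) : {a // S a} := ⟨s.perm a, (s.map_iff a).2 a.2⟩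

theorem ext' {s t : CocyclePerm S H} (h1 : ∀ a, s.perm a = t.perm a)
    (h2 : ∀ a, s.coc a = t.coc a) : s = t :=
  CocyclePerm.ext (Equiv.ext h1) (funext h2)

variable [Group H]

/-- The values of the cocycle are pull-backs, so they compose in the opposite order: first factor
`t` at `a`, then `s` at the image of `a`. -/
instance : Mul (CocyclePerm S H) :=
  ⟨fun s t => ⟨s.perm * t.perm, fun a => (s.map_iff _).trans (t.map_iff a),
    fun a => t.coc a * s.coc (t.act a)⟩⟩

instance : One (CocyclePerm S H) := ⟨⟨1, fun _ => Iff.rfl, fun _ => 1⟩⟩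

instance : Inv (CocyclePerm S H) :=
  ⟨fun s => ⟨s.perm⁻¹, fun a => by
      have h := s.map_iff (s.perm⁻¹ a)
      rw [show s.perm (s.perm⁻¹ a) = a from s.perm.apply_symm_apply a] at h
      exact h.symm,
    fun a => (s.coc ⟨s.perm⁻¹ a, by
      rw [← s.map_iff, show s.perm (s.perm⁻¹ a) = a from s.perm.apply_symm_apply a.1]
      exact a.2⟩)⁻¹⟩⟩

@[simp] theorem mul_perm (s t : CocyclePerm S H) : (s * t).perm = s.perm * t.perm := rfl
@[simp] theorem mul_coc (s t : CocyclePerm S H) (a : {a // S a}) :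
    (s * t).coc a = t.coc a * s.coc (t.act a) := rfl
@[simp] theorem one_perm : (1 : CocyclePerm S H).perm = 1 := rfl
@[simp] theorem one_coc (a : {a // S a}) : (1 : CocyclePerm S H).coc a = 1 := rfl

instance : Group (CocyclePerm S H) :=
  Group.ofLeftAxioms
    (fun a b c => ext' (fun _ => rfl) fun x => (mul_assoc (c.coc x) _ _).symm)
    (fun a => ext' (fun _ => rfl) fun x => mul_one _)
    (fun a => ext' (fun x => a.perm.symm_apply_apply x) fun x => by
      change a.coc x * (a.coc ⟨a.perm⁻¹ (a.perm x), _⟩)⁻¹ = 1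
      rw [mul_inv_eq_one]
      congr 1
      exact Subtype.ext (a.perm.symm_apply_apply x.1).symm)

/-- The projection to the permutations. -/
def permHom : CocyclePerm S H →* Equiv.Perm X where
  toFun s := s.perm
  map_one' := rfl
  map_mul' _ _ := rfl

end CocyclePerm

/-! ### Diagram automorphisms -/

/-- The rotation `(β₀ β₅ β₁ β₆)(β₂ β₄)`. -/
def rot : diagramAut := ⟨c[(0 : Fin 7), 5, 1, 6] * c[(2 : Fin 7), 4], by
  change ∀ i j : Fin 7, d6Entry _ _ = d6Entry _ _
  decide⟩

/-- The reflection `(β₀ β₁)`. -/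
def refl01 : diagramAut := ⟨Equiv.swap (0 : Fin 7) 1, by
  change ∀ i j : Fin 7, d6Entry _ _ = d6Entry _ _
  decide⟩

theorem σ₁_eq : σ₁ = SemidirectProduct.inr rot := rfl
theorem σ₂_eq : σ₂ = SemidirectProduct.inr refl01 := rfl

theorem diagramAut_edge (π : diagramAut) {i j : Fin 7} (h : d6Edge i j = true) :
    d6Edge (π.1 i) (π.1 j) = true := by
  have h1 : d6Entry (π.1 i) (π.1 j) = d6Entry i j := π.2 i j
  have h2 : d6Entry i j = 3 := by
    clear h1
    revert i j
    decide
  rw [h2] at h1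
  revert h1
  generalize π.1 i = a
  generalize π.1 j = b
  revert a b
  decide

/-- The values of the diagram automorphisms. -/
def diagramAutValues : List (Fin 7 → Fin 7) :=
  [![0, 1, 2, 3, 4, 5, 6], ![1, 0, 2, 3, 4, 5, 6], ![0, 1, 2, 3, 4, 6, 5], ![1, 0, 2, 3, 4, 6, 5],
    ![5, 6, 4, 3, 2, 1, 0], ![6, 5, 4, 3, 2, 1, 0], ![5, 6, 4, 3, 2, 0, 1], ![6, 5, 4, 3, 2, 0, 1]]

-- An automorphism is followed from the centre outwards. Each adjacency condition stands directly
-- after the quantifier it restricts, so the search discards a branch as soon as it fails.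
set_option maxRecDepth 100000 in
theorem mem_diagramAutValues : ∀ p3 p2 : Fin 7, d6Edge p2 p3 = true →
    ∀ p4, d6Edge p3 p4 = true → p2 ≠ p4 → ∀ p0, d6Edge p0 p2 = true → p0 ≠ p3 →
    ∀ p1, d6Edge p1 p2 = true → p1 ≠ p3 → p0 ≠ p1 → ∀ p5, d6Edge p4 p5 = true → p5 ≠ p3 →
    ∀ p6, d6Edge p4 p6 = true → p6 ≠ p3 → p5 ≠ p6 →
    ![p0, p1, p2, p3, p4, p5, p6] ∈ diagramAutValues := by
  decide

theorem diagramAut_mem (π : diagramAut) : (π.1 : Fin 7 → Fin 7) ∈ diagramAutValues := by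
  have hne : ∀ i j : Fin 7, i ≠ j → π.1 i ≠ π.1 j := fun i j h h2 => h (π.1.injective h2)
  have he : ∀ i j : Fin 7, d6Edge i j = true → d6Edge (π.1 i) (π.1 j) = true :=
    fun i j h => diagramAut_edge π h
  have h := mem_diagramAutValues (π.1 3) (π.1 2) (he 2 3 rfl) (π.1 4) (he 3 4 rfl)
    (hne 2 4 (by decide)) (π.1 0) (he 0 2 rfl) (hne 0 3 (by decide)) (π.1 1) (he 1 2 rfl)
    (hne 1 3 (by decide)) (hne 0 1 (by decide)) (π.1 5) (he 4 5 rfl) (hne 5 3 (by decide))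
    (π.1 6) (he 4 6 rfl) (hne 6 3 (by decide)) (hne 5 6 (by decide))
  convert h using 1
  ext i
  fin_cases i <;> rfl

/-- The vertices with one neighbour. -/
def IsLeaf (i : Fin 7) : Prop := i ∈ ([0, 1, 5, 6] : List (Fin 7))

instance : DecidablePred IsLeaf := fun i => inferInstanceAs (Decidable (i ∈ _))

theorem diagramAut_isLeaf (π : diagramAut) (i : Fin 7) : IsLeaf (π.1 i) ↔ IsLeaf i := by
  have h := diagramAut_mem π
  revert h
  generalize (π.1 : Fin 7 → Fin 7) = p
  revert p
  have key : (diagramAutValues.all fun p => decide (∀ i, IsLeaf (p i) ↔ IsLeaf i)) = true := by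
    decide +kernel
  exact fun p hp => of_decide_eq_true (List.all_eq_true.1 key p hp) i

theorem diagramAut_eq (π : diagramAut) :
    ∃ (k : Fin 4) (e : Fin 2), π = rot ^ (k : ℕ) * refl01 ^ (e : ℕ) := by
  have h := diagramAut_mem π
  have key : (diagramAutValues.all fun p => decide (∃ (k : Fin 4) (e : Fin 2), ∀ i,
      p i = (rot.1 ^ (k : ℕ) * refl01.1 ^ (e : ℕ)) i)) = true := by
    decide +kernel
  obtain ⟨k, e, hke⟩ := of_decide_eq_true (List.all_eq_true.1 key _ h)
  exact ⟨k, e, Subtype.ext (Equiv.ext hke)⟩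

theorem diagramAut_induction {P : diagramAut → Prop} (one : P 1)
    (hrot : ∀ π, P π → P (rot * π)) (hrefl : ∀ π, P π → P (refl01 * π)) (π : diagramAut) : P π := by
  obtain ⟨k, e, rfl⟩ := diagramAut_eq π
  have h1 : ∀ (n : ℕ), P (refl01 ^ n) := fun n => by
    induction n with
    | zero => exact one
    | succ n ih => rw [pow_succ']; exact hrefl _ ih
  have h2 : ∀ (m n : ℕ), P (rot ^ m * refl01 ^ n) := fun m n => by
    induction m with
    | zero => rw [pow_zero, one_mul]; exact h1 n
    | succ m ih => rw [pow_succ', mul_assoc]; exact hrot _ ih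
  exact h2 k e

/-- Every element is a word in simple reflections followed by one in `σ₁`, `σ₂`. This reduces
compatibility with constraints and curves to the generators. -/
theorem extW_induction {P : ExtW → Prop} (one : P 1) (hw : ∀ i g, P g → P (wβ i * g))
    (h1 : ∀ g, P g → P (σ₁ * g)) (h2 : ∀ g, P g → P (σ₂ * g)) (g : ExtW) : P g := by
  rw [← SemidirectProduct.inl_left_mul_inr_right g]
  have hr : P (SemidirectProduct.inr g.right) := by
    generalize g.right = π
    induction π using diagramAut_induction with
    | one => rw [map_one]; exact one
    | hrot π ih => rw [map_mul]; exact h1 _ ih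
    | hrefl π ih => rw [map_mul]; exact h2 _ ih
  generalize g.left = w
  induction w using affineD6.toCoxeterSystem.simple_induction_left with
  | one => rw [map_one, one_mul]; exact hr
  | mul_simple_left w i ih => rw [map_mul, mul_assoc]; exact hw i _ ih

/-- Every pair of nodes can be moved to a standard pair. -/
theorem exists_standard_pair (i j : Fin 7) : ∃ (k : Fin 4) (e : Fin 2) (x y : Fin 7),
    (x, y) ∈ ([(0, 0), (2, 2), (3, 3), (0, 1), (0, 5), (0, 2), (0, 4), (0, 3), (2, 4), (2, 3)] :
      List (Fin 7 × Fin 7)) ∧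
    (((rot ^ (k : ℕ) * refl01 ^ (e : ℕ)).1 x = i ∧ (rot ^ (k : ℕ) * refl01 ^ (e : ℕ)).1 y = j) ∨
      ((rot ^ (k : ℕ) * refl01 ^ (e : ℕ)).1 x = j ∧
        (rot ^ (k : ℕ) * refl01 ^ (e : ℕ)).1 y = i)) := by
  have key : ∀ i j : Fin 7, ∃ xy ∈ ([(0, 0), (2, 2), (3, 3), (0, 1), (0, 5), (0, 2), (0, 4), (0, 3),
      (2, 4), (2, 3)] : List (Fin 7 × Fin 7)), ∃ (k : Fin 4) (e : Fin 2),
    (((rot.1 ^ (k : ℕ) * refl01.1 ^ (e : ℕ)) xy.1 = i ∧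
        (rot.1 ^ (k : ℕ) * refl01.1 ^ (e : ℕ)) xy.2 = j) ∨
      ((rot.1 ^ (k : ℕ) * refl01.1 ^ (e : ℕ)) xy.1 = j ∧
        (rot.1 ^ (k : ℕ) * refl01.1 ^ (e : ℕ)) xy.2 = i)) := by
    decide +kernel
  obtain ⟨⟨x, y⟩, hmem, k, e, h⟩ := key i j
  exact ⟨k, e, x, y, hmem, h⟩

/-! ### The action on the parameters -/

/-- The parameters `e_i` at the leaves of the diagram. -/
def pairAt (a : Params) : Fin 7 → ℂ × ℂ :=
  ![(a.e1, a.e2), (a.e5, a.e6), 0, 0, 0, (a.e3, a.e4), (a.e7, a.e8)]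

/-- A diagram automorphism permutes the pairs `(e₁, e₂)`, `(e₅, e₆)`, `(e₃, e₄)`, `(e₇, e₈)`. -/
def permutePairs (π : diagramAut) (a : Params) : Params :=
  let p := fun i => pairAt a (π⁻¹.1 i)
  ⟨a.hx, a.hy, (p 0).1, (p 0).2, (p 5).1, (p 5).2, (p 1).1, (p 1).2, (p 6).1, (p 6).2⟩

theorem pairAt_eq_zero (a : Params) {i : Fin 7} (h : ¬ IsLeaf i) : pairAt a i = 0 := by
  revert h
  fin_cases i
  all_goals first
    | exact fun _ => rfl
    | exact fun h => absurd (by decide) h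

/-- At inner nodes both sides vanish, because automorphisms preserve the set of leaves. Having the
formula at all nodes makes the action multiplicative. -/
theorem pairAt_permutePairs (π : diagramAut) (a : Params) (i : Fin 7) :
    pairAt (permutePairs π a) i = pairAt a (π⁻¹.1 i) := by
  by_cases h : IsLeaf i
  · revert h
    fin_cases i
    all_goals first
      | exact fun _ => rfl
      | exact fun h => absurd h (by decide)
  · rw [pairAt_eq_zero _ h, pairAt_eq_zero _ (mt (diagramAut_isLeaf π⁻¹ i).1 h)]

theorem params_ext_pairAt {a b : Params} (hx : a.hx = b.hx) (hy : a.hy = b.hy)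
    (h : ∀ i, pairAt a i = pairAt b i) : a = b := by
  have h0 : (a.e1, a.e2) = (b.e1, b.e2) := h 0
  have h1 : (a.e5, a.e6) = (b.e5, b.e6) := h 1
  have h5 : (a.e3, a.e4) = (b.e3, b.e4) := h 5
  have h6 : (a.e7, a.e8) = (b.e7, b.e8) := h 6
  simp only [Prod.mk.injEq] at h0 h1 h5 h6
  ext
  · exact hx
  · exact hy
  · exact h0.1
  · exact h0.2
  · exact h5.1
  · exact h5.2
  · exact h1.1
  · exact h1.2
  · exact h6.1
  · exact h6.2

theorem permutePairs_one (a : Params) : permutePairs 1 a = a :=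
  params_ext_pairAt rfl rfl fun i => pairAt_permutePairs 1 a i

theorem permutePairs_mul (π ρ : diagramAut) (a : Params) :
    permutePairs (π * ρ) a = permutePairs π (permutePairs ρ a) :=
  params_ext_pairAt rfl rfl fun i => by
    rw [pairAt_permutePairs, pairAt_permutePairs, pairAt_permutePairs, mul_inv_rev]
    rfl

/-- The action of the diagram automorphisms on the parameters. -/
def diagramPerm : diagramAut →* Equiv.Perm Params where
  toFun π := ⟨permutePairs π, permutePairs π⁻¹,
    fun a => by rw [← permutePairs_mul, inv_mul_cancel, permutePairs_one],
    fun a => by rw [← permutePairs_mul, mul_inv_cancel, permutePairs_one]⟩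
  map_one' := Equiv.ext permutePairs_one
  map_mul' π ρ := Equiv.ext (permutePairs_mul π ρ)

theorem diagramPerm_rot (a : Params) : diagramPerm rot a =
    { a with e1 := a.e7, e2 := a.e8, e3 := a.e1, e4 := a.e2,
             e5 := a.e3, e6 := a.e4, e7 := a.e5, e8 := a.e6 } := by
  have h0 : rot⁻¹.1 0 = 6 := by decide
  have h1 : rot⁻¹.1 1 = 5 := by decide
  have h5 : rot⁻¹.1 5 = 0 := by decide
  have h6 : rot⁻¹.1 6 = 1 := by decide
  change permutePairs rot a = _
  simp only [permutePairs, h0, h1, h5, h6]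
  rfl

theorem diagramPerm_rot_mul_rot (a : Params) : diagramPerm (rot * rot) a =
    { a with e1 := a.e5, e2 := a.e6, e3 := a.e7, e4 := a.e8,
             e5 := a.e1, e6 := a.e2, e7 := a.e3, e8 := a.e4 } := by
  rw [map_mul, Equiv.Perm.mul_apply, diagramPerm_rot, diagramPerm_rot]

theorem diagramPerm_refl01 (a : Params) : diagramPerm refl01 a =
    { a with e1 := a.e5, e2 := a.e6, e5 := a.e1, e6 := a.e2 } := by
  have h0 : refl01⁻¹.1 0 = 1 := by decide
  have h1 : refl01⁻¹.1 1 = 0 := by decide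
  have h5 : refl01⁻¹.1 5 = 5 := by decide
  have h6 : refl01⁻¹.1 6 = 6 := by decide
  change permutePairs refl01 a = _
  simp only [permutePairs, h0, h1, h5, h6]
  rfl

/-- The formulas for the simple reflections on the parameters. -/
def simpleMap : Fin 7 → Params → Params :=
  ![fun a => { a with e1 := a.e2, e2 := a.e1 },
    fun a => { a with e5 := a.e6, e6 := a.e5 },
    fun a => { a with
      hx := a.hx + a.hy - a.e1 - a.e5, e1 := a.hy - a.e5, e5 := a.hy - a.e1 },
    fun a => { a with hx := a.hy, hy := a.hx },
    fun a => { a with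
      hx := a.hx + a.hy - a.e3 - a.e7, e3 := a.hy - a.e7, e7 := a.hy - a.e3 },
    fun a => { a with e3 := a.e4, e4 := a.e3 },
    fun a => { a with e7 := a.e8, e8 := a.e7 }]

theorem simpleMap_involutive (i : Fin 7) : Function.Involutive (simpleMap i) := by
  intro a
  fin_cases i <;> ext <;> simp [simpleMap] <;> ring

/-- The action of the simple reflections on the parameters. -/
def simplePerm (i : Fin 7) : Equiv.Perm Params :=
  Function.Involutive.toPerm (simpleMap i) (simpleMap_involutive i)

theorem simplePerm_apply (i : Fin 7) (a : Params) : simplePerm i a = simpleMap i a := rfl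

/-! ### Generic parameters -/

/-- The parameters `e₁, …, e₈` as a vector. -/
def eVec (a : Params) : Fin 8 → ℂ := ![a.e1, a.e2, a.e3, a.e4, a.e5, a.e6, a.e7, a.e8]

theorem pullback_eq (a : Params) (lx ly : ℤ) (m : Fin 8 → ℤ) :
    pullback a lx ly m = lx * a.hx + ly * a.hy + ∑ i, (m i : ℂ) * eVec a i := rfl

/-- Only the roots `E_i - E_j`, `E_i + E_j - H_x`, `E_i + E_j - H_y` and `H_x - H_y` are ever used.
Other roots matter only for stability of genericity under the group. -/
theorem Generic.sub {br : ℂ → ℂ} {a : Params} (h : Generic br a) (i j : Fin 8)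
    (hij : i ≠ j := by decide) : br (eVec a i - eVec a j) ≠ 0 := by
  have key := h 0 0 (fun k => (if k = i then 1 else 0) - (if k = j then 1 else 0))
    (by revert i j; decide) (by revert i j; decide)
  convert key using 2
  rw [pullback_eq]
  simp [sub_mul, Finset.sum_sub_distrib]

theorem Generic.add_sub_hx {br : ℂ → ℂ} {a : Params} (h : Generic br a) (i j : Fin 8)
    (hij : i ≠ j := by decide) : br (eVec a i + eVec a j - a.hx) ≠ 0 := by
  have key := h (-1) 0 (fun k => (if k = i then 1 else 0) + (if k = j then 1 else 0))
    (by revert i j; decide) (by revert i j; decide)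
  convert key using 2
  rw [pullback_eq]
  simp [add_mul, Finset.sum_add_distrib]
  ring

theorem Generic.add_sub_hy {br : ℂ → ℂ} {a : Params} (h : Generic br a) (i j : Fin 8)
    (hij : i ≠ j := by decide) : br (eVec a i + eVec a j - a.hy) ≠ 0 := by
  have key := h 0 (-1) (fun k => (if k = i then 1 else 0) + (if k = j then 1 else 0))
    (by revert i j; decide) (by revert i j; decide)
  convert key using 2
  rw [pullback_eq]
  simp [add_mul, Finset.sum_add_distrib]
  ring

theorem Generic.hx_sub_hy {br : ℂ → ℂ} {a : Params} (h : Generic br a) :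
    br (a.hx - a.hy) ≠ 0 := by
  have key := h 1 (-1) 0 (by simp) (by simp)
  convert key using 2
  simp [pullback_eq, sub_eq_add_neg]

theorem generic_of_pullback {br : ℂ → ℂ} {a b : Params} (h : Generic br a)
    (hp : ∀ (lx ly : ℤ) (m : Fin 8 → ℤ), 2 * lx * ly - ∑ i, m i ^ 2 = -2 →
      2 * lx + 2 * ly + ∑ i, m i = 0 → ∃ (lx' ly' : ℤ) (m' : Fin 8 → ℤ),
        2 * lx' * ly' - ∑ i, m' i ^ 2 = -2 ∧ 2 * lx' + 2 * ly' + ∑ i, m' i = 0 ∧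
          pullback b lx ly m = pullback a lx' ly' m') : Generic br b := by
  intro lx ly m h1 h2
  obtain ⟨lx', ly', m', h1', h2', he⟩ := hp lx ly m h1 h2
  rw [he]
  exact h lx' ly' m' h1' h2'

/-- The parameter map is dual to a reflection of the lattice, which keeps the intersection form and
the degree against `K`. For `β₂` it is the reflection in `H_y - E₁ - E₅`, for `β₄` in `H_y - E₃ -
E₇`; the witnesses are the reflected coefficients. -/
theorem pullback_simplePerm (i : Fin 7) (a : Params) (lx ly : ℤ) (m : Fin 8 → ℤ)
    (h1 : 2 * lx * ly - ∑ i, m i ^ 2 = -2) (h2 : 2 * lx + 2 * ly + ∑ i, m i = 0) :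
    ∃ (lx' ly' : ℤ) (m' : Fin 8 → ℤ),
      2 * lx' * ly' - ∑ i, m' i ^ 2 = -2 ∧ 2 * lx' + 2 * ly' + ∑ i, m' i = 0 ∧
        pullback (simplePerm i a) lx ly m = pullback a lx' ly' m' := by
  simp only [Fin.sum_univ_eight] at h1 h2
  fin_cases i
  · refine ⟨lx, ly, ![m 1, m 0, m 2, m 3, m 4, m 5, m 6, m 7], ?_, ?_, ?_⟩ <;>
      simp [Fin.sum_univ_eight, pullback, simplePerm_apply, simpleMap] <;>
      first
      | linear_combination h1
      | linear_combination h2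
      | ring
  · refine ⟨lx, ly, ![m 0, m 1, m 2, m 3, m 5, m 4, m 6, m 7], ?_, ?_, ?_⟩ <;>
      simp [Fin.sum_univ_eight, pullback, simplePerm_apply, simpleMap] <;>
      first
      | linear_combination h1
      | linear_combination h2
      | ring
  · refine ⟨lx, lx + ly + m 0 + m 4,
      ![-lx - m 4, m 1, m 2, m 3, -lx - m 0, m 5, m 6, m 7], ?_, ?_, ?_⟩ <;>
      simp [Fin.sum_univ_eight, pullback, simplePerm_apply, simpleMap] <;>
      first
      | linear_combination h1
      | linear_combination h2
      | ring
  · refine ⟨ly, lx, m, ?_, ?_, ?_⟩ <;>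
      simp [Fin.sum_univ_eight, pullback, simplePerm_apply, simpleMap] <;>
      first
      | linear_combination h1
      | linear_combination h2
      | ring
  · refine ⟨lx, lx + ly + m 2 + m 6,
      ![m 0, m 1, -lx - m 6, m 3, m 4, m 5, -lx - m 2, m 7], ?_, ?_, ?_⟩ <;>
      simp [Fin.sum_univ_eight, pullback, simplePerm_apply, simpleMap] <;>
      first
      | linear_combination h1
      | linear_combination h2
      | ring
  · refine ⟨lx, ly, ![m 0, m 1, m 3, m 2, m 4, m 5, m 6, m 7], ?_, ?_, ?_⟩ <;>
      simp [Fin.sum_univ_eight, pullback, simplePerm_apply, simpleMap] <;>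
      first
      | linear_combination h1
      | linear_combination h2
      | ring
  · refine ⟨lx, ly, ![m 0, m 1, m 2, m 3, m 4, m 5, m 7, m 6], ?_, ?_, ?_⟩ <;>
      simp [Fin.sum_univ_eight, pullback, simplePerm_apply, simpleMap] <;>
      first
      | linear_combination h1
      | linear_combination h2
      | ring

theorem generic_simplePerm {br : ℂ → ℂ} (i : Fin 7) (a : Params) :
    Generic br (simplePerm i a) ↔ Generic br a := by
  have key : ∀ a, Generic br a → Generic br (simplePerm i a) :=
    fun a h => generic_of_pullback h fun lx ly m => pullback_simplePerm i a lx ly m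
  refine ⟨fun h => ?_, key a⟩
  have := key _ h
  rwa [simplePerm_apply, simplePerm_apply, simpleMap_involutive i a] at this

theorem generic_rot {br : ℂ → ℂ} {a : Params} (h : Generic br a) :
    Generic br (diagramPerm rot a) := by
  refine generic_of_pullback h fun lx ly m h1 h2 =>
    ⟨lx, ly, ![m 2, m 3, m 4, m 5, m 6, m 7, m 0, m 1], ?_, ?_, ?_⟩ <;>
  simp only [Fin.sum_univ_eight] at h1 h2 <;>
  simp [Fin.sum_univ_eight, pullback, diagramPerm_rot] <;>
      first
      | linear_combination h1
      | linear_combination h2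
      | ring

theorem generic_refl01 {br : ℂ → ℂ} {a : Params} (h : Generic br a) :
    Generic br (diagramPerm refl01 a) := by
  refine generic_of_pullback h fun lx ly m h1 h2 =>
    ⟨lx, ly, ![m 4, m 5, m 2, m 3, m 0, m 1, m 6, m 7], ?_, ?_, ?_⟩ <;>
  simp only [Fin.sum_univ_eight] at h1 h2 <;>
  simp [Fin.sum_univ_eight, pullback, diagramPerm_refl01] <;>
      first
      | linear_combination h1
      | linear_combination h2
      | ring

theorem generic_diagramPerm {br : ℂ → ℂ} (π : diagramAut) (a : Params) :
    Generic br (diagramPerm π a) ↔ Generic br a := by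
  have key : ∀ (π : diagramAut) a, Generic br a → Generic br (diagramPerm π a) := fun π a h => by
    induction π using diagramAut_induction with
    | one => exact (permutePairs_one a).symm ▸ h
    | hrot π ih => rw [map_mul]; exact generic_rot ih
    | hrefl π ih => rw [map_mul]; exact generic_refl01 ih
  refine ⟨fun h => ?_, key π a⟩
  have := key π⁻¹ _ h
  rwa [← Equiv.Perm.mul_apply, ← map_mul, inv_mul_cancel, map_one] at this

/-! ### The constraints -/

theorem inLattice_neg {τ z : ℂ} (h : inLattice τ z) : inLattice τ (-z) := by
  obtain ⟨m, n, rfl⟩ := h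
  exact ⟨-m, -n, by push_cast; ring⟩

/-- Both combinations are invariant already in `ℂ`, not merely modulo the lattice. The diagram
generators below keep them up to sign and exchange. -/
theorem constraints_simplePerm {τ : ℂ} (i : Fin 7) {a : Params} (h : Constraints τ a) :
    Constraints τ (simplePerm i a) := by
  have h1 : (simpleMap i a).e1 + (simpleMap i a).e2 - (simpleMap i a).e5 - (simpleMap i a).e6 =
      a.e1 + a.e2 - a.e5 - a.e6 := by
    fin_cases i <;> simp [simpleMap] <;> ring
  have h2 : (simpleMap i a).e3 + (simpleMap i a).e4 - (simpleMap i a).e7 - (simpleMap i a).e8 =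
      a.e3 + a.e4 - a.e7 - a.e8 := by
    fin_cases i <;> simp [simpleMap] <;> ring
  unfold Constraints
  rw [simplePerm_apply, h1, h2]
  exact h

theorem constraints_rot {τ : ℂ} {a : Params} (h : Constraints τ a) :
    Constraints τ (diagramPerm rot a) := by
  rw [diagramPerm_rot]
  refine ⟨?_, h.1⟩
  convert inLattice_neg h.2 using 1
  simp only
  ring

theorem constraints_refl01 {τ : ℂ} {a : Params} (h : Constraints τ a) :
    Constraints τ (diagramPerm refl01 a) := by
  rw [diagramPerm_refl01]
  refine ⟨?_, h.2⟩
  convert inLattice_neg h.1 using 1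
  simp only
  ring

/-! ### Automorphisms of `ℂ(x, y)` that fix `y` -/

/-- The field `ℂ(y)`. -/
abbrev fieldY : IntermediateField ℂ RatXY := IntermediateField.adjoin ℂ {coordY}

/-- The automorphism `φ` fixes `y` and acts on `x` by the fractional linear transformation `N`. -/
def ActsBy (φ : RatXY ≃ₐ[ℂ] RatXY) (N : Matrix (Fin 2) (Fin 2) RatXY) : Prop :=
  φ coordY = coordY ∧ φ coordX * (N 1 0 * coordX + N 1 1) = N 0 0 * coordX + N 0 1

theorem algEquiv_fix_fieldY {φ : RatXY ≃ₐ[ℂ] RatXY} (hφ : φ coordY = coordY) {w : RatXY}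
    (hw : w ∈ fieldY) : φ w = w := by
  have h : fieldY ≤ (AlgHom.equalizer (φ : RatXY →ₐ[ℂ] RatXY) (AlgHom.id ℂ RatXY)).toIntermediateField
      (fun x hx => by
        rw [AlgHom.mem_equalizer] at hx ⊢
        rw [map_inv₀, map_inv₀, hx]) := by
    rw [IntermediateField.adjoin_le_iff]
    rintro z rfl
    exact hφ
  exact h hw

/-- If the denominator vanished, so would the numerator, and `(x, 1)` would be a kernel vector of an
invertible matrix. -/
theorem ActsBy.denom_ne_zero {φ : RatXY ≃ₐ[ℂ] RatXY} {N : Matrix (Fin 2) (Fin 2) RatXY}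
    (h : ActsBy φ N) (hN : N.det ≠ 0) : N 1 0 * coordX + N 1 1 ≠ 0 := by
  intro h0
  have h1 := h.2
  rw [h0, mul_zero] at h1
  apply hN
  rw [Matrix.det_fin_two]
  have hx : (N 0 0 * N 1 1 - N 0 1 * N 1 0) * coordX = 0 := by
    linear_combination (N 1 1) * (-h1) + N 0 1 * (-h0)
  have hone : (N 0 0 * N 1 1 - N 0 1 * N 1 0) * 1 = 0 := by
    linear_combination (N 1 0) * h1 + N 0 0 * h0
  simpa using hone

/-- The fractional linear equation can be solved back for `x`, so the proposed image of `x` and `y`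
generate the whole field. -/
theorem exists_actsBy {N : Matrix (Fin 2) (Fin 2) RatXY} (hN : N.det ≠ 0)
    (hmem : ∀ i j, N i j ∈ fieldY) : ∃ φ, ActsBy φ N := by
  have hd : N 1 0 * coordX + N 1 1 ≠ 0 := by
    intro h0
    obtain ⟨h1, h2⟩ := eq_zero_of_mul_coordX_add (hmem 1 0) (hmem 1 1) h0
    apply hN
    rw [Matrix.det_fin_two, h1, h2]
    ring
  set p := (N 0 0 * coordX + N 0 1) / (N 1 0 * coordX + N 1 1) with hp
  have hp' : p * (N 1 0 * coordX + N 1 1) = N 0 0 * coordX + N 0 1 := div_mul_cancel₀ _ hd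
  set F := IntermediateField.adjoin ℂ {p, coordY}
  have hyF : coordY ∈ F := IntermediateField.subset_adjoin _ _ (by simp)
  have hpF : p ∈ F := IntermediateField.subset_adjoin _ _ (by simp)
  have hle : fieldY ≤ F := by
    rw [IntermediateField.adjoin_le_iff]
    rintro z rfl
    exact hyF
  have hNF : ∀ i j, N i j ∈ F := fun i j => hle (hmem i j)
  have hxF : coordX ∈ F := by
    have h1 : p * N 1 0 - N 0 0 ≠ 0 := by
      intro h0
      apply hN
      rw [Matrix.det_fin_two]
      linear_combination N 1 0 * hp' - N 1 1 * h0 - N 1 0 * coordX * h0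
    have h2 : coordX = (N 0 1 - p * N 1 1) / (p * N 1 0 - N 0 0) := by
      rw [eq_div_iff h1]
      linear_combination hp'
    rw [h2]
    exact F.div_mem (F.sub_mem (hNF 0 1) (F.mul_mem hpF (hNF 1 1)))
      (F.sub_mem (F.mul_mem hpF (hNF 1 0)) (hNF 0 0))
  obtain ⟨φ, hx, hy⟩ := exists_algEquiv hxF hyF
  exact ⟨φ, hy, hx.symm ▸ hp'⟩

/-- The order is reversed: `φ₁` fixes the entries of `N₂` and substitutes the `N₁`-image of `x` into
the fraction given by `N₂`. -/
theorem ActsBy.mul {φ₁ φ₂ : RatXY ≃ₐ[ℂ] RatXY} {N₁ N₂ : Matrix (Fin 2) (Fin 2) RatXY}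
    (h₁ : ActsBy φ₁ N₁) (h₂ : ActsBy φ₂ N₂) (hmem : ∀ i j, N₂ i j ∈ fieldY) (hN : N₁.det ≠ 0) :
    ActsBy (φ₁ * φ₂) (N₂ * N₁) := by
  refine ⟨by rw [AlgEquiv.mul_apply, h₂.1, h₁.1], ?_⟩
  have hd := h₁.denom_ne_zero hN
  have h := congrArg φ₁ h₂.2
  simp only [map_mul, map_add, algEquiv_fix_fieldY h₁.1 (hmem _ _)] at h
  rw [AlgEquiv.mul_apply]
  simp only [Matrix.mul_apply, Fin.sum_univ_two]
  have h1 := h₁.2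
  linear_combination (N₁ 1 0 * coordX + N₁ 1 1) * h + (N₂ 0 0 - φ₁ (φ₂ coordX) * N₂ 1 0) * h1

theorem ActsBy.unique {φ₁ φ₂ : RatXY ≃ₐ[ℂ] RatXY} {N₁ N₂ : Matrix (Fin 2) (Fin 2) RatXY}
    (h₁ : ActsBy φ₁ N₁) (h₂ : ActsBy φ₂ N₂) (hN₁ : N₁.det ≠ 0) {k₁ k₂ : RatXY} (hk₁ : k₁ ≠ 0)
    (hk : k₁ • N₁ = k₂ • N₂) : φ₁ = φ₂ := by
  have hij : ∀ i j, k₁ * N₁ i j = k₂ * N₂ i j := fun i j => congrFun (congrFun hk i) j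
  have hd := mul_ne_zero hk₁ (h₁.denom_ne_zero hN₁)
  refine algEquiv_ext_coord (mul_right_cancel₀ hd ?_) (h₁.1.trans h₂.1.symm)
  have h1 := h₁.2
  have h2 := h₂.2
  linear_combination k₁ * h1 - k₂ * h2 + coordX * hij 0 0 + hij 0 1 -
    φ₂ coordX * coordX * hij 1 0 - φ₂ coordX * hij 1 1

theorem actsBy_one : ActsBy 1 1 := by
  refine ⟨rfl, ?_⟩
  simp

/-! ### Elementary transformations -/

/-- The matrix over `ℂ[y]` of the transformation that blows up the two points with parameters
`p`, `q` and contracts the fibres of `y` through them. -/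
def elemMat {L : Type} [CommRing L] [Algebra ℂ L] (f g : ℂ → ℂ) (hx hy p q : ℂ) (y : L) :
    Matrix (Fin 2) (Fin 2) L :=
  let c := algebraMap ℂ L
  let A := y * c (g (p - hy / 2)) - c (f (p - hy / 2))
  let B := y * c (g (q - hy / 2)) - c (f (q - hy / 2))
  -- With `h = h_x + h_y - p - q`, the new `h_x`, these are `(h_y - q) - h / 2` and `(h_y - p) - h /
  -- 2`, the intrinsic arguments of the new base points.
  let v := (hy - hx - q + p) / 2
  let w := (hy - hx - p + q) / 2
  !![A * c (f v * g (q - hx / 2)) - B * c (f w * g (p - hx / 2)),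
      B * c (f w * f (p - hx / 2)) - A * c (f v * f (q - hx / 2));
    A * c (g v * g (q - hx / 2)) - B * c (g w * g (p - hx / 2)),
      B * c (g w * f (p - hx / 2)) - A * c (g v * f (q - hx / 2))]

/-- Base change lets one matrix be used over `ℂ` at points of the curve, over `ℂ[y]` for identities,
and over `ℂ(x, y)` for automorphisms. -/
theorem elemMat_map {L L' : Type} [CommRing L] [Algebra ℂ L] [CommRing L'] [Algebra ℂ L']
    (φ : L →ₐ[ℂ] L') (f g : ℂ → ℂ) (hx hy p q : ℂ) (y : L) :
    φ.mapMatrix (elemMat f g hx hy p q y) = elemMat f g hx hy p q (φ y) := by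
  ext i j
  fin_cases i <;> fin_cases j <;>
    simp [elemMat, AlgHom.mapMatrix_apply, Matrix.map_apply, AlgHom.commutes]

theorem elemMat_swap {L : Type} [CommRing L] [Algebra ℂ L] (f g : ℂ → ℂ) (hx hy p q : ℂ) (y : L) :
    elemMat f g hx hy q p y = -elemMat f g hx hy p q y := by
  ext i j
  fin_cases i <;> fin_cases j <;> simp [elemMat]

/-! ### Identities on the curve, off discrete sets -/

theorem eventually_nhdsNE_of_codiscrete {P : ℂ → Prop} (h : ∀ᶠ u in Filter.codiscrete ℂ, P u)
    (x : ℂ) : ∀ᶠ u in nhdsWithin x {x}ᶜ, P u := by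
  have := mem_codiscrete.1 h x
  rwa [Filter.disjoint_principal_right, compl_compl] at this

instance : (Filter.codiscrete ℂ).NeBot :=
  ⟨fun h => by
    have h1 : ∀ᶠ u in Filter.codiscrete ℂ, False := by rw [h]; exact Filter.mem_bot
    exact (eventually_nhdsNE_of_codiscrete h1 0).exists.elim fun _ h => h⟩

namespace AddFormula

variable {br f g : ℂ → ℂ} (hb : AddFormula br f g)

include hb

/-- Exchanging the two vectors changes the sign of their determinant, while `v - p` becomes `p - v`.
-/
theorem neg (u : ℂ) : br (-u) = -br u := by
  by_cases h : ∃ w, br w ≠ 0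
  · obtain ⟨w, hw⟩ := h
    have h1 := hb.mul_eq ((w + u) / 2) ((w - u) / 2)
    have h2 := hb.mul_eq ((w - u) / 2) ((w + u) / 2)
    rw [show (w + u) / 2 + (w - u) / 2 = w by ring, show (w + u) / 2 - (w - u) / 2 = u by ring] at h1
    rw [show (w - u) / 2 + (w + u) / 2 = w by ring,
      show (w - u) / 2 - (w + u) / 2 = -u by ring] at h2
    apply mul_left_cancel₀ hw
    linear_combination h1 + h2
  · push Not at h
    rw [h, h, neg_zero]

theorem mul_eq' {v p a b : ℂ} (ha : a = v + p) (hb' : b = v - p) :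
    br a * br b = f v * g p - g v * f p := by
  rw [ha, hb', hb.mul_eq]

theorem br_swap (u v : ℂ) : br (u - v) = -br (v - u) := by
  rw [← hb.neg, neg_sub]

/-- On the curve each linear form splits into two brackets. Up to the common factor `[u - p] [u - q]
/ g`, the image becomes `(z ∧ w) v - (z ∧ v) w`, where `z` is the point of the new curve and `v`,
`w` are the two column vectors of the matrix. In dimension two this equals `(v ∧ w) z`, and `v ∧ w =
[h_y - h_x] [p - q]`. -/
theorem elemMat_mulVec (hx hy p q u : ℂ) (h0 : g (u - hy / 2) ≠ 0) :
    (elemMat f g hx hy p q (f (u - hy / 2) / g (u - hy / 2))).mulVec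
        ![f (u - hx / 2), g (u - hx / 2)] =
      (br (u - p) * br (u - q) * br (hy - hx) * br (p - q) / g (u - hy / 2)) •
        ![f (u - (hx + hy - p - q) / 2), g (u - (hx + hy - p - q) / 2)] := by
  set w := u - hy / 2
  set v := u - hx / 2
  set z := u - (hx + hy - p - q) / 2
  set E := (hy - hx - q + p) / 2 with hE
  set E' := (hy - hx - p + q) / 2 with hE'
  have hAq : br (u + q - hx) * br (u - q) = f v * g (q - hx / 2) - g v * f (q - hx / 2) :=
    hb.mul_eq' (by simp only [v]; ring) (by simp only [v]; ring)
  have hAp : br (u + p - hx) * br (u - p) = f v * g (p - hx / 2) - g v * f (p - hx / 2) :=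
    hb.mul_eq' (by simp only [v]; ring) (by simp only [v]; ring)
  have hBq : br (u + q - hy) * br (u - q) = f w * g (q - hy / 2) - g w * f (q - hy / 2) :=
    hb.mul_eq' (by simp only [w]; ring) (by simp only [w]; ring)
  have hBp : br (u + p - hy) * br (u - p) = f w * g (p - hy / 2) - g w * f (p - hy / 2) :=
    hb.mul_eq' (by simp only [w]; ring) (by simp only [w]; ring)
  have hC : br (u + q - hx) * br (u + p - hy) = f z * g E' - g z * f E' :=
    hb.mul_eq' (by simp only [z, E']; ring) (by simp only [z, E']; ring)
  have hC' : br (u + p - hx) * br (u + q - hy) = f z * g E - g z * f E :=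
    hb.mul_eq' (by simp only [z, E]; ring) (by simp only [z, E]; ring)
  have hD : br (hy - hx) * br (p - q) = f E * g E' - g E * f E' :=
    hb.mul_eq' (by simp only [E, E']; ring) (by simp only [E, E']; ring)
  have e1 : f w / g w * g (p - hy / 2) - f (p - hy / 2) =
      br (u + p - hy) * br (u - p) / g w := by rw [hBp]; field_simp
  have e2 : f w / g w * g (q - hy / 2) - f (q - hy / 2) =
      br (u + q - hy) * br (u - q) / g w := by rw [hBq]; field_simp
  ext i
  fin_cases i
  · simp only [elemMat, Algebra.algebraMap_self, RingHom.id_apply, ← hE, ← hE', e1, e2,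
      Matrix.mulVec, dotProduct, Fin.sum_univ_two, Fin.zero_eta, Pi.smul_apply, smul_eq_mul,
      Matrix.cons_val_zero, Matrix.cons_val_one, Matrix.of_apply]
    generalize p - hx / 2 = p' at hAp ⊢
    generalize q - hx / 2 = q' at hAq ⊢
    field_simp
    linear_combination (-br (u + p - hy) * br (u - p) * f E) * hAq +
      (br (u + q - hy) * br (u - q) * f E') * hAp + br (u - p) * br (u - q) * f E * hC -
      br (u - p) * br (u - q) * f E' * hC' - br (u - p) * br (u - q) * f z * hD
  · simp only [elemMat, Algebra.algebraMap_self, RingHom.id_apply, ← hE, ← hE', e1, e2,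
      Matrix.mulVec, dotProduct, Fin.sum_univ_two, Fin.mk_one, Pi.smul_apply, smul_eq_mul,
      Matrix.cons_val_zero, Matrix.cons_val_one, Matrix.of_apply]
    generalize p - hx / 2 = p' at hAp ⊢
    generalize q - hx / 2 = q' at hAq ⊢
    field_simp
    linear_combination (-br (u + p - hy) * br (u - p) * g E) * hAq +
      (br (u + q - hy) * br (u - q) * g E') * hAp + br (u - p) * br (u - q) * g E * hC -
      br (u - p) * br (u - q) * g E' * hC' - br (u - p) * br (u - q) * g z * hD

theorem eventually_comp_ne_zero {z : ℂ} (hz : br z ≠ 0) (s : ℂ) {m : ℂ} (hm : m ≠ 0) :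
    ∀ᶠ u in Filter.codiscrete ℂ, br (m * u + s) ≠ 0 := by
  have h : AnalyticOnNhd ℂ (fun u => br (m * u + s)) Set.univ := fun u _ =>
    Differentiable.analyticAt (hb.diff.comp (by fun_prop)) u
  refine h.preimage_zero_mem_codiscrete (x := (z - s) / m) ?_
  rwa [show m * ((z - s) / m) + s = z by field_simp; ring]

theorem eventually_add_ne_zero {z : ℂ} (hz : br z ≠ 0) (s : ℂ) :
    ∀ᶠ u in Filter.codiscrete ℂ, br (u + s) ≠ 0 := by
  simpa using hb.eventually_comp_ne_zero hz s one_ne_zero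

theorem eventually_sub_ne_zero {z : ℂ} (hz : br z ≠ 0) (s : ℂ) :
    ∀ᶠ u in Filter.codiscrete ℂ, br (u - s) ≠ 0 := by
  simpa [sub_eq_add_neg] using hb.eventually_add_ne_zero hz (-s)

/-- If `g w = 0`, the determinant with `w` vanishes at every zero of `g`, so zeros of `g` are zeros
of translates of `br`. No regularity of `g` is needed. -/
theorem eventually_g_ne_zero {z : ℂ} (hz : br z ≠ 0) (s : ℂ) :
    ∀ᶠ u in Filter.codiscrete ℂ, g (u - s) ≠ 0 := by
  by_cases h : ∃ w, g w = 0
  · obtain ⟨w, hw⟩ := h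
    filter_upwards [hb.eventually_add_ne_zero hz (-s + w), hb.eventually_add_ne_zero hz (-s - w)]
      with u h1 h2 h0
    have := hb.mul_eq (u - s) w
    rw [hw, h0, show u - s + w = u + (-s + w) by ring, show u - s - w = u + (-s - w) by ring] at this
    exact mul_ne_zero h1 h2 (by simpa using this)
  · push Not at h
    exact Filter.Eventually.of_forall fun u => h _

/-- The quotient `f / g` takes infinitely many values outside a discrete set. -/
theorem infinite_quotient {z : ℂ} (hz : br z ≠ 0) (s : ℂ) {P : ℂ → Prop}
    (hP : ∀ᶠ u in Filter.codiscrete ℂ, P u) :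
    {t | ∃ u, P u ∧ g (u - s) ≠ 0 ∧ t = f (u - s) / g (u - s)}.Infinite := by
  intro hfin
  -- The value attained at `w` recurs at `u` only if `[u + w - 2 s] [u - w] = 0`, hence only on a
  -- discrete set.
  have h : ∀ t ∈ hfin.toFinset, ∀ᶠ u in Filter.codiscrete ℂ,
      g (u - s) ≠ 0 → t ≠ f (u - s) / g (u - s) := by
    intro t ht
    obtain ⟨w, -, hw, rfl⟩ := hfin.mem_toFinset.1 ht
    filter_upwards [hb.eventually_add_ne_zero hz (w - 2 * s), hb.eventually_sub_ne_zero hz w]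
      with u h1 h2 hu he
    have := hb.mul_eq' (v := u - s) (p := w - s) (a := u + (w - 2 * s)) (b := u - w)
      (by ring) (by ring)
    rw [div_eq_div_iff hw hu] at he
    exact mul_ne_zero h1 h2 (by rw [this]; linear_combination -he)
  have h2 := (Filter.eventually_all_finset hfin.toFinset).2 h
  obtain ⟨u, hu1, hu2, hu3⟩ := (h2.and (hP.and (hb.eventually_g_ne_zero hz s))).exists
  exact hu1 _ (hfin.mem_toFinset.2 ⟨u, hu2, hu3, rfl⟩) hu3 rfl

/-- A matrix of polynomials in `y` that annihilates the curve is zero. -/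
theorem polyMatrix_eq_zero {hx hy : ℂ} (h0 : br (hx - hy) ≠ 0)
    (D : Matrix (Fin 2) (Fin 2) (Polynomial ℂ))
    (hD : ∀ u, g (u - hy / 2) ≠ 0 →
      ((Polynomial.aeval (f (u - hy / 2) / g (u - hy / 2))).mapMatrix D).mulVec
        ![f (u - hx / 2), g (u - hx / 2)] = 0) : D = 0 := by
  ext1 i j
  -- The condition `[2 u - h_y] ≠ 0` avoids the parameters where `u` and `h_y - u` give the same
  -- point.
  have hinf := hb.infinite_quotient h0 (hy / 2) (hb.eventually_comp_ne_zero h0 (-hy) two_ne_zero)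
  refine Polynomial.eq_zero_of_infinite_isRoot _ (hinf.mono ?_)
  rintro t ⟨u, hu1, hu2, rfl⟩
  have e : hy - u - hy / 2 = -(u - hy / 2) := by ring
  have h1 := congrFun (hD u hu2) i
  have h2 := hD (hy - u) (by rw [e, hb.g_neg]; exact hu2)
  rw [e, hb.g_neg, hb.f_neg] at h2
  have h2 := congrFun h2 i
  set t := f (u - hy / 2) / g (u - hy / 2)
  simp only [Matrix.mulVec, dotProduct, Fin.sum_univ_two, Matrix.cons_val_zero,
    Matrix.cons_val_one, Pi.zero_apply, AlgHom.mapMatrix_apply, Matrix.map_apply,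
    Polynomial.coe_aeval_eq_eval] at h1 h2
  -- The vectors at `u` and `h_y - u` lie over the same `y`. Their determinant is `[h_y - h_x] [2 u
  -- - h_y]`, so the row, which annihilates both, is zero.
  have hdet : f (u - hx / 2) * g (hy - u - hx / 2) - g (u - hx / 2) * f (hy - u - hx / 2) ≠ 0 := by
    rw [← hb.mul_eq, show u - hx / 2 + (hy - u - hx / 2) = -(hx - hy) by ring, hb.neg,
      show u - hx / 2 - (hy - u - hx / 2) = 2 * u + -hy by ring]
    exact mul_ne_zero (neg_ne_zero.2 h0) hu1
  have h3 : ∀ k, (D i k).eval t = 0 := by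
    rw [Fin.forall_fin_two]
    constructor
    · apply (mul_eq_zero.1 (_ : _ * (f (u - hx / 2) * g (hy - u - hx / 2) -
        g (u - hx / 2) * f (hy - u - hx / 2)) = 0)).resolve_right hdet
      linear_combination g (hy - u - hx / 2) * h1 - g (u - hx / 2) * h2
    · apply (mul_eq_zero.1 (_ : _ * (f (u - hx / 2) * g (hy - u - hx / 2) -
        g (u - hx / 2) * f (hy - u - hx / 2)) = 0)).resolve_right hdet
      linear_combination -f (hy - u - hx / 2) * h1 + f (u - hx / 2) * h2
  exact h3 j

end AddFormula

theorem elemMat_mem_fieldY (f g : ℂ → ℂ) (hx hy p q : ℂ) (i j : Fin 2) :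
    elemMat f g hx hy p q coordY i j ∈ fieldY := by
  have h := elemMat_map fieldY.val f g hx hy p q
    (⟨coordY, IntermediateField.subset_adjoin _ _ rfl⟩ : fieldY)
  change fieldY.val.mapMatrix _ = elemMat f g hx hy p q coordY at h
  rw [← h]
  exact SetLike.coe_mem _

theorem algEquiv_elemMat (f g : ℂ → ℂ) (ψ : RatXY ≃ₐ[ℂ] RatXY) (hx hy p q : ℂ) (y : RatXY)
    (i j : Fin 2) : ψ (elemMat f g hx hy p q y i j) = elemMat f g hx hy p q (ψ y) i j :=
  congrFun (congrFun (elemMat_map (ψ : RatXY →ₐ[ℂ] RatXY) f g hx hy p q y) i) j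

/-- The linear form in `y` that vanishes at the fibre through the point with parameter `p`. -/
def etaForm {L : Type} [CommRing L] [Algebra ℂ L] (f g : ℂ → ℂ) (h p : ℂ) (y : L) : L :=
  y * algebraMap ℂ L (g (p - h / 2)) - algebraMap ℂ L (f (p - h / 2))

theorem etaForm_map {L L' : Type} [CommRing L] [Algebra ℂ L] [CommRing L'] [Algebra ℂ L']
    (φ : L →ₐ[ℂ] L') (f g : ℂ → ℂ) (h p : ℂ) (y : L) :
    φ (etaForm f g h p y) = etaForm f g h p (φ y) := by
  simp [etaForm, AlgHom.commutes]

/-- The matrix factors into its column vectors at the new base points, the diagonal of the two fibre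
forms with one sign, and the linear forms in `x` at `q`, `p`. -/
theorem det_elemMat {L : Type} [CommRing L] [Algebra ℂ L] (f g : ℂ → ℂ) (hx hy p q : ℂ) (y : L) :
    (elemMat f g hx hy p q y).det = -(etaForm f g hy p y * etaForm f g hy q y) *
      algebraMap ℂ L ((f ((hy - hx - q + p) / 2) * g ((hy - hx - p + q) / 2) -
        g ((hy - hx - q + p) / 2) * f ((hy - hx - p + q) / 2)) *
        (f (q - hx / 2) * g (p - hx / 2) - g (q - hx / 2) * f (p - hx / 2))) := by
  simp only [Matrix.det_fin_two, elemMat, etaForm, Matrix.of_apply, Matrix.cons_val_zero,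
    Matrix.cons_val_one, map_mul, map_sub]
  ring

/-- The conditions under which the elementary transformation is invertible. -/
structure ElemGeneric (br : ℂ → ℂ) (hx hy p q : ℂ) : Prop where
  sub : br (p - q) ≠ 0
  addx : br (p + q - hx) ≠ 0
  addy : br (p + q - hy) ≠ 0
  h : br (hx - hy) ≠ 0

namespace AddFormula

variable {br f g : ℂ → ℂ} (hb : AddFormula br f g)

include hb

theorem wedge_ne_zero {h p q : ℂ} (h1 : br (p - q) ≠ 0) (h2 : br (p + q - h) ≠ 0) :
    f (p - h / 2) * g (q - h / 2) - g (p - h / 2) * f (q - h / 2) ≠ 0 := by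
  rw [← hb.mul_eq, show p - h / 2 + (q - h / 2) = p + q - h by ring,
    show p - h / 2 - (q - h / 2) = p - q by ring]
  exact mul_ne_zero h2 h1

theorem etaForm_ne_zero {h p q : ℂ} (h1 : br (p - q) ≠ 0) (h2 : br (p + q - h) ≠ 0) :
    etaForm f g h p coordY ≠ 0 := by
  intro h0
  have h3 : const (g (p - h / 2)) * coordY + const (-f (p - h / 2)) = 0 := by
    rw [← h0, etaForm, const, const, map_neg]
    ring
  obtain ⟨h4, h5⟩ := eq_zero_of_const_mul_coordY_add h3
  apply hb.wedge_ne_zero h1 h2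
  rw [h4, neg_eq_zero.1 h5]
  ring

theorem det_elemMat_ne_zero {hx hy p q : ℂ} (h : ElemGeneric br hx hy p q) :
    (elemMat f g hx hy p q coordY).det ≠ 0 := by
  have h1 : br (q - p) ≠ 0 := by
    rw [hb.br_swap]
    exact neg_ne_zero.2 h.sub
  rw [det_elemMat]
  refine mul_ne_zero (neg_ne_zero.2 (mul_ne_zero (hb.etaForm_ne_zero h.sub h.addy)
    (hb.etaForm_ne_zero h1 (by rw [add_comm]; exact h.addy)))) ?_
  rw [Ne, map_eq_zero_iff _ (algebraMap ℂ RatXY).injective]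
  refine mul_ne_zero ?_ (hb.wedge_ne_zero h1 (by rw [add_comm]; exact h.addx))
  rw [← hb.mul_eq' (a := hy - hx) (b := p - q) (by ring) (by ring), hb.br_swap]
  exact mul_ne_zero (neg_ne_zero.2 h.h) h.sub

end AddFormula

open Classical in
/-- An automorphism with a given property, if there is one. -/
def autOf (P : (RatXY ≃ₐ[ℂ] RatXY) → Prop) : RatXY ≃ₐ[ℂ] RatXY :=
  if h : ∃ φ, P φ then h.choose else 1

theorem autOf_spec {P : (RatXY ≃ₐ[ℂ] RatXY) → Prop} (h : ∃ φ, P φ) : P (autOf P) := by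
  rw [autOf, dif_pos h]
  exact h.choose_spec

/-- The automorphism of `ℂ(x, y)` of the elementary transformation at the points with parameters
`p`, `q`. -/
def elemAut (f g : ℂ → ℂ) (hx hy p q : ℂ) : RatXY ≃ₐ[ℂ] RatXY :=
  autOf fun φ => ActsBy φ (elemMat f g hx hy p q coordY)

/-- The two matrices differ by a sign, so the defining predicates coincide and the same automorphism
is chosen, for all parameters. -/
theorem elemAut_swap (f g : ℂ → ℂ) (hx hy p q : ℂ) :
    elemAut f g hx hy q p = elemAut f g hx hy p q := by
  have h : ∀ φ, ActsBy φ (elemMat f g hx hy q p coordY) ↔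
      ActsBy φ (elemMat f g hx hy p q coordY) := by
    intro φ
    rw [elemMat_swap f g hx hy p q]
    refine and_congr_right fun _ => ?_
    simp only [Matrix.neg_apply]
    constructor <;> intro h <;> linear_combination -h
  exact congrArg autOf (funext fun φ => propext (h φ))

namespace AddFormula

variable {br f g : ℂ → ℂ} (hb : AddFormula br f g)

include hb

theorem actsBy_elemAut {hx hy p q : ℂ} (h : ElemGeneric br hx hy p q) :
    ActsBy (elemAut f g hx hy p q) (elemMat f g hx hy p q coordY) :=
  autOf_spec (exists_actsBy (hb.det_elemMat_ne_zero h) (elemMat_mem_fieldY f g hx hy p q))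

theorem etaForm_curve (h p u : ℂ) (h0 : g (u - h / 2) ≠ 0) :
    etaForm f g h p (f (u - h / 2) / g (u - h / 2)) =
      br (u + p - h) * br (u - p) / g (u - h / 2) := by
  rw [hb.mul_eq' (v := u - h / 2) (p := p - h / 2) (by ring) (by ring), etaForm]
  simp only [Algebra.algebraMap_self, RingHom.id_apply]
  generalize p - h / 2 = p'
  generalize u - h / 2 = w at h0 ⊢
  field_simp

/-- An identity of matrices over `ℂ[y]` that holds on the curve. -/
theorem matrix_identity {hx hy : ℂ} (h0 : br (hx - hy) ≠ 0)
    (D : ∀ {L : Type} [CommRing L] [Algebra ℂ L], L → Matrix (Fin 2) (Fin 2) L)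
    (hmap : ∀ {L L' : Type} [CommRing L] [Algebra ℂ L] [CommRing L'] [Algebra ℂ L']
      (φ : L →ₐ[ℂ] L') (y : L), φ.mapMatrix (D y) = D (φ y))
    (hD : ∀ u, g (u - hy / 2) ≠ 0 →
      (D (f (u - hy / 2) / g (u - hy / 2))).mulVec ![f (u - hx / 2), g (u - hx / 2)] = 0) :
    D coordY = 0 := by
  -- The identity is proved for the indeterminate of `ℂ[y]` and then specialised to the coordinate
  -- function.
  have h := hb.polyMatrix_eq_zero h0 (D (Polynomial.X : Polynomial ℂ)) fun u hu => by
    rw [hmap, Polynomial.aeval_X]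
    exact hD u hu
  have h2 := hmap (Polynomial.aeval coordY) (Polynomial.X : Polynomial ℂ)
  rw [h, Polynomial.aeval_X, map_zero] at h2
  exact h2.symm

/-- The second step returns `h_x`. The scalars `[u - p] [u - h_y + p]` and `[u - q] [u - h_y + q]`
collected on the curve are the two fibre forms, so the matrix product is a scalar matrix over
`ℂ[y]`. -/
theorem elemAut_mul_inverse {hx hy p q : ℂ} (h : ElemGeneric br hx hy p q)
    (h' : ElemGeneric br (hx + hy - p - q) hy (hy - q) (hy - p)) :
    elemAut f g hx hy p q * elemAut f g (hx + hy - p - q) hy (hy - q) (hy - p) = 1 := by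
  have hmul := (hb.actsBy_elemAut h).mul (hb.actsBy_elemAut h')
    (elemMat_mem_fieldY _ _ _ _ _ _) (hb.det_elemMat_ne_zero h)
  set c := br (hy - hx) * br (p - q) * br (hy - (hx + hy - p - q)) * br (hy - q - (hy - p))
  have hid := hb.matrix_identity h.h (fun {L} _ _ y =>
    elemMat f g (hx + hy - p - q) hy (hy - q) (hy - p) y * elemMat f g hx hy p q y -
      (algebraMap ℂ L c * etaForm f g hy p y * etaForm f g hy q y) • 1)
    (fun φ y => by
      ext i j
      have h1 := fun i j => congrFun (congrFun (elemMat_map φ f g hx hy p q y) i) j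
      have h2 := fun i j => congrFun (congrFun
        (elemMat_map φ f g (hx + hy - p - q) hy (hy - q) (hy - p) y) i) j
      simp only [AlgHom.mapMatrix_apply, Matrix.map_apply] at h1 h2
      simp [Matrix.mul_apply, Matrix.one_apply, h1, h2, etaForm_map, AlgHom.commutes, apply_ite φ])
    (fun u hu => by
      rw [Matrix.sub_mulVec, ← Matrix.mulVec_mulVec, hb.elemMat_mulVec _ _ _ _ _ hu,
        Matrix.mulVec_smul, hb.elemMat_mulVec _ _ _ _ _ hu, Matrix.smul_mulVec,
        Matrix.one_mulVec, hb.etaForm_curve _ _ _ hu, hb.etaForm_curve _ _ _ hu, smul_smul,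
        show hx + hy - p - q + hy - (hy - q) - (hy - p) = hx by ring, ← sub_smul]
      convert zero_smul ℂ _
      rw [show u - (hy - q) = u + q - hy by ring, show u - (hy - p) = u + p - hy by ring]
      simp only [c, Algebra.algebraMap_self, RingHom.id_apply]
      ring)
  have hc : c ≠ 0 := by
    refine mul_ne_zero (mul_ne_zero (mul_ne_zero ?_ h.sub) ?_) h'.sub
    · rw [hb.br_swap]
      exact neg_ne_zero.2 h.h
    · rw [hb.br_swap]
      exact neg_ne_zero.2 h'.h
  have hqp : br (q - p) ≠ 0 := by
    rw [hb.br_swap]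
    exact neg_ne_zero.2 h.sub
  refine (actsBy_one.unique hmul (by simp) (mul_ne_zero (mul_ne_zero
    ((map_ne_zero_iff _ (algebraMap ℂ RatXY).injective).2 hc) (hb.etaForm_ne_zero h.sub h.addy))
    (hb.etaForm_ne_zero hqp (by rw [add_comm]; exact h.addy))) (k₂ := 1) ?_).symm
  rw [one_smul]
  exact (sub_eq_zero.1 hid).symm

/-- The modification at `p` is undone at `h_y - p`, leaving those at `q` and `r`. The cancelled
fibre contributes its form as a scalar. -/
theorem elemAut_mul_triangle {hx hy p q r : ℂ} (h : ElemGeneric br hx hy p q)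
    (h' : ElemGeneric br (hx + hy - p - q) hy r (hy - p)) (h'' : ElemGeneric br hx hy r q) :
    elemAut f g hx hy p q * elemAut f g (hx + hy - p - q) hy r (hy - p) =
      elemAut f g hx hy r q := by
  have hmul := (hb.actsBy_elemAut h).mul (hb.actsBy_elemAut h')
    (elemMat_mem_fieldY _ _ _ _ _ _) (hb.det_elemMat_ne_zero h)
  set c := br (p - q) * br (hy - (hx + hy - p - q)) * br (r - (hy - p))
  have hid := hb.matrix_identity h.h (fun {L} _ _ y =>
    algebraMap ℂ L (br (r - q)) •
      (elemMat f g (hx + hy - p - q) hy r (hy - p) y * elemMat f g hx hy p q y) -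
      (algebraMap ℂ L c * etaForm f g hy p y) • elemMat f g hx hy r q y)
    (fun φ y => by
      ext i j
      have h1 := fun i j => congrFun (congrFun (elemMat_map φ f g hx hy p q y) i) j
      have h2 := fun i j => congrFun (congrFun
        (elemMat_map φ f g (hx + hy - p - q) hy r (hy - p) y) i) j
      have h3 := fun i j => congrFun (congrFun (elemMat_map φ f g hx hy r q y) i) j
      simp only [AlgHom.mapMatrix_apply, Matrix.map_apply] at h1 h2 h3
      simp [Matrix.mul_apply, h1, h2, h3, etaForm_map, AlgHom.commutes])
    (fun u hu => by
      rw [Matrix.sub_mulVec, Matrix.smul_mulVec, ← Matrix.mulVec_mulVec,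
        hb.elemMat_mulVec _ _ _ _ _ hu,
        Matrix.mulVec_smul, hb.elemMat_mulVec _ _ _ _ _ hu, Matrix.smul_mulVec,
        hb.elemMat_mulVec _ _ _ _ _ hu, hb.etaForm_curve _ _ _ hu, smul_smul, smul_smul, smul_smul,
        show hx + hy - p - q + hy - r - (hy - p) = hx + hy - r - q by ring, ← sub_smul]
      convert zero_smul ℂ _
      rw [show u - (hy - p) = u + p - hy by ring]
      simp only [c, Algebra.algebraMap_self, RingHom.id_apply]
      ring)
  refine hmul.unique (hb.actsBy_elemAut h'') ?_
    ((map_ne_zero_iff _ (algebraMap ℂ RatXY).injective).2 h''.sub) (sub_eq_zero.1 hid)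
  rw [Matrix.det_mul]
  exact mul_ne_zero (hb.det_elemMat_ne_zero h') (hb.det_elemMat_ne_zero h)

/-- Both orders reach the same curve with the same factors in `u`. They differ only in a bracket of
the intermediate `h_x`, hence the two constants. -/
theorem elemAut_mul_comm {hx hy p q r s : ℂ} (h₁ : ElemGeneric br hx hy p q)
    (h₂ : ElemGeneric br (hx + hy - p - q) hy r s) (h₃ : ElemGeneric br hx hy r s)
    (h₄ : ElemGeneric br (hx + hy - r - s) hy p q) :
    elemAut f g hx hy p q * elemAut f g (hx + hy - p - q) hy r s =
      elemAut f g hx hy r s * elemAut f g (hx + hy - r - s) hy p q := by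
  have hmul := (hb.actsBy_elemAut h₁).mul (hb.actsBy_elemAut h₂)
    (elemMat_mem_fieldY _ _ _ _ _ _) (hb.det_elemMat_ne_zero h₁)
  have hmul' := (hb.actsBy_elemAut h₃).mul (hb.actsBy_elemAut h₄)
    (elemMat_mem_fieldY _ _ _ _ _ _) (hb.det_elemMat_ne_zero h₃)
  have hid := hb.matrix_identity h₁.h (fun {L} _ _ y =>
    algebraMap ℂ L (br (hy - (hx + hy - r - s))) •
      (elemMat f g (hx + hy - p - q) hy r s y * elemMat f g hx hy p q y) -
    algebraMap ℂ L (br (hy - (hx + hy - p - q))) •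
      (elemMat f g (hx + hy - r - s) hy p q y * elemMat f g hx hy r s y))
    (fun φ y => by
      ext i j
      have h1 := fun i j => congrFun (congrFun (elemMat_map φ f g hx hy p q y) i) j
      have h2 := fun i j => congrFun (congrFun
        (elemMat_map φ f g (hx + hy - p - q) hy r s y) i) j
      have h3 := fun i j => congrFun (congrFun (elemMat_map φ f g hx hy r s y) i) j
      have h4 := fun i j => congrFun (congrFun
        (elemMat_map φ f g (hx + hy - r - s) hy p q y) i) j
      simp only [AlgHom.mapMatrix_apply, Matrix.map_apply] at h1 h2 h3 h4
      simp [Matrix.mul_apply, h1, h2, h3, h4])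
    (fun u hu => by
      rw [Matrix.sub_mulVec, Matrix.smul_mulVec, ← Matrix.mulVec_mulVec,
        hb.elemMat_mulVec _ _ _ _ _ hu,
        Matrix.mulVec_smul, hb.elemMat_mulVec _ _ _ _ _ hu, Matrix.smul_mulVec,
        ← Matrix.mulVec_mulVec, hb.elemMat_mulVec _ _ _ _ _ hu,
        Matrix.mulVec_smul, hb.elemMat_mulVec _ _ _ _ _ hu, smul_smul, smul_smul, smul_smul,
        smul_smul, show hx + hy - r - s + hy - p - q = hx + hy - p - q + hy - r - s by ring,
        ← sub_smul]
      convert zero_smul ℂ _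
      simp only [Algebra.algebraMap_self, RingHom.id_apply]
      ring)
  refine hmul.unique hmul' ?_
    ((map_ne_zero_iff _ (algebraMap ℂ RatXY).injective).2 ?_) (sub_eq_zero.1 hid)
  · rw [Matrix.det_mul]
    exact mul_ne_zero (hb.det_elemMat_ne_zero h₂) (hb.det_elemMat_ne_zero h₁)
  · rw [hb.br_swap]
    exact neg_ne_zero.2 h₄.h

/-- The braid relation of the elementary transformation and the exchange of `x` and `y`. -/
theorem elemAut_swapXY_braid {hx hy p q : ℂ} (h : ElemGeneric br hx hy p q)
    (h' : ElemGeneric br hy (hx + hy - p - q) (hy - q) (hy - p))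
    (h'' : ElemGeneric br hy hx p q) :
    elemAut f g hx hy p q * (swapXY * elemAut f g hy (hx + hy - p - q) (hy - q) (hy - p)) =
      swapXY * (elemAut f g hy hx p q * swapXY) := by
  obtain ⟨hφ1, hφ2⟩ := hb.actsBy_elemAut h
  have hφ0 := (hb.actsBy_elemAut h).denom_ne_zero (hb.det_elemMat_ne_zero h)
  obtain ⟨hθ1, hθ2⟩ := hb.actsBy_elemAut h'
  have hθ0 := (hb.actsBy_elemAut h').denom_ne_zero (hb.det_elemMat_ne_zero h')
  obtain ⟨hχ1, hχ2⟩ := hb.actsBy_elemAut h''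
  have hχ0 := (hb.actsBy_elemAut h'').denom_ne_zero (hb.det_elemMat_ne_zero h'')
  set φ := elemAut f g hx hy p q
  set θ := elemAut f g hy (hx + hy - p - q) (hy - q) (hy - p)
  set χ := elemAut f g hy hx p q
  have hmap := algEquiv_elemMat f g
  apply algEquiv_ext_coord
  · simp only [AlgEquiv.mul_apply, swapXY_coordX, hχ1, swapXY_coordY]
    have e1 := congrArg (fun z => φ (swapXY z)) hθ2
    have e0 : φ (swapXY (elemMat f g hy (hx + hy - p - q) (hy - q) (hy - p) coordY 1 0 * coordX +
        elemMat f g hy (hx + hy - p - q) (hy - q) (hy - p) coordY 1 1)) ≠ 0 := by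
      exact (map_ne_zero φ).2 ((map_ne_zero swapXY).2 hθ0)
    simp only [map_mul, map_add, hmap, swapXY_coordX, swapXY_coordY, hφ1] at e1 e0
    apply mul_right_cancel₀ e0
    rw [e1]
    apply mul_left_cancel₀ hφ0
    -- Up to sign, the arguments in the second transformation are those of the first. Evenness of
    -- `f`, `g` removes the signs.
    have a1 : (hx + hy - p - q - hy - (hy - p) + (hy - q)) / 2 = -(q - hx / 2) := by ring
    have a2 : (hx + hy - p - q - hy - (hy - q) + (hy - p)) / 2 = -(p - hx / 2) := by ring
    have a3 : hy - q - (hx + hy - p - q) / 2 = (hy - hx - q + p) / 2 := by ring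
    have a4 : hy - p - (hx + hy - p - q) / 2 = (hy - hx - p + q) / 2 := by ring
    have a5 : hy - q - hy / 2 = -(q - hy / 2) := by ring
    have a6 : hy - p - hy / 2 = -(p - hy / 2) := by ring
    simp only [elemMat, Matrix.of_apply, Matrix.cons_val_zero, Matrix.cons_val_one, a1, a2, a3,
      a4, a5, a6, hb.f_neg, hb.g_neg, map_mul] at hφ2 ⊢
    set c := algebraMap ℂ RatXY
    -- The remaining equation is affine in the image of `x` under the first transformation. The
    -- multiplier is the coefficient of that image, so it gets eliminated.
    linear_combination (c (g ((hy - hx - q + p) / 2)) *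
      (coordY * c (g (p - hy / 2)) - c (f (p - hy / 2))) *
      (c (f (q - hx / 2)) - coordX * c (g (q - hx / 2))) - c (g ((hy - hx - p + q) / 2)) *
      (coordY * c (g (q - hy / 2)) - c (f (q - hy / 2))) *
      (c (f (p - hx / 2)) - coordX * c (g (p - hx / 2)))) * hφ2
  · simp only [AlgEquiv.mul_apply, hθ1, swapXY_coordY]
    have e1 := congrArg (fun z => swapXY z) hχ2
    have e0 : swapXY (elemMat f g hy hx p q coordY 1 0 * coordX +
        elemMat f g hy hx p q coordY 1 1) ≠ 0 := by
      exact (map_ne_zero swapXY).2 hχ0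
    simp only [map_mul, map_add, hmap, swapXY_coordX, swapXY_coordY] at e1 e0
    apply mul_right_cancel₀ hφ0
    rw [hφ2]
    apply mul_right_cancel₀ e0
    rw [mul_right_comm, e1]
    have a1 : (hx - hy - q + p) / 2 = -((hy - hx - p + q) / 2) := by ring
    have a2 : (hx - hy - p + q) / 2 = -((hy - hx - q + p) / 2) := by ring
    simp only [elemMat, Matrix.of_apply, Matrix.cons_val_zero, Matrix.cons_val_one, a1, a2,
      hb.f_neg, hb.g_neg, map_mul]
    ring

end AddFormula

/-! ### The representation in intrinsic coordinates -/

theorem Generic.elemGeneric {br : ℂ → ℂ} {a : Params} (h : Generic br a) (i j : Fin 8)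
    (hij : i ≠ j := by decide) : ElemGeneric br a.hx a.hy (eVec a i) (eVec a j) :=
  ⟨h.sub i j hij, h.add_sub_hx i j hij, h.add_sub_hy i j hij, h.hx_sub_hy⟩

theorem Generic.simple {br : ℂ → ℂ} {a : Params} (h : Generic br a) (i : Fin 7) :
    Generic br (simplePerm i a) := (generic_simplePerm i a).2 h

/-- The birational maps of the simple reflections in the coordinates in which the curve is
`u ↦ ((f / g)(u - h_x / 2), (f / g)(u - h_y / 2))`. -/
def simpleCoc (f g : ℂ → ℂ) : Fin 7 → Params → (RatXY ≃ₐ[ℂ] RatXY) :=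
  ![fun _ => 1, fun _ => 1, fun a => elemAut f g a.hx a.hy a.e1 a.e5, fun _ => swapXY,
    fun a => elemAut f g a.hx a.hy a.e3 a.e7, fun _ => 1, fun _ => 1]

/-- The simple reflections, acting on parameters and coordinates. -/
def simpleGen (br f g : ℂ → ℂ) (i : Fin 7) : CocyclePerm (Generic br) (RatXY ≃ₐ[ℂ] RatXY) :=
  ⟨simplePerm i, generic_simplePerm i, fun a => simpleCoc f g i a.1⟩

/-- The diagram automorphisms, acting on parameters and coordinates. -/
def diagramGen (br : ℂ → ℂ) : diagramAut →* CocyclePerm (Generic br) (RatXY ≃ₐ[ℂ] RatXY) where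
  toFun π := ⟨diagramPerm π, generic_diagramPerm π, fun _ => 1⟩
  map_one' := CocyclePerm.ext' permutePairs_one fun _ => rfl
  map_mul' π ρ := CocyclePerm.ext' (permutePairs_mul π ρ) fun _ => (mul_one _).symm

theorem simpleGen_rot (br f g : ℂ → ℂ) (i : Fin 7) :
    simpleGen br f g (rot.1 i) * diagramGen br rot = diagramGen br rot * simpleGen br f g i := by
  have hi : ∀ i, rot.1 i = ![5, 6, 4, 3, 2, 1, 0] i := by decide
  rw [hi]
  refine CocyclePerm.ext' (fun a => ?_) fun a => ?_
  · change simpleMap (![5, 6, 4, 3, 2, 1, 0] i) (diagramPerm rot a) = diagramPerm rot (simpleMap i a)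
    rw [diagramPerm_rot, diagramPerm_rot]
    fin_cases i <;> ext <;> simp [simpleMap] <;> ring
  · change 1 * simpleCoc f g (![5, 6, 4, 3, 2, 1, 0] i) (diagramPerm rot a.1) = simpleCoc f g i a.1 * 1
    rw [one_mul, mul_one, diagramPerm_rot]
    fin_cases i <;> simp [simpleCoc]
    -- The rotation taken twice exchanges `e₁, e₅` and `e₃, e₇` within their pairs, so one of `β₂`,
    -- `β₄` returns with its base points in the other order.
    exact elemAut_swap _ _ _ _ _ _

theorem simpleGen_refl01 (br f g : ℂ → ℂ) (i : Fin 7) :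
    simpleGen br f g (refl01.1 i) * diagramGen br refl01 =
      diagramGen br refl01 * simpleGen br f g i := by
  have hi : ∀ i, refl01.1 i = ![1, 0, 2, 3, 4, 5, 6] i := by decide
  rw [hi]
  refine CocyclePerm.ext' (fun a => ?_) fun a => ?_
  · change simpleMap (![1, 0, 2, 3, 4, 5, 6] i) (diagramPerm refl01 a) = diagramPerm refl01 (simpleMap i a)
    rw [diagramPerm_refl01, diagramPerm_refl01]
    fin_cases i <;> ext <;> simp [simpleMap] <;> ring
  · change 1 * simpleCoc f g (![1, 0, 2, 3, 4, 5, 6] i) (diagramPerm refl01 a.1) = simpleCoc f g i a.1 * 1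
    rw [one_mul, mul_one, diagramPerm_refl01]
    fin_cases i <;> simp [simpleCoc]
    exact elemAut_swap _ _ _ _ _ _

theorem simpleGen_conj (br f g : ℂ → ℂ) (π : diagramAut) :
    ∀ i, simpleGen br f g (π.1 i) = diagramGen br π * simpleGen br f g i * (diagramGen br π)⁻¹ := by
  induction π using diagramAut_induction with
  | one => intro i; simp
  | hrot π ih =>
    intro i
    have h := eq_mul_inv_of_mul_eq (simpleGen_rot br f g (π.1 i))
    rw [map_mul, mul_inv_rev]
    change simpleGen br f g (rot.1 (π.1 i)) = _
    rw [h, ih i]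
    group
  | hrefl π ih =>
    intro i
    have h := eq_mul_inv_of_mul_eq (simpleGen_refl01 br f g (π.1 i))
    rw [map_mul, mul_inv_rev]
    change simpleGen br f g (refl01.1 (π.1 i)) = _
    rw [h, ih i]
    group

/-! ### Verification of the Coxeter relations -/

theorem mul_pow_two_of_comm {G : Type*} [Group G] {a b : G} (ha : a * a = 1) (hb : b * b = 1)
    (h : a * b = b * a) : (a * b) ^ 2 = 1 := by
  rw [pow_two, mul_assoc, ← mul_assoc b, ← h, mul_assoc a, hb, mul_one, ha]

theorem mul_pow_three_of_braid {G : Type*} [Group G] {a b : G} (ha : a * a = 1) (hb : b * b = 1)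
    (h : a * b * a = b * a * b) : (a * b) ^ 3 = 1 := by
  calc (a * b) ^ 3 = (a * b * a) * (b * a * b) := by simp only [pow_succ, pow_zero, one_mul, mul_assoc]
    _ = a * (b * (a * a) * b) * a := by rw [← h]; simp only [mul_assoc]
    _ = 1 := by rw [ha, mul_one, hb, mul_one, ha]

namespace AddFormula

variable {br f g : ℂ → ℂ} (hb : AddFormula br f g)

include hb

theorem simpleGen_mul_self (i : Fin 7) : simpleGen br f g i * simpleGen br f g i = 1 := by
  refine CocyclePerm.ext' (fun a => simpleMap_involutive i a) fun a => ?_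
  change simpleCoc f g i a.1 * simpleCoc f g i (simplePerm i a.1) = 1
  obtain ⟨a, ha⟩ := a
  fin_cases i
  · rfl
  · rfl
  · exact hb.elemAut_mul_inverse (ha.elemGeneric 0 4) ((ha.simple 2).elemGeneric 0 4)
  · exact swapXY_mul_self
  · exact hb.elemAut_mul_inverse (ha.elemGeneric 2 6) ((ha.simple 4).elemGeneric 2 6)
  · rfl
  · rfl

theorem simpleGen_comm {i j : Fin 7} (h : (i, j) ∈ ([(0, 1), (0, 5), (0, 4), (0, 3), (2, 4)] :
      List (Fin 7 × Fin 7))) :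
    simpleGen br f g i * simpleGen br f g j = simpleGen br f g j * simpleGen br f g i := by
  refine CocyclePerm.ext' (fun a => ?_) fun a => ?_
  · change simpleMap i (simpleMap j a) = simpleMap j (simpleMap i a)
    simp only [List.mem_cons, Prod.mk.injEq, List.not_mem_nil, or_false] at h
    obtain ⟨rfl, rfl⟩ | ⟨rfl, rfl⟩ | ⟨rfl, rfl⟩ | ⟨rfl, rfl⟩ | ⟨rfl, rfl⟩ := h
    · rfl
    · rfl
    · rfl
    · rfl
    · ext <;> simp [simpleMap] <;> ring
  · change simpleCoc f g j a.1 * simpleCoc f g i (simplePerm j a.1) =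
      simpleCoc f g i a.1 * simpleCoc f g j (simplePerm i a.1)
    obtain ⟨a, ha⟩ := a
    simp only [List.mem_cons, Prod.mk.injEq, List.not_mem_nil, or_false] at h
    obtain ⟨rfl, rfl⟩ | ⟨rfl, rfl⟩ | ⟨rfl, rfl⟩ | ⟨rfl, rfl⟩ | ⟨rfl, rfl⟩ := h
    · rfl
    · rfl
    · exact (mul_one _).trans (one_mul _).symm
    · exact (mul_one _).trans (one_mul _).symm
    · exact hb.elemAut_mul_comm (ha.elemGeneric 2 6) ((ha.simple 4).elemGeneric 0 4)
        (ha.elemGeneric 0 4) ((ha.simple 2).elemGeneric 2 6)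

/-- Since `β₀` acts trivially on intrinsic coordinates, this is the triangle relation for the points
`e₁`, `e₅`, `e₂`. -/
theorem simpleGen_braid02 : simpleGen br f g 0 * simpleGen br f g 2 * simpleGen br f g 0 =
    simpleGen br f g 2 * simpleGen br f g 0 * simpleGen br f g 2 := by
  refine CocyclePerm.ext' (fun a => ?_) fun a => ?_
  · change simpleMap 0 (simpleMap 2 (simpleMap 0 a)) = simpleMap 2 (simpleMap 0 (simpleMap 2 a))
    ext <;> simp [simpleMap] <;> ring
  · obtain ⟨a, ha⟩ := a
    exact ((one_mul _).trans (mul_one _)).trans ((hb.elemAut_mul_triangle (ha.elemGeneric 0 4)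
      ((ha.simple 2).elemGeneric 1 4) (ha.elemGeneric 1 4)).symm.trans
        (congrArg _ (one_mul _).symm))

theorem simpleGen_braid23 : simpleGen br f g 2 * simpleGen br f g 3 * simpleGen br f g 2 =
    simpleGen br f g 3 * simpleGen br f g 2 * simpleGen br f g 3 := by
  refine CocyclePerm.ext' (fun a => ?_) fun a => ?_
  · change simpleMap 2 (simpleMap 3 (simpleMap 2 a)) = simpleMap 3 (simpleMap 2 (simpleMap 3 a))
    ext <;> simp [simpleMap] <;> ring
  · obtain ⟨a, ha⟩ := a
    exact hb.elemAut_swapXY_braid (ha.elemGeneric 0 4)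
      (((ha.simple 2).simple 3).elemGeneric 0 4) ((ha.simple 3).elemGeneric 0 4)

/-- Conjugation by diagram automorphisms and exchange of the two nodes reduce every pair to ten
standard ones. -/
theorem isLiftable_simpleGen : affineD6.IsLiftable (simpleGen br f g) := by
  have base : ∀ x y : Fin 7, (x, y) ∈ ([(0, 0), (2, 2), (3, 3), (0, 1), (0, 5), (0, 2), (0, 4),
      (0, 3), (2, 4), (2, 3)] : List (Fin 7 × Fin 7)) →
      (simpleGen br f g x * simpleGen br f g y) ^ d6Entry x y = 1 := by
    intro x y h
    have hs := hb.simpleGen_mul_self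
    simp only [List.mem_cons, Prod.mk.injEq, List.not_mem_nil, or_false] at h
    obtain ⟨rfl, rfl⟩ | ⟨rfl, rfl⟩ | ⟨rfl, rfl⟩ | ⟨rfl, rfl⟩ | ⟨rfl, rfl⟩ | ⟨rfl, rfl⟩ | ⟨rfl, rfl⟩ |
      ⟨rfl, rfl⟩ | ⟨rfl, rfl⟩ | ⟨rfl, rfl⟩ := h
    · exact (pow_one _).trans (hs 0)
    · exact (pow_one _).trans (hs 2)
    · exact (pow_one _).trans (hs 3)
    · exact mul_pow_two_of_comm (hs _) (hs _) (hb.simpleGen_comm (by simp))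
    · exact mul_pow_two_of_comm (hs _) (hs _) (hb.simpleGen_comm (by simp))
    · exact mul_pow_three_of_braid (hs _) (hs _) hb.simpleGen_braid02
    · exact mul_pow_two_of_comm (hs _) (hs _) (hb.simpleGen_comm (by simp))
    · exact mul_pow_two_of_comm (hs _) (hs _) (hb.simpleGen_comm (by simp))
    · exact mul_pow_two_of_comm (hs _) (hs _) (hb.simpleGen_comm (by simp))
    · exact mul_pow_three_of_braid (hs _) (hs _) hb.simpleGen_braid23
  have hconj : ∀ (π : diagramAut) (x y : Fin 7),
      (simpleGen br f g x * simpleGen br f g y) ^ d6Entry x y = 1 →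
      (simpleGen br f g (π.1 x) * simpleGen br f g (π.1 y)) ^ d6Entry (π.1 x) (π.1 y) = 1 := by
    intro π x y h
    have he : d6Entry (π.1 x) (π.1 y) = d6Entry x y := π.2 x y
    have hm : simpleGen br f g (π.1 x) * simpleGen br f g (π.1 y) =
        diagramGen br π * (simpleGen br f g x * simpleGen br f g y) * (diagramGen br π)⁻¹ := by
      rw [simpleGen_conj, simpleGen_conj br f g π y]
      group
    rw [he, hm, conj_pow, h, mul_one, mul_inv_cancel]
  have hsymm : ∀ x y : Fin 7, (simpleGen br f g x * simpleGen br f g y) ^ d6Entry x y = 1 →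
      (simpleGen br f g y * simpleGen br f g x) ^ d6Entry y x = 1 := by
    intro x y h
    have he : d6Entry y x = d6Entry x y := affineD6.symmetric y x
    have hm : simpleGen br f g y * simpleGen br f g x =
        simpleGen br f g y * (simpleGen br f g x * simpleGen br f g y) *
          (simpleGen br f g y)⁻¹ := by
      group
    rw [he, hm, conj_pow, h, mul_one, mul_inv_cancel]
  intro i j
  obtain ⟨k, e, x, y, hmem, h⟩ := exists_standard_pair i j
  have hxy := hconj (rot ^ (k : ℕ) * refl01 ^ (e : ℕ)) x y (base x y hmem)
  obtain ⟨h1, h2⟩ | ⟨h1, h2⟩ := h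
  · rw [h1, h2] at hxy
    exact hxy
  · rw [h1, h2] at hxy
    exact hsymm _ _ hxy

end AddFormula

/-- The extended affine Weyl group acts on the parameters and on the coordinates. -/
def extHom {br f g : ℂ → ℂ} (hb : AddFormula br f g) :
    ExtW →* CocyclePerm (Generic br) (RatXY ≃ₐ[ℂ] RatXY) :=
  SemidirectProduct.lift
    (affineD6.toCoxeterSystem.lift ⟨simpleGen br f g, hb.isLiftable_simpleGen⟩)
    (diagramGen br) fun π => by
      apply affineD6.toCoxeterSystem.ext_simple
      intro i
      have h1 : ∀ i, affineD6.toCoxeterSystem.lift ⟨simpleGen br f g, hb.isLiftable_simpleGen⟩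
          (affineD6.simple i) = simpleGen br f g i :=
        affineD6.toCoxeterSystem.lift_apply_simple hb.isLiftable_simpleGen
      change affineD6.toCoxeterSystem.lift _ (diagramEndo π (affineD6.simple i)) =
        diagramGen br π * affineD6.toCoxeterSystem.lift _ (affineD6.simple i) * (diagramGen br π)⁻¹
      rw [diagramEndo_simple, h1, h1, simpleGen_conj]

theorem extHom_wβ {br f g : ℂ → ℂ} (hb : AddFormula br f g) (i : Fin 7) :
    extHom hb (wβ i) = simpleGen br f g i := by
  rw [extHom, wβ, SemidirectProduct.lift_inl]
  exact affineD6.toCoxeterSystem.lift_apply_simple hb.isLiftable_simpleGen i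

theorem extHom_inr {br f g : ℂ → ℂ} (hb : AddFormula br f g) (π : diagramAut) :
    extHom hb (SemidirectProduct.inr π) = diagramGen br π := by
  rw [extHom, SemidirectProduct.lift_inr]

/-! ### Normalized coordinates -/

theorem algEquiv_etaForm (f g : ℂ → ℂ) (φ : RatXY ≃ₐ[ℂ] RatXY) (h p : ℂ) (z : RatXY) :
    φ (etaForm f g h p z) = etaForm f g h p (φ z) :=
  etaForm_map (φ : RatXY →ₐ[ℂ] RatXY) f g h p z

theorem const_mul (a b : ℂ) : const (a * b) = const a * const b := map_mul _ _ _
theorem const_sub (a b : ℂ) : const (a - b) = const a - const b := map_sub _ _ _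
theorem const_neg (a : ℂ) : const (-a) = -const a := map_neg _ _
theorem const_div (a b : ℂ) : const (a / b) = const a / const b := map_div₀ _ _ _
theorem const_ne_zero {a : ℂ} (h : a ≠ 0) : const a ≠ 0 :=
  (map_ne_zero_iff _ (algebraMap ℂ RatXY).injective).2 h

theorem etaForm_eq (f g : ℂ → ℂ) (h p : ℂ) (z : RatXY) :
    etaForm f g h p z = z * const (g (p - h / 2)) - const (f (p - h / 2)) := rfl

/-- The automorphism given by the coordinates `F₁₂`, `G₁₂` in terms of the intrinsic ones. -/
def frameAut (f g : ℂ → ℂ) (a : Params) : RatXY ≃ₐ[ℂ] RatXY :=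
  autOf fun φ =>
    φ coordX = etaForm f g a.hx a.e2 coordX / etaForm f g a.hx a.e1 coordX ∧
    φ coordY = etaForm f g a.hy a.e2 coordY / etaForm f g a.hy a.e1 coordY

namespace AddFormula

variable {br f g : ℂ → ℂ} (hb : AddFormula br f g)

include hb

theorem br_swap_ne_zero {p q : ℂ} (h : br (p - q) ≠ 0) : br (q - p) ≠ 0 := by
  rw [hb.br_swap]
  exact neg_ne_zero.2 h

theorem etaForm_coordX_ne_zero {h p q : ℂ} (h1 : br (p - q) ≠ 0) (h2 : br (p + q - h) ≠ 0) :
    etaForm f g h p coordX ≠ 0 := by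
  rw [← swapXY_coordY, ← algEquiv_etaForm]
  exact (map_ne_zero swapXY).2 (hb.etaForm_ne_zero h1 h2)

theorem const_br_mul_br (h p q : ℂ) : const (br (p + q - h)) * const (br (p - q)) =
    const (f (p - h / 2)) * const (g (q - h / 2)) -
      const (g (p - h / 2)) * const (f (q - h / 2)) := by
  rw [← const_mul, ← const_mul, ← const_mul, ← const_sub,
    hb.mul_eq' (v := p - h / 2) (p := q - h / 2) (by ring) (by ring)]

/-- A coordinate is a fractional linear function of the quotient of two of its linear forms. -/
theorem eq_div_of_etaForm {L : Type} [Field L] [Algebra ℂ L] {h p q : ℂ} {z w : L}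
    (hz : etaForm f g h p z ≠ 0) (h1 : br (q - p) ≠ 0) (h2 : br (q + p - h) ≠ 0)
    (hw : etaForm f g h q z / etaForm f g h p z = w) :
    w * algebraMap ℂ L (g (p - h / 2)) - algebraMap ℂ L (g (q - h / 2)) ≠ 0 ∧
      z = (w * algebraMap ℂ L (f (p - h / 2)) - algebraMap ℂ L (f (q - h / 2))) /
        (w * algebraMap ℂ L (g (p - h / 2)) - algebraMap ℂ L (g (q - h / 2))) := by
  have hw' := (div_eq_iff hz).1 hw
  simp only [etaForm] at hw'
  have hd : w * algebraMap ℂ L (g (p - h / 2)) - algebraMap ℂ L (g (q - h / 2)) ≠ 0 := by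
    intro h0
    refine (map_ne_zero_iff _ (algebraMap ℂ L).injective).2 (hb.wedge_ne_zero h1 h2) ?_
    rw [map_sub, map_mul, map_mul]
    linear_combination -algebraMap ℂ L (g (p - h / 2)) * hw' -
      (z * algebraMap ℂ L (g (p - h / 2)) - algebraMap ℂ L (f (p - h / 2))) * h0
  refine ⟨hd, ?_⟩
  rw [eq_div_iff hd]
  linear_combination -hw'

theorem mem_of_etaForm_div {F : IntermediateField ℂ RatXY} {h p q : ℂ} {z : RatXY}
    (hz : etaForm f g h p z ≠ 0) (h1 : br (q - p) ≠ 0) (h2 : br (q + p - h) ≠ 0)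
    (hF : etaForm f g h q z / etaForm f g h p z ∈ F) : z ∈ F := by
  have hc : ∀ t, algebraMap ℂ RatXY t ∈ F := fun t => F.algebraMap_mem t
  rw [(hb.eq_div_of_etaForm hz h1 h2 rfl).2]
  exact F.div_mem (F.sub_mem (F.mul_mem hF (hc _)) (hc _)) (F.sub_mem (F.mul_mem hF (hc _)) (hc _))

theorem frameAut_spec {a : Params} (h : Generic br a) :
    frameAut f g a coordX = etaForm f g a.hx a.e2 coordX / etaForm f g a.hx a.e1 coordX ∧
    frameAut f g a coordY = etaForm f g a.hy a.e2 coordY / etaForm f g a.hy a.e1 coordY :=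
  autOf_spec (exists_algEquiv
    (hb.mem_of_etaForm_div (hb.etaForm_coordX_ne_zero (h.sub 0 1) (h.add_sub_hx 0 1))
      (h.sub 1 0) (h.add_sub_hx 1 0) (IntermediateField.subset_adjoin _ _ (Set.mem_insert _ _)))
    (hb.mem_of_etaForm_div (hb.etaForm_ne_zero (h.sub 0 1) (h.add_sub_hy 0 1))
      (h.sub 1 0) (h.add_sub_hy 1 0)
      (IntermediateField.subset_adjoin _ _ (Set.mem_insert_of_mem _ rfl))))

/-- The Plücker relation, for the difference of two values of a normalized coordinate. -/
theorem sub_thetaQuot {h p q k : ℂ} {z : RatXY} (hz : etaForm f g h p z ≠ 0)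
    (h1 : br (k - p) ≠ 0) (h2 : br (k + p - h) ≠ 0) :
    etaForm f g h q z / etaForm f g h p z - const (thetaQuot br h p q k) =
      etaForm f g h k z * (const (br (q + p - h)) * const (br (q - p))) /
        (etaForm f g h p z * (const (br (k + p - h)) * const (br (k - p)))) := by
  have e1 := const_ne_zero h1
  have e2 := const_ne_zero h2
  have w1 := hb.const_br_mul_br h k q
  have w2 := hb.const_br_mul_br h k p
  have w3 := hb.const_br_mul_br h q p
  have e3 := mul_ne_zero e2 e1
  rw [thetaQuot, const_div, const_mul, const_mul, mul_comm (const (br (k - q))),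
    mul_comm (const (br (k - p))), div_sub_div _ _ hz e3, w1, w2, w3]
  congr 1
  simp only [etaForm_eq]
  ring

/-- The coordinates with respect to other normalization points. -/
theorem etaForm_div_eq {h p q r s : ℂ} {z : RatXY} (hz : etaForm f g h p z ≠ 0)
    (hr : etaForm f g h r z ≠ 0)
    (h1 : br (s - p) ≠ 0) (h2 : br (s + p - h) ≠ 0) (h3 : br (r - p) ≠ 0) (h4 : br (r + p - h) ≠ 0)
    (h5 : br (q - p) ≠ 0) (h6 : br (q + p - h) ≠ 0) :
    etaForm f g h s z / etaForm f g h r z = const (thetaQuot br h r s p) *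
      ((etaForm f g h q z / etaForm f g h p z - const (thetaQuot br h p q s)) /
        (etaForm f g h q z / etaForm f g h p z - const (thetaQuot br h p q r))) := by
  rw [hb.sub_thetaQuot hz h1 h2, hb.sub_thetaQuot hz h3 h4, thetaQuot, add_comm p s, add_comm p r,
    hb.br_swap p s, hb.br_swap p r]
  have e1 := const_ne_zero h1
  have e2 := const_ne_zero h2
  have e3 := const_ne_zero h3
  have e4 := const_ne_zero h4
  have e5 := const_ne_zero h5
  have e6 := const_ne_zero h6
  simp only [const_div, const_mul, const_neg]
  field_simp

/-- Pairing the image vector with either new base point kills one of the two terms of the matrix.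
The common denominator `D` drops out of ratios, which is how it is used below. -/
theorem etaForm_elemAut {hx hy p q : ℂ} (h : ElemGeneric br hx hy p q) :
    ∃ D : RatXY, D ≠ 0 ∧
      D * etaForm f g (hx + hy - p - q) (hy - q) (elemAut f g hx hy p q coordX) =
        etaForm f g hx p coordX * etaForm f g hy q coordY ∧
      D * etaForm f g (hx + hy - p - q) (hy - p) (elemAut f g hx hy p q coordX) =
        etaForm f g hx q coordX * etaForm f g hy p coordY := by
  have hA := hb.actsBy_elemAut h
  have hd := hA.denom_ne_zero (hb.det_elemMat_ne_zero h)
  have hA2 := hA.2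
  set D := elemMat f g hx hy p q coordY 1 0 * coordX + elemMat f g hx hy p q coordY 1 1 with hD
  have hk : const (br (hy - hx) * br (p - q)) ≠ 0 :=
    const_ne_zero (mul_ne_zero (hb.br_swap_ne_zero h.h) h.sub)
  have a3 : hy - q - (hx + hy - p - q) / 2 = (hy - hx - q + p) / 2 := by ring
  have a4 : hy - p - (hx + hy - p - q) / 2 = (hy - hx - p + q) / 2 := by ring
  have hk2 : const (br (hy - hx) * br (p - q)) =
      const (f ((hy - hx - q + p) / 2)) * const (g ((hy - hx - p + q) / 2)) -
      const (g ((hy - hx - q + p) / 2)) * const (f ((hy - hx - p + q) / 2)) := by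
    rw [← const_mul, ← const_mul, ← const_sub, hb.mul_eq' (v := (hy - hx - q + p) / 2)
      (p := (hy - hx - p + q) / 2) (by ring) (by ring)]
  refine ⟨D / const (br (hy - hx) * br (p - q)), div_ne_zero hd hk, ?_, ?_⟩
  · rw [div_mul_eq_mul_div, div_eq_iff hk, hk2]
    simp only [etaForm_eq, a3]
    have : D * (elemAut f g hx hy p q coordX * const (g ((hy - hx - q + p) / 2)) -
        const (f ((hy - hx - q + p) / 2))) =
        (elemMat f g hx hy p q coordY 0 0 * coordX + elemMat f g hx hy p q coordY 0 1) *
          const (g ((hy - hx - q + p) / 2)) - D * const (f ((hy - hx - q + p) / 2)) := by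
      linear_combination const (g ((hy - hx - q + p) / 2)) * hA2
    rw [this, hD]
    simp only [elemMat, Matrix.of_apply, Matrix.cons_val_zero, Matrix.cons_val_one, map_mul, const]
    ring
  · rw [div_mul_eq_mul_div, div_eq_iff hk, hk2]
    simp only [etaForm_eq, a4]
    have : D * (elemAut f g hx hy p q coordX * const (g ((hy - hx - p + q) / 2)) -
        const (f ((hy - hx - p + q) / 2))) =
        (elemMat f g hx hy p q coordY 0 0 * coordX + elemMat f g hx hy p q coordY 0 1) *
          const (g ((hy - hx - p + q) / 2)) - D * const (f ((hy - hx - p + q) / 2)) := by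
      linear_combination const (g ((hy - hx - p + q) / 2)) * hA2
    rw [this, hD]
    simp only [elemMat, Matrix.of_apply, Matrix.cons_val_zero, Matrix.cons_val_one, map_mul, const]
    ring

end AddFormula

open Classical in
/-- The birational representation in normalized coordinates. -/
def rep {br f g : ℂ → ℂ} (hb : AddFormula br f g) (s : ExtW) (a : Params) : RatXY ≃ₐ[ℂ] RatXY :=
  if h : Generic br a then
    (frameAut f g a)⁻¹ * ((extHom hb s).coc ⟨a, h⟩ * frameAut f g ((extHom hb s).perm a))
  else 1

namespace AddFormula

variable {br f g : ℂ → ℂ} (hb : AddFormula br f g)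

theorem rep_eq (s : ExtW) {a : Params} (h : Generic br a) : rep hb s a =
    (frameAut f g a)⁻¹ * ((extHom hb s).coc ⟨a, h⟩ * frameAut f g ((extHom hb s).perm a)) :=
  dif_pos h

theorem rep_one {a : Params} (h : Generic br a) : rep hb 1 a = 1 := by
  rw [rep_eq hb 1 h]
  have e : extHom hb 1 = 1 := map_one _
  rw [e, CocyclePerm.one_coc, CocyclePerm.one_perm, one_mul]
  exact inv_mul_cancel _

/-- The changes of coordinates at the intermediate parameters cancel, leaving the cocycle rule. -/
theorem rep_mul (s t : ExtW) {a : Params} (h : Generic br a) :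
    rep hb (s * t) a = rep hb t a * rep hb s ((extHom hb t).perm a) := by
  rw [rep_eq hb _ h, rep_eq hb _ h, rep_eq hb s (((extHom hb t).map_iff a).2 h)]
  have e : extHom hb (s * t) = extHom hb s * extHom hb t := map_mul _ _ _
  rw [e, CocyclePerm.mul_coc, CocyclePerm.mul_perm]
  change _ = (frameAut f g a)⁻¹ * ((extHom hb t).coc ⟨a, h⟩ *
    frameAut f g ((extHom hb t).perm a)) * ((frameAut f g ((extHom hb t).perm a))⁻¹ *
      ((extHom hb s).coc ((extHom hb t).act ⟨a, h⟩) *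
        frameAut f g ((extHom hb s).perm ((extHom hb t).perm a))))
  rw [Equiv.Perm.mul_apply]
  group

theorem frameAut_rep (s : ExtW) {a : Params} (h : Generic br a) (z : RatXY) :
    frameAut f g a (rep hb s a z) =
      (extHom hb s).coc ⟨a, h⟩ (frameAut f g ((extHom hb s).perm a) z) := by
  rw [rep_eq hb s h]
  exact (frameAut f g a).apply_symm_apply _

end AddFormula

/-! ### The maps of the generators -/

namespace AddFormula

variable {br f g : ℂ → ℂ} (hb : AddFormula br f g)

theorem frameAut_rep_wβ (i : Fin 7) {a : Params} (h : Generic br a) (z : RatXY) :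
    frameAut f g a (rep hb (wβ i) a z) =
      simpleCoc f g i a (frameAut f g (simplePerm i a) z) := by
  rw [hb.frameAut_rep _ h, extHom_wβ]
  rfl

theorem frameAut_rep_inr (π : diagramAut) {a : Params} (h : Generic br a) (z : RatXY) :
    frameAut f g a (rep hb (SemidirectProduct.inr π) a z) = frameAut f g (diagramPerm π a) z := by
  rw [hb.frameAut_rep _ h, extHom_inr]
  rfl

include hb in
-- Parameters `p` and `h - p` lie on the same fibre.
theorem etaForm_reflect (h p : ℂ) (z : RatXY) : etaForm f g h (h - p) z = etaForm f g h p z := by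
  rw [etaForm_eq, etaForm_eq, show h - p - h / 2 = -(p - h / 2) by ring, hb.f_neg, hb.g_neg]

theorem rep_wβ_id {i : Fin 7} (hi : i = 1 ∨ i = 5 ∨ i = 6) {a : Params} (h : Generic br a)
    (z : RatXY) : rep hb (wβ i) a z = z := by
  apply (frameAut f g a).injective
  rw [hb.frameAut_rep_wβ i h]
  obtain rfl | rfl | rfl := hi <;> rfl

theorem rep_wβ_zero {a : Params} (h : Generic br a) :
    rep hb (wβ 0) a coordX = 1 / coordX ∧ rep hb (wβ 0) a coordY = 1 / coordY := by
  have h1 := hb.frameAut_spec h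
  have h2 := hb.frameAut_spec (h.simple 0)
  constructor <;> apply (frameAut f g a).injective <;>
    rw [hb.frameAut_rep_wβ 0 h, map_div₀, map_one]
  · rw [h1.1, h2.1, one_div_div]
    rfl
  · rw [h1.2, h2.2, one_div_div]
    rfl

theorem rep_wβ_three {a : Params} (h : Generic br a) :
    rep hb (wβ 3) a coordX = coordY ∧ rep hb (wβ 3) a coordY = coordX := by
  have h1 := hb.frameAut_spec h
  have h2 := hb.frameAut_spec (h.simple 3)
  constructor <;> apply (frameAut f g a).injective <;> rw [hb.frameAut_rep_wβ 3 h]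
  · rw [h1.2, h2.1]
    change swapXY _ = _
    rw [map_div₀, algEquiv_etaForm, algEquiv_etaForm, swapXY_coordX]
    rfl
  · rw [h1.1, h2.2]
    change swapXY _ = _
    rw [map_div₀, algEquiv_etaForm, algEquiv_etaForm, swapXY_coordY]
    rfl

theorem rep_wβ_two {a : Params} (h : Generic br a) :
    rep hb (wβ 2) a coordX - const (F12 br (simplePerm 2 a) (simplePerm 2 a).e5) =
        -const (F12 br (simplePerm 2 a) (simplePerm 2 a).e5 * G12 br a a.e5 / F12 br a a.e5) *
          ((coordX - const (F12 br a a.e5)) / (coordY - const (G12 br a a.e5))) ∧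
      rep hb (wβ 2) a coordY =
        const (G52 br a a.e1) * coordY / (coordY - const (G12 br a a.e5)) := by
  have h1 := hb.frameAut_spec h
  have h2 := hb.frameAut_spec (h.simple 2)
  have hX1 : etaForm f g a.hx a.e1 coordX ≠ 0 :=
    hb.etaForm_coordX_ne_zero (h.sub 0 1) (h.add_sub_hx 0 1)
  have hY1 : etaForm f g a.hy a.e1 coordY ≠ 0 := hb.etaForm_ne_zero (h.sub 0 1) (h.add_sub_hy 0 1)
  have hY5 : etaForm f g a.hy a.e5 coordY ≠ 0 := hb.etaForm_ne_zero (h.sub 4 1) (h.add_sub_hy 4 1)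
  have x51 := hb.sub_thetaQuot (q := a.e2) hX1 (h.sub 4 0) (h.add_sub_hx 4 0)
  have y51 := hb.sub_thetaQuot (q := a.e2) hY1 (h.sub 4 0) (h.add_sub_hy 4 0)
  have n1 := const_ne_zero (h.sub 4 0)
  have n2 := const_ne_zero (h.add_sub_hx 4 0)
  have n3 := const_ne_zero (h.add_sub_hy 4 0)
  have n4 := const_ne_zero (h.sub 1 0)
  have n5 := const_ne_zero (h.add_sub_hx 1 0)
  have n6 := const_ne_zero (h.add_sub_hy 1 0)
  have n7 := const_ne_zero (h.sub 4 1)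
  have n8 := const_ne_zero (h.add_sub_hx 4 1)
  have n9 := const_ne_zero (h.add_sub_hy 4 1)
  simp only [eVec, Matrix.cons_val] at x51 y51 n1 n2 n3 n4 n5 n6 n7 n8 n9
  constructor <;> apply (frameAut f g a).injective
  · obtain ⟨D, hD0, hD1, hD2⟩ := hb.etaForm_elemAut (h.elemGeneric 0 4)
    have h3 := (h.simple 2).sub 4 0
    have h4 := (h.simple 2).add_sub_hx 4 0
    have hz : etaForm f g (a.hx + a.hy - a.e1 - a.e5) (a.hy - a.e5)
        (elemAut f g a.hx a.hy a.e1 a.e5 coordX) ≠ 0 := by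
      rw [← algEquiv_etaForm]
      exact (map_ne_zero (elemAut f g a.hx a.hy a.e1 a.e5)).2
        (hb.etaForm_coordX_ne_zero ((h.simple 2).sub 0 1) ((h.simple 2).add_sub_hx 0 1))
    have key := hb.sub_thetaQuot (q := a.e2) hz h3 h4
    change D * etaForm f g _ _ (elemAut f g a.hx a.hy a.e1 a.e5 coordX) = _ at hD1 hD2
    have m1 := const_ne_zero h3
    have m2 := const_ne_zero h4
    rw [map_sub, map_mul, map_neg, map_div₀, map_sub, map_sub, hb.frameAut_rep_wβ 2 h, h2.1, h1.1,
      h1.2]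
    simp only [algEquiv_const]
    rw [show F12 br a a.e5 = thetaQuot br a.hx a.e1 a.e2 a.e5 from rfl,
      show G12 br a a.e5 = thetaQuot br a.hy a.e1 a.e2 a.e5 from rfl, x51, y51]
    change elemAut f g a.hx a.hy a.e1 a.e5 (_ / _) - const (thetaQuot br _ _ _ _) =
      -const (thetaQuot br (a.hx + a.hy - a.e1 - a.e5) (a.hy - a.e5) a.e2 (a.hy - a.e1) * _ / _) * _
    rw [map_div₀, algEquiv_etaForm, algEquiv_etaForm]
    refine key.trans ?_
    change etaForm f g (a.hx + a.hy - a.e1 - a.e5) (a.hy - a.e1)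
      (elemAut f g a.hx a.hy a.e1 a.e5 coordX) * _ / (_ * (const (br (a.hy - a.e1 + (a.hy - a.e5) - (a.hx + a.hy - a.e1 - a.e5))) *
      const (br (a.hy - a.e1 - (a.hy - a.e5))))) = _
    change const (br (a.hy - a.e1 - (a.hy - a.e5))) ≠ 0 at m1
    change const (br (a.hy - a.e1 + (a.hy - a.e5) - (a.hx + a.hy - a.e1 - a.e5))) ≠ 0 at m2
    change _ * etaForm f g (a.hx + a.hy - a.e1 - a.e5) (a.hy - a.e5) _ =
      etaForm f g a.hx a.e1 coordX * etaForm f g a.hy a.e5 coordY at hD1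
    change _ * etaForm f g (a.hx + a.hy - a.e1 - a.e5) (a.hy - a.e1) _ =
      etaForm f g a.hx a.e5 coordX * etaForm f g a.hy a.e1 coordY at hD2
    -- Cross-multiplying the two formulas for the new linear forms eliminates `D`.
    have hE := mul_left_cancel₀ hD0 (show D * (etaForm f g (a.hx + a.hy - a.e1 - a.e5) (a.hy - a.e1)
        (elemAut f g a.hx a.hy a.e1 a.e5 coordX) * (etaForm f g a.hx a.e1 coordX *
          etaForm f g a.hy a.e5 coordY)) = D * (etaForm f g (a.hx + a.hy - a.e1 - a.e5) (a.hy - a.e5)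
        (elemAut f g a.hx a.hy a.e1 a.e5 coordX) * (etaForm f g a.hx a.e5 coordX *
          etaForm f g a.hy a.e1 coordY)) by rw [← hD1, ← hD2]; ring)
    simp only [thetaQuot, const_div, const_mul]
    -- Brackets at the transformed parameters become old ones, up to sign, and cancel.
    rw [show a.e2 + (a.hy - a.e5) - (a.hx + a.hy - a.e1 - a.e5) = a.e2 + a.e1 - a.hx by ring,
      show a.e2 - (a.hy - a.e5) = a.e5 + a.e2 - a.hy by ring,
      show a.hy - a.e1 + a.e2 - (a.hx + a.hy - a.e1 - a.e5) = a.e5 + a.e2 - a.hx by ring,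
      show a.hy - a.e1 - a.e2 = a.hy - (a.e2 + a.e1) by ring, hb.br_swap a.hy, const_neg]
    generalize const (br (a.hy - a.e1 - (a.hy - a.e5))) = c1 at m1 ⊢
    generalize const (br (a.hy - a.e1 + (a.hy - a.e5) - (a.hx + a.hy - a.e1 - a.e5))) = c2 at m2 ⊢
    generalize etaForm f g (a.hx + a.hy - a.e1 - a.e5) (a.hy - a.e1)
      (elemAut f g a.hx a.hy a.e1 a.e5 coordX) = E5 at hE ⊢
    generalize etaForm f g (a.hx + a.hy - a.e1 - a.e5) (a.hy - a.e5)
      (elemAut f g a.hx a.hy a.e1 a.e5 coordX) = E1 at hz hE ⊢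
    field_simp
    linear_combination hE
  · rw [hb.frameAut_rep_wβ 2 h, h2.2, map_div₀ (frameAut f g a), map_mul, map_sub, h1.2]
    simp only [algEquiv_const]
    rw [show G12 br a a.e5 = thetaQuot br a.hy a.e1 a.e2 a.e5 from rfl, y51]
    change elemAut f g a.hx a.hy a.e1 a.e5 (etaForm f g a.hy a.e2 coordY /
      etaForm f g a.hy (a.hy - a.e5) coordY) = const (thetaQuot br a.hy a.e5 a.e2 a.e1) * _ / _
    rw [map_div₀, algEquiv_etaForm, algEquiv_etaForm,
      show elemAut f g a.hx a.hy a.e1 a.e5 coordY = coordY from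
        (hb.actsBy_elemAut (h.elemGeneric 0 4)).1, hb.etaForm_reflect]
    simp only [thetaQuot, const_div, const_mul]
    rw [hb.br_swap a.e1 a.e2, hb.br_swap a.e1 a.e5, const_neg, const_neg, add_comm a.e1 a.e2,
      add_comm a.e1 a.e5]
    field_simp

theorem rep_wβ_four {a : Params} (h : Generic br a) :
    (rep hb (wβ 4) a coordX - const (F12 br (simplePerm 4 a) (simplePerm 4 a).e3)) /
        (rep hb (wβ 4) a coordX - const (F12 br (simplePerm 4 a) (simplePerm 4 a).e7)) =
      ((coordX - const (F12 br a a.e3)) * (coordY - const (G12 br a a.e7))) /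
        ((coordX - const (F12 br a a.e7)) * (coordY - const (G12 br a a.e3))) ∧
    rep hb (wβ 4) a coordY = coordY := by
  have h1 := hb.frameAut_spec h
  have h2 := hb.frameAut_spec (h.simple 4)
  have hX1 : etaForm f g a.hx a.e1 coordX ≠ 0 :=
    hb.etaForm_coordX_ne_zero (h.sub 0 1) (h.add_sub_hx 0 1)
  have hX7 : etaForm f g a.hx a.e7 coordX ≠ 0 :=
    hb.etaForm_coordX_ne_zero (h.sub 6 1) (h.add_sub_hx 6 1)
  have hY1 : etaForm f g a.hy a.e1 coordY ≠ 0 := hb.etaForm_ne_zero (h.sub 0 1) (h.add_sub_hy 0 1)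
  have hY3 : etaForm f g a.hy a.e3 coordY ≠ 0 := hb.etaForm_ne_zero (h.sub 2 1) (h.add_sub_hy 2 1)
  constructor <;> apply (frameAut f g a).injective
  · have x31 := hb.sub_thetaQuot (q := a.e2) hX1 (h.sub 2 0) (h.add_sub_hx 2 0)
    have y31 := hb.sub_thetaQuot (q := a.e2) hY1 (h.sub 2 0) (h.add_sub_hy 2 0)
    have x71 := hb.sub_thetaQuot (q := a.e2) hX1 (h.sub 6 0) (h.add_sub_hx 6 0)
    have y71 := hb.sub_thetaQuot (q := a.e2) hY1 (h.sub 6 0) (h.add_sub_hy 6 0)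
    have n1 := const_ne_zero (h.sub 2 0)
    have n2 := const_ne_zero (h.add_sub_hx 2 0)
    have n3 := const_ne_zero (h.add_sub_hy 2 0)
    have n4 := const_ne_zero (h.sub 1 0)
    have n5 := const_ne_zero (h.add_sub_hx 1 0)
    have n6 := const_ne_zero (h.add_sub_hy 1 0)
    have n7 := const_ne_zero (h.sub 6 0)
    have n8 := const_ne_zero (h.add_sub_hx 6 0)
    have n9 := const_ne_zero (h.add_sub_hy 6 0)
    simp only [eVec, Matrix.cons_val] at x31 y31 x71 y71 n1 n2 n3 n4 n5 n6 n7 n8 n9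
    obtain ⟨D, hD0, hD1, hD2⟩ := hb.etaForm_elemAut (h.elemGeneric 2 6)
    change D * etaForm f g (a.hx + a.hy - a.e3 - a.e7) (a.hy - a.e7)
      (elemAut f g a.hx a.hy a.e3 a.e7 coordX) =
        etaForm f g a.hx a.e3 coordX * etaForm f g a.hy a.e7 coordY at hD1
    change D * etaForm f g (a.hx + a.hy - a.e3 - a.e7) (a.hy - a.e3)
      (elemAut f g a.hx a.hy a.e3 a.e7 coordX) =
        etaForm f g a.hx a.e7 coordX * etaForm f g a.hy a.e3 coordY at hD2
    have hz : etaForm f g (a.hx + a.hy - a.e3 - a.e7) a.e1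
        (elemAut f g a.hx a.hy a.e3 a.e7 coordX) ≠ 0 := by
      rw [← algEquiv_etaForm]
      exact (map_ne_zero (elemAut f g a.hx a.hy a.e3 a.e7)).2
        (hb.etaForm_coordX_ne_zero ((h.simple 4).sub 0 1) ((h.simple 4).add_sub_hx 0 1))
    have hz7 : etaForm f g (a.hx + a.hy - a.e3 - a.e7) (a.hy - a.e3)
        (elemAut f g a.hx a.hy a.e3 a.e7 coordX) ≠ 0 := by
      rw [← algEquiv_etaForm]
      exact (map_ne_zero (elemAut f g a.hx a.hy a.e3 a.e7)).2
        (hb.etaForm_coordX_ne_zero ((h.simple 4).sub 6 1) ((h.simple 4).add_sub_hx 6 1))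
    have k3 : elemAut f g a.hx a.hy a.e3 a.e7 (frameAut f g (simplePerm 4 a) coordX) -
        const (F12 br (simplePerm 4 a) (simplePerm 4 a).e3) =
        etaForm f g (a.hx + a.hy - a.e3 - a.e7) (a.hy - a.e7)
          (elemAut f g a.hx a.hy a.e3 a.e7 coordX) *
          (const (br (a.e2 + a.e1 - (a.hx + a.hy - a.e3 - a.e7))) * const (br (a.e2 - a.e1))) /
        (etaForm f g (a.hx + a.hy - a.e3 - a.e7) a.e1 (elemAut f g a.hx a.hy a.e3 a.e7 coordX) *
          (const (br (a.hy - a.e7 + a.e1 - (a.hx + a.hy - a.e3 - a.e7))) *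
            const (br (a.hy - a.e7 - a.e1)))) := by
      rw [h2.1, map_div₀, algEquiv_etaForm, algEquiv_etaForm]
      exact hb.sub_thetaQuot hz ((h.simple 4).sub 2 0) ((h.simple 4).add_sub_hx 2 0)
    have k7 : elemAut f g a.hx a.hy a.e3 a.e7 (frameAut f g (simplePerm 4 a) coordX) -
        const (F12 br (simplePerm 4 a) (simplePerm 4 a).e7) =
        etaForm f g (a.hx + a.hy - a.e3 - a.e7) (a.hy - a.e3)
          (elemAut f g a.hx a.hy a.e3 a.e7 coordX) *
          (const (br (a.e2 + a.e1 - (a.hx + a.hy - a.e3 - a.e7))) * const (br (a.e2 - a.e1))) /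
        (etaForm f g (a.hx + a.hy - a.e3 - a.e7) a.e1 (elemAut f g a.hx a.hy a.e3 a.e7 coordX) *
          (const (br (a.hy - a.e3 + a.e1 - (a.hx + a.hy - a.e3 - a.e7))) *
            const (br (a.hy - a.e3 - a.e1)))) := by
      rw [h2.1, map_div₀, algEquiv_etaForm, algEquiv_etaForm]
      exact hb.sub_thetaQuot hz ((h.simple 4).sub 6 0) ((h.simple 4).add_sub_hx 6 0)
    have m1 : const (br (a.e2 + a.e1 - (a.hx + a.hy - a.e3 - a.e7))) ≠ 0 :=
      const_ne_zero ((h.simple 4).add_sub_hx 1 0)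
    rw [map_div₀, map_sub, map_sub, hb.frameAut_rep_wβ 4 h, map_div₀, map_mul, map_mul, map_sub,
      map_sub, map_sub, map_sub, h1.1, h1.2]
    simp only [algEquiv_const]
    change (elemAut f g a.hx a.hy a.e3 a.e7 (frameAut f g (simplePerm 4 a) coordX) - _) /
      (elemAut f g a.hx a.hy a.e3 a.e7 (frameAut f g (simplePerm 4 a) coordX) - _) = _
    rw [k3, k7]
    rw [show F12 br a a.e3 = thetaQuot br a.hx a.e1 a.e2 a.e3 from rfl,
      show G12 br a a.e3 = thetaQuot br a.hy a.e1 a.e2 a.e3 from rfl,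
      show F12 br a a.e7 = thetaQuot br a.hx a.e1 a.e2 a.e7 from rfl,
      show G12 br a a.e7 = thetaQuot br a.hy a.e1 a.e2 a.e7 from rfl, x31, y31, x71, y71]
    have hE := mul_left_cancel₀ hD0 (show D * (etaForm f g (a.hx + a.hy - a.e3 - a.e7) (a.hy - a.e7)
        (elemAut f g a.hx a.hy a.e3 a.e7 coordX) * (etaForm f g a.hx a.e7 coordX *
          etaForm f g a.hy a.e3 coordY)) = D * (etaForm f g (a.hx + a.hy - a.e3 - a.e7) (a.hy - a.e3)
        (elemAut f g a.hx a.hy a.e3 a.e7 coordX) * (etaForm f g a.hx a.e3 coordX *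
          etaForm f g a.hy a.e7 coordY)) by rw [← hD1, ← hD2]; ring)
    rw [show a.hy - a.e7 + a.e1 - (a.hx + a.hy - a.e3 - a.e7) = a.e3 + a.e1 - a.hx by ring,
      show a.hy - a.e3 + a.e1 - (a.hx + a.hy - a.e3 - a.e7) = a.e7 + a.e1 - a.hx by ring,
      show a.hy - a.e7 - a.e1 = a.hy - (a.e7 + a.e1) by ring,
      show a.hy - a.e3 - a.e1 = a.hy - (a.e3 + a.e1) by ring, hb.br_swap a.hy (a.e7 + a.e1),
      hb.br_swap a.hy (a.e3 + a.e1), const_neg, const_neg]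
    generalize const (br (a.e2 + a.e1 - (a.hx + a.hy - a.e3 - a.e7))) = c1 at m1 ⊢
    generalize etaForm f g (a.hx + a.hy - a.e3 - a.e7) (a.hy - a.e7)
      (elemAut f g a.hx a.hy a.e3 a.e7 coordX) = E3 at hE ⊢
    generalize etaForm f g (a.hx + a.hy - a.e3 - a.e7) (a.hy - a.e3)
      (elemAut f g a.hx a.hy a.e3 a.e7 coordX) = E7 at hz7 hE ⊢
    generalize etaForm f g (a.hx + a.hy - a.e3 - a.e7) a.e1
      (elemAut f g a.hx a.hy a.e3 a.e7 coordX) = E1 at hz ⊢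
    field_simp
    linear_combination hE
  · rw [hb.frameAut_rep_wβ 4 h, h2.2, h1.2]
    change elemAut f g a.hx a.hy a.e3 a.e7 _ = _
    rw [map_div₀, algEquiv_etaForm, algEquiv_etaForm,
      show elemAut f g a.hx a.hy a.e3 a.e7 coordY = coordY from
        (hb.actsBy_elemAut (h.elemGeneric 2 6)).1]
    rfl

/-- Only the normalization points change, from `e₁, e₂` to `e_i, e_j`. The constant is the new
coordinate at `u = e₁`, where the old one is infinite and the ratio of differences is `1`. -/
theorem rep_inr_of_pair (π : diagramAut) {a : Params} (h : Generic br a) (i j : Fin 8)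
    (hij : i ≠ j) (hi : i ≠ 0) (hj : j ≠ 0) (hhx : (diagramPerm π a).hx = a.hx)
    (hhy : (diagramPerm π a).hy = a.hy) (h1 : (diagramPerm π a).e1 = eVec a i)
    (h2 : (diagramPerm π a).e2 = eVec a j) :
    rep hb (SemidirectProduct.inr π) a coordX =
        const (thetaQuot br a.hx (eVec a i) (eVec a j) a.e1) *
          ((coordX - const (F12 br a (eVec a j))) / (coordX - const (F12 br a (eVec a i)))) ∧
      rep hb (SemidirectProduct.inr π) a coordY =
        const (thetaQuot br a.hy (eVec a i) (eVec a j) a.e1) *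
          ((coordY - const (G12 br a (eVec a j))) / (coordY - const (G12 br a (eVec a i)))) := by
  have s1 := hb.frameAut_spec h
  have s2 := hb.frameAut_spec ((generic_diagramPerm π a).2 h)
  rw [hhx, hhy, h1, h2] at s2
  constructor <;> apply (frameAut f g a).injective <;>
    rw [hb.frameAut_rep_inr π h, map_mul, map_div₀, map_sub, map_sub]
  · rw [s1.1, s2.1]
    simp only [algEquiv_const]
    exact hb.etaForm_div_eq (hb.etaForm_coordX_ne_zero (h.sub 0 1) (h.add_sub_hx 0 1))
      (hb.etaForm_coordX_ne_zero (h.sub i j hij) (h.add_sub_hx i j hij)) (h.sub j 0 hj)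
      (h.add_sub_hx j 0 hj) (h.sub i 0 hi) (h.add_sub_hx i 0 hi) (h.sub 1 0) (h.add_sub_hx 1 0)
  · rw [s1.2, s2.2]
    simp only [algEquiv_const]
    exact hb.etaForm_div_eq (hb.etaForm_ne_zero (h.sub 0 1) (h.add_sub_hy 0 1))
      (hb.etaForm_ne_zero (h.sub i j hij) (h.add_sub_hy i j hij)) (h.sub j 0 hj)
      (h.add_sub_hy j 0 hj) (h.sub i 0 hi) (h.add_sub_hy i 0 hi) (h.sub 1 0) (h.add_sub_hy 1 0)

theorem rep_σ₁ {a : Params} (h : Generic br a) :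
    rep hb σ₁ a coordX = const (F78 br a a.e1) *
        ((coordX - const (F12 br a a.e8)) / (coordX - const (F12 br a a.e7))) ∧
      rep hb σ₁ a coordY = const (G78 br a a.e1) *
        ((coordY - const (G12 br a a.e8)) / (coordY - const (G12 br a a.e7))) :=
  hb.rep_inr_of_pair rot h 6 7 (by decide) (by decide) (by decide) (by rw [diagramPerm_rot])
    (by rw [diagramPerm_rot]) (by rw [diagramPerm_rot]; rfl) (by rw [diagramPerm_rot]; rfl)

theorem isMap56_rep_σ₂ {a : Params} (h : Generic br a) : IsMap56 br a (rep hb σ₂ a) :=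
  hb.rep_inr_of_pair refl01 h 4 5 (by decide) (by decide) (by decide) (by rw [diagramPerm_refl01])
    (by rw [diagramPerm_refl01]) (by rw [diagramPerm_refl01]; rfl)
    (by rw [diagramPerm_refl01]; rfl)

/-- Like `σ₂`, the square of `σ₁` moves `e₅, e₆` into the first two places, and the map depends on
nothing else. -/
theorem isMap56_rep_σ₁_mul_σ₁ {a : Params} (h : Generic br a) :
    IsMap56 br a (rep hb (σ₁ * σ₁) a) := by
  rw [σ₁_eq, ← map_mul]
  exact hb.rep_inr_of_pair (rot * rot) h 4 5 (by decide) (by decide) (by decide)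
    (by rw [diagramPerm_rot_mul_rot]) (by rw [diagramPerm_rot_mul_rot])
    (by rw [diagramPerm_rot_mul_rot]; rfl) (by rw [diagramPerm_rot_mul_rot]; rfl)

end AddFormula

/-! ### Values of rational functions at points -/

/-- The rational function `r` is defined at the point `P` and has the value `v` there. -/
def HasVal (P : Fin 2 → ℂ) (r : RatXY) (v : ℂ) : Prop :=
  ∃ n d : MvPolynomial (Fin 2) ℂ, r * algebraMap _ RatXY d = algebraMap _ RatXY n ∧
    MvPolynomial.eval P d ≠ 0 ∧ MvPolynomial.eval P n = v * MvPolynomial.eval P d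

namespace HasVal

variable {P : Fin 2 → ℂ} {r s : RatXY} {v w : ℂ}

theorem poly (P : Fin 2 → ℂ) (p : MvPolynomial (Fin 2) ℂ) :
    HasVal P (algebraMap _ RatXY p) (MvPolynomial.eval P p) :=
  ⟨p, 1, by simp, by simp, by simp⟩

theorem congr (h : HasVal P r v) (e : v = w) : HasVal P r w := e ▸ h

theorem const (P : Fin 2 → ℂ) (z : ℂ) : HasVal P (const z) z := by
  have h := poly P (MvPolynomial.C z)
  rw [MvPolynomial.eval_C] at h
  exact h

theorem coordX (P : Fin 2 → ℂ) : HasVal P coordX (P 0) := by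
  have h := poly P (MvPolynomial.X 0)
  rwa [MvPolynomial.eval_X] at h

theorem coordY (P : Fin 2 → ℂ) : HasVal P coordY (P 1) := by
  have h := poly P (MvPolynomial.X 1)
  rwa [MvPolynomial.eval_X] at h

theorem add (hr : HasVal P r v) (hs : HasVal P s w) : HasVal P (r + s) (v + w) := by
  obtain ⟨n, d, h1, h2, h3⟩ := hr
  obtain ⟨n', d', h1', h2', h3'⟩ := hs
  refine ⟨n * d' + n' * d, d * d', ?_, ?_, ?_⟩
  · simp only [map_add, map_mul]
    linear_combination algebraMap _ RatXY d' * h1 + algebraMap _ RatXY d * h1'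
  · rw [map_mul]
    exact mul_ne_zero h2 h2'
  · simp only [map_add, map_mul]
    linear_combination MvPolynomial.eval P d' * h3 + MvPolynomial.eval P d * h3'

theorem mul (hr : HasVal P r v) (hs : HasVal P s w) : HasVal P (r * s) (v * w) := by
  obtain ⟨n, d, h1, h2, h3⟩ := hr
  obtain ⟨n', d', h1', h2', h3'⟩ := hs
  refine ⟨n * n', d * d', ?_, ?_, ?_⟩
  · simp only [map_mul, ← h1, ← h1']
    ring
  · rw [map_mul]
    exact mul_ne_zero h2 h2'
  · simp only [map_mul, h3, h3']
    ring

theorem sub (hr : HasVal P r v) (hs : HasVal P s w) : HasVal P (r - s) (v - w) := by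
  have h := hr.add ((const P (-1)).mul hs)
  rw [const_neg, show EllipticD6.const 1 = 1 from map_one _] at h
  convert h using 1 <;> ring

theorem div (hr : HasVal P r v) (hs : HasVal P s w) (hw : w ≠ 0) : HasVal P (r / s) (v / w) := by
  obtain ⟨n, d, h1, h2, h3⟩ := hr
  obtain ⟨n', d', h1', h2', h3'⟩ := hs
  have hn : MvPolynomial.eval P n' ≠ 0 := h3' ▸ mul_ne_zero hw h2'
  have hs : s ≠ 0 := by
    rintro rfl
    rw [zero_mul] at h1'
    have h0 := (map_eq_zero_iff _ (IsFractionRing.injective (MvPolynomial (Fin 2) ℂ) RatXY)).1 h1'.symm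
    rw [h0, map_zero] at hn
    exact hn rfl
  refine ⟨n * d', d * n', ?_, ?_, ?_⟩
  · simp only [map_mul, ← h1, ← h1']
    field_simp
  · rw [map_mul]
    exact mul_ne_zero h2 hn
  · simp only [map_mul, h3, h3']
    field_simp

/-- One representation with nonvanishing denominator controls all others: cross-multiply in the
polynomial ring, evaluate, and cancel that denominator. -/
theorem eval_eq (hr : HasVal P r v) {p q : MvPolynomial (Fin 2) ℂ}
    (h : algebraMap _ RatXY p = r * algebraMap _ RatXY q) :
    MvPolynomial.eval P p = v * MvPolynomial.eval P q := by
  obtain ⟨n, d, h1, h2, h3⟩ := hr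
  have h4 : p * d = n * q := by
    apply IsFractionRing.injective (MvPolynomial (Fin 2) ℂ) RatXY
    rw [map_mul, map_mul, h, ← h1]
    ring
  have h5 := congrArg (MvPolynomial.eval P) h4
  rw [map_mul, map_mul, h3] at h5
  apply mul_right_cancel₀ h2
  rw [h5]
  ring

theorem map_poly {φ : RatXY ≃ₐ[ℂ] RatXY} {Q : Fin 2 → ℂ} (hx : HasVal P (φ EllipticD6.coordX) (Q 0))
    (hy : HasVal P (φ EllipticD6.coordY) (Q 1)) (p : MvPolynomial (Fin 2) ℂ) :
    HasVal P (φ (algebraMap _ RatXY p)) (MvPolynomial.eval Q p) := by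
  induction p using MvPolynomial.induction_on with
  | C z =>
    rw [MvPolynomial.eval_C]
    convert const P z
    exact φ.commutes z
  | add p q hp hq =>
    rw [map_add, map_add, map_add]
    exact hp.add hq
  | mul_X p i hp =>
    rw [map_mul, map_mul, map_mul, MvPolynomial.eval_X]
    refine hp.mul ?_
    fin_cases i
    · exact hx
    · exact hy

theorem map {φ : RatXY ≃ₐ[ℂ] RatXY} {Q : Fin 2 → ℂ} (hr : HasVal Q r v)
    (hx : HasVal P (φ EllipticD6.coordX) (Q 0)) (hy : HasVal P (φ EllipticD6.coordY) (Q 1)) : HasVal P (φ r) v := by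
  obtain ⟨n, d, h1, h2, h3⟩ := hr
  have h := (map_poly hx hy n).div (map_poly hx hy d) h2
  have hd : algebraMap _ RatXY d ≠ 0 := by
    rw [Ne, map_eq_zero_iff _ (IsFractionRing.injective (MvPolynomial (Fin 2) ℂ) RatXY)]
    rintro rfl
    exact h2 (map_zero _)
  rwa [← map_div₀, ← h1, mul_div_cancel_right₀ _ hd, h3, mul_div_cancel_right₀ _ h2] at h

theorem etaForm (f g : ℂ → ℂ) (h p : ℂ) (hr : HasVal P r v) :
    HasVal P (etaForm f g h p r) (EllipticD6.etaForm f g h p v) :=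
  (hr.mul (const P _)).sub (const P _)

theorem elemMat (f g : ℂ → ℂ) (hx hy p q : ℂ) (P : Fin 2 → ℂ) (i j : Fin 2) :
    HasVal P (elemMat f g hx hy p q EllipticD6.coordY i j)
      (EllipticD6.elemMat f g hx hy p q (P 1) i j) := by
  have h := poly P (EllipticD6.elemMat f g hx hy p q (MvPolynomial.X 1) i j)
  have h1 := congrFun (congrFun (elemMat_map (IsScalarTower.toAlgHom ℂ (MvPolynomial (Fin 2) ℂ) RatXY)
    f g hx hy p q (MvPolynomial.X 1)) i) j
  have h2 := congrFun (congrFun (elemMat_map (MvPolynomial.aeval P) f g hx hy p q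
    (MvPolynomial.X 1)) i) j
  rw [MvPolynomial.aeval_X] at h2
  rw [← h2]
  change HasVal P (EllipticD6.elemMat f g hx hy p q _ i j) _
  exact h1 ▸ h

end HasVal

/-! ### Transport of the parametrized curves -/

/-- The automorphism `φ` is the pull-back by a birational map that carries the parametrized curve
`c` to `c'`. -/
def Carries (φ : RatXY ≃ₐ[ℂ] RatXY) (c c' : ℂ → Fin 2 → ℂ) : Prop :=
  ∀ᶠ u in Filter.codiscrete ℂ, HasVal (c u) (φ coordX) (c' u 0) ∧ HasVal (c u) (φ coordY) (c' u 1)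

theorem Carries.mul {φ ψ : RatXY ≃ₐ[ℂ] RatXY} {c c' c'' : ℂ → Fin 2 → ℂ} (h : Carries φ c c')
    (h' : Carries ψ c' c'') : Carries (φ * ψ) c c'' := by
  filter_upwards [h, h'] with u hu hu'
  exact ⟨hu'.1.map hu.1 hu.2, hu'.2.map hu.1 hu.2⟩

theorem Carries.one (c : ℂ → Fin 2 → ℂ) : Carries 1 c c :=
  Filter.Eventually.of_forall fun _ => ⟨HasVal.coordX _, HasVal.coordY _⟩

/-- The curve in intrinsic coordinates. -/
def thetaCurve (f g : ℂ → ℂ) (a : Params) (u : ℂ) : Fin 2 → ℂ :=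
  ![f (u - a.hx / 2) / g (u - a.hx / 2), f (u - a.hy / 2) / g (u - a.hy / 2)]

/-- The curve in normalized coordinates. -/
def normCurve (br : ℂ → ℂ) (a : Params) (u : ℂ) : Fin 2 → ℂ := ![F12 br a u, G12 br a u]

namespace AddFormula

variable {br f g : ℂ → ℂ} (hb : AddFormula br f g)

section

include hb

theorem eventually_frame {a : Params} (h : Generic br a) : ∀ᶠ u in Filter.codiscrete ℂ,
    g (u - a.hx / 2) ≠ 0 ∧ g (u - a.hy / 2) ≠ 0 ∧
      etaForm f g a.hx a.e1 (f (u - a.hx / 2) / g (u - a.hx / 2)) ≠ 0 ∧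
      etaForm f g a.hy a.e1 (f (u - a.hy / 2) / g (u - a.hy / 2)) ≠ 0 ∧
      etaForm f g a.hx a.e2 (f (u - a.hx / 2) / g (u - a.hx / 2)) /
        etaForm f g a.hx a.e1 (f (u - a.hx / 2) / g (u - a.hx / 2)) = F12 br a u ∧
      etaForm f g a.hy a.e2 (f (u - a.hy / 2) / g (u - a.hy / 2)) /
        etaForm f g a.hy a.e1 (f (u - a.hy / 2) / g (u - a.hy / 2)) = G12 br a u := by
  have h0 := h.hx_sub_hy
  filter_upwards [hb.eventually_g_ne_zero h0 (a.hx / 2), hb.eventually_g_ne_zero h0 (a.hy / 2),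
    hb.eventually_sub_ne_zero h0 a.e1, hb.eventually_sub_ne_zero h0 (a.hx - a.e1),
    hb.eventually_sub_ne_zero h0 (a.hy - a.e1)] with u h1 h2 h3 h4 h5
  rw [show u - (a.hx - a.e1) = u + a.e1 - a.hx by ring] at h4
  rw [show u - (a.hy - a.e1) = u + a.e1 - a.hy by ring] at h5
  simp only [hb.etaForm_curve _ _ _ h1, hb.etaForm_curve _ _ _ h2]
  refine ⟨h1, h2, div_ne_zero (mul_ne_zero h4 h3) h1, div_ne_zero (mul_ne_zero h5 h3) h2, ?_, ?_⟩
  · rw [div_div_div_cancel_right₀ h1, mul_comm, mul_comm (br (u + a.e1 - a.hx))]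
    rfl
  · rw [div_div_div_cancel_right₀ h2, mul_comm, mul_comm (br (u + a.e1 - a.hy))]
    rfl

theorem carries_frameAut {a : Params} (h : Generic br a) :
    Carries (frameAut f g a) (thetaCurve f g a) (normCurve br a) := by
  filter_upwards [hb.eventually_frame h] with u ⟨_, _, h1, h2, h3, h4⟩
  rw [(hb.frameAut_spec h).1, (hb.frameAut_spec h).2]
  constructor
  · have := ((HasVal.coordX (thetaCurve f g a u)).etaForm f g a.hx a.e2).div
      ((HasVal.coordX (thetaCurve f g a u)).etaForm f g a.hx a.e1) h1
    exact this.congr h3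
  · have := ((HasVal.coordY (thetaCurve f g a u)).etaForm f g a.hy a.e2).div
      ((HasVal.coordY (thetaCurve f g a u)).etaForm f g a.hy a.e1) h2
    exact this.congr h4

/-- The inverse is written out by solving the fractional linear relation, so that its denominator
can be seen not to vanish at almost all points. -/
theorem carries_frameAut_inv {a : Params} (h : Generic br a) :
    Carries (frameAut f g a)⁻¹ (normCurve br a) (thetaCurve f g a) := by
  have hs := hb.frameAut_spec h
  have hx := (hb.eq_div_of_etaForm (hb.etaForm_coordX_ne_zero (h.sub 0 1) (h.add_sub_hx 0 1))
    (h.sub 1 0) (h.add_sub_hx 1 0) hs.1.symm).2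
  have hy := (hb.eq_div_of_etaForm (hb.etaForm_ne_zero (h.sub 0 1) (h.add_sub_hy 0 1))
    (h.sub 1 0) (h.add_sub_hy 1 0) hs.2.symm).2
  have hxi := congrArg (fun z => (frameAut f g a)⁻¹ z) hx
  have hyi := congrArg (fun z => (frameAut f g a)⁻¹ z) hy
  have hi : ∀ z, (frameAut f g a)⁻¹ (frameAut f g a z) = z := (frameAut f g a).symm_apply_apply
  have hc : ∀ z, (frameAut f g a)⁻¹ (algebraMap ℂ RatXY z) = const z := algEquiv_const _
  simp only [map_div₀, map_sub, map_mul, hi, hc] at hxi hyi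
  filter_upwards [hb.eventually_frame h] with u ⟨_, _, h1, h2, h3, h4⟩
  obtain ⟨h5, h6⟩ := hb.eq_div_of_etaForm h1 (h.sub 1 0) (h.add_sub_hx 1 0) h3
  obtain ⟨h7, h8⟩ := hb.eq_div_of_etaForm h2 (h.sub 1 0) (h.add_sub_hy 1 0) h4
  rw [hxi, hyi]
  set P := normCurve br a u
  have hX : ∀ s t : ℂ, HasVal P (coordX * const s - const t) (P 0 * s - t) := fun s t =>
    ((HasVal.coordX P).mul (HasVal.const P s)).sub (HasVal.const P t)
  have hY : ∀ s t : ℂ, HasVal P (coordY * const s - const t) (P 1 * s - t) := fun s t =>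
    ((HasVal.coordY P).mul (HasVal.const P s)).sub (HasVal.const P t)
  exact ⟨((hX _ _).div (hX _ _) h5).congr h6.symm, ((hY _ _).div (hY _ _) h7).congr h8.symm⟩

theorem carries_elemAut {a : Params} {p q : ℂ} (h : ElemGeneric br a.hx a.hy p q) {b : Params}
    (hx : b.hx = a.hx + a.hy - p - q) (hy : b.hy = a.hy) :
    Carries (elemAut f g a.hx a.hy p q) (thetaCurve f g a) (thetaCurve f g b) := by
  have hA := hb.actsBy_elemAut h
  have hd := hA.denom_ne_zero (hb.det_elemMat_ne_zero h)
  have h0 := h.h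
  filter_upwards [hb.eventually_g_ne_zero h0 (a.hx / 2), hb.eventually_g_ne_zero h0 (a.hy / 2),
    hb.eventually_g_ne_zero h0 ((a.hx + a.hy - p - q) / 2), hb.eventually_sub_ne_zero h0 p,
    hb.eventually_sub_ne_zero h0 q] with u h1 h2 h3 h4 h5
  set P := thetaCurve f g a u with hP
  constructor
  · have hE := (((HasVal.elemMat f g a.hx a.hy p q P 0 0).mul (HasVal.coordX P)).add
      (HasVal.elemMat f g a.hx a.hy p q P 0 1))
    have hE' := (((HasVal.elemMat f g a.hx a.hy p q P 1 0).mul (HasVal.coordX P)).add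
      (HasVal.elemMat f g a.hx a.hy p q P 1 1))
    have hM := hb.elemMat_mulVec a.hx a.hy p q u h2
    set K := br (u - p) * br (u - q) * br (a.hy - a.hx) * br (p - q) / g (u - a.hy / 2) with hK
    have hK0 : K ≠ 0 := div_ne_zero (mul_ne_zero (mul_ne_zero (mul_ne_zero h4 h5)
      (hb.br_swap_ne_zero h0)) h.sub) h2
    have hM0 := congrFun hM 0
    have hM1 := congrFun hM 1
    simp only [Matrix.mulVec, dotProduct, Fin.sum_univ_two, Matrix.cons_val_zero,
      Matrix.cons_val_one, Pi.smul_apply, smul_eq_mul] at hM0 hM1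
    have hP0 : P 0 = f (u - a.hx / 2) / g (u - a.hx / 2) := rfl
    have hP1 : P 1 = f (u - a.hy / 2) / g (u - a.hy / 2) := rfl
    have e0 : ∀ s t : ℂ, s * (f (u - a.hx / 2) / g (u - a.hx / 2)) + t =
        (s * f (u - a.hx / 2) + t * g (u - a.hx / 2)) / g (u - a.hx / 2) := by
      intro s t
      rw [add_div, mul_div_cancel_right₀ _ h1, mul_div_assoc]
    rw [hP0, hP1, e0, hM0] at hE
    rw [hP0, hP1, e0, hM1] at hE'
    -- The scalar `K` and the factor `g (u - h_x / 2)` cancel in the quotient of the two components.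
    have hq := hE.div hE' (div_ne_zero (mul_ne_zero hK0 h3) h1)
    rw [← hA.2, mul_div_cancel_right₀ _ hd, div_div_div_cancel_right₀ h1,
      mul_div_mul_left _ _ hK0, ← hx] at hq
    exact hq
  · rw [hA.1]
    change HasVal P coordY (f (u - b.hy / 2) / g (u - b.hy / 2))
    rw [hy]
    exact HasVal.coordY P

theorem carries_simpleCoc (i : Fin 7) {a : Params} (h : Generic br a) :
    Carries (simpleCoc f g i a) (thetaCurve f g a) (thetaCurve f g (simplePerm i a)) := by
  fin_cases i
  · exact Carries.one _
  · exact Carries.one _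
  · exact hb.carries_elemAut (h.elemGeneric 0 4) rfl rfl
  · refine Filter.Eventually.of_forall fun u => ?_
    change HasVal _ (swapXY coordX) _ ∧ HasVal _ (swapXY coordY) _
    rw [swapXY_coordX, swapXY_coordY]
    exact ⟨HasVal.coordY _, HasVal.coordX _⟩
  · exact hb.carries_elemAut (h.elemGeneric 2 6) rfl rfl
  · exact Carries.one _
  · exact Carries.one _

end

/-- Diagram automorphisms fix `h_x` and `h_y`, hence the intrinsic curve, so only simple reflections
need an argument. -/
theorem carries_extHom (s : ExtW) : ∀ {a : Params} (h : Generic br a),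
    Carries ((extHom hb s).coc ⟨a, h⟩) (thetaCurve f g a)
      (thetaCurve f g ((extHom hb s).perm a)) := by
  have hrot : ∀ a, thetaCurve f g (diagramPerm rot a) = thetaCurve f g a := by
    intro a
    rw [diagramPerm_rot]
    rfl
  have hrefl : ∀ a, thetaCurve f g (diagramPerm refl01 a) = thetaCurve f g a := by
    intro a
    rw [diagramPerm_refl01]
    rfl
  induction s using extW_induction with
  | one =>
    intro a h
    rw [map_one]
    exact Carries.one _
  | hw i s ih =>
    intro a h
    rw [map_mul, extHom_wβ]
    exact (ih h).mul (hb.carries_simpleCoc i (((extHom hb s).map_iff a).2 h))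
  | h1 s ih =>
    intro a h
    rw [map_mul, σ₁_eq, extHom_inr]
    refine (ih h).mul ?_
    change Carries 1 _ (thetaCurve f g (diagramPerm rot _))
    rw [hrot]
    exact Carries.one _
  | h2 s ih =>
    intro a h
    rw [map_mul, σ₂_eq, extHom_inr]
    refine (ih h).mul ?_
    change Carries 1 _ (thetaCurve f g (diagramPerm refl01 _))
    rw [hrefl]
    exact Carries.one _

theorem carries_rep (s : ExtW) {a : Params} (h : Generic br a) :
    Carries (rep hb s a) (normCurve br a) (normCurve br ((extHom hb s).perm a)) := by
  rw [rep_eq hb s h]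
  exact (hb.carries_frameAut_inv h).mul
    ((hb.carries_extHom s h).mul (hb.carries_frameAut (((extHom hb s).map_iff a).2 h)))

include hb in
theorem continuousAt_thetaQuot {h p q u : ℂ} (h1 : br (u - p) ≠ 0) (h2 : br (u + p - h) ≠ 0) :
    ContinuousAt (thetaQuot br h p q) u := by
  have hc := hb.diff.continuous
  exact ContinuousAt.div (by fun_prop) (by fun_prop) (mul_ne_zero h1 h2)

include hb in
theorem continuousAt_normCurve {a : Params} {u : ℂ} (h : FiniteAt br a u) :
    ContinuousAt (normCurve br a) u := by
  rw [continuousAt_pi]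
  intro i
  fin_cases i
  · exact hb.continuousAt_thetaQuot h.1 h.2.1
  · exact hb.continuousAt_thetaQuot h.1 h.2.2

include hb in
/-- A value that is known at almost all points of the curve is known at all points. -/
theorem hasValueOnCurve_of_eventually {a b : Params} {r : RatXY} {u : ℂ} (i : Fin 2)
    (ha : FiniteAt br a u) (hb' : FiniteAt br b u)
    (h : ∀ᶠ u in Filter.codiscrete ℂ, HasVal (normCurve br a u) r (normCurve br b u i)) :
    HasValueOnCurve br a r u (normCurve br b u i) := by
  intro p q hpq
  have ca := hb.continuousAt_normCurve ha
  have cb := (continuousAt_pi.1 (hb.continuousAt_normCurve hb')) i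
  have cp : ContinuousAt (fun u => MvPolynomial.eval (normCurve br a u) p) u :=
    (MvPolynomial.continuous_eval p).continuousAt.comp ca
  have cq : ContinuousAt (fun u => MvPolynomial.eval (normCurve br a u) q) u :=
    (MvPolynomial.continuous_eval q).continuousAt.comp ca
  -- Both sides are continuous at `u` and agree on a punctured neighbourhood, hence at `u` itself.
  exact tendsto_nhds_unique_of_eventuallyEq (cp.tendsto.mono_left nhdsWithin_le_nhds)
    ((cb.mul cq).tendsto.mono_left nhdsWithin_le_nhds)
    (eventually_nhdsNE_of_codiscrete (h.mono fun _ hv => hv.eval_eq hpq) u)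

theorem respectsCurves_rep :
    RespectsCurves br (CocyclePerm.permHom.comp (extHom hb)) (rep hb) := fun _ ha s _ h1 h2 =>
  ⟨hb.hasValueOnCurve_of_eventually 0 h1 h2 ((hb.carries_rep s ha).mono fun _ h => h.1),
    hb.hasValueOnCurve_of_eventually 1 h1 h2 ((hb.carries_rep s ha).mono fun _ h => h.2)⟩

end AddFormula

/-! ### The required properties of the representation -/

namespace AddFormula

variable {br f g : ℂ → ℂ} (hb : AddFormula br f g)

theorem perm_wβ (i : Fin 7) (a : Params) : (extHom hb (wβ i)).perm a = simpleMap i a := by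
  rw [extHom_wβ]
  rfl

theorem perm_inr (π : diagramAut) (a : Params) :
    (extHom hb (SemidirectProduct.inr π)).perm a = diagramPerm π a := by
  rw [extHom_inr]
  rfl

theorem parameterAction_perm : ParameterAction (CocyclePerm.permHom.comp (extHom hb)) := fun a =>
  ⟨hb.perm_wβ 0 a, hb.perm_wβ 1 a, hb.perm_wβ 2 a, hb.perm_wβ 3 a, hb.perm_wβ 4 a, hb.perm_wβ 5 a,
    hb.perm_wβ 6 a, (hb.perm_inr rot a).trans (diagramPerm_rot a),
    (hb.perm_inr refl01 a).trans (diagramPerm_refl01 a)⟩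

theorem constraints_perm {τ : ℂ} (s : ExtW) {a : Params} (h : Constraints τ a) :
    Constraints τ ((extHom hb s).perm a) := by
  induction s using extW_induction with
  | one => rwa [map_one]
  | hw i s ih =>
    rw [map_mul, extHom_wβ]
    exact constraints_simplePerm i ih
  | h1 s ih =>
    rw [map_mul, σ₁_eq, extHom_inr]
    exact constraints_rot ih
  | h2 s ih =>
    rw [map_mul, σ₂_eq, extHom_inr]
    exact constraints_refl01 ih

theorem generatorMaps_rep :
    GeneratorMaps br (CocyclePerm.permHom.comp (extHom hb)) (rep hb) := by
  intro a h
  have h2 := hb.rep_wβ_two h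
  have h4 := hb.rep_wβ_four h
  have e2 : CocyclePerm.permHom.comp (extHom hb) (wβ 2) a = simplePerm 2 a := hb.perm_wβ 2 a
  have e4 : CocyclePerm.permHom.comp (extHom hb) (wβ 4) a = simplePerm 4 a := hb.perm_wβ 4 a
  rw [← e2] at h2
  rw [← e4] at h4
  have hid := fun i hi => hb.rep_wβ_id (i := i) hi h
  exact ⟨⟨hid 1 (by simp) _, hid 1 (by simp) _⟩, ⟨hid 5 (by simp) _, hid 5 (by simp) _⟩,
    ⟨hid 6 (by simp) _, hid 6 (by simp) _⟩, hb.rep_wβ_zero h, h2, hb.rep_wβ_three h, h4,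
    hb.rep_σ₁ h, hb.isMap56_rep_σ₂ h⟩

theorem isRepresentation_rep :
    IsRepresentation br (CocyclePerm.permHom.comp (extHom hb)) (rep hb) := fun _ h =>
  ⟨fun r => DFunLike.congr_fun (hb.rep_one h) r,
    fun s t r => DFunLike.congr_fun (hb.rep_mul s t h) r⟩

end AddFormula

end EllipticD6

end

open EllipticD6
theorem mainTheorem5 (τ κ c : ℂ) (hτ : 0 < τ.im) (hc : c ≠ 0) :
    ∃ (A : ExtW →* Equiv.Perm Params) (ρ : ExtW → Params → (RatXY ≃ₐ[ℂ] RatXY)),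
      ParameterAction A ∧
      (∀ g a, Constraints τ a → Constraints τ (A g a)) ∧
      (∀ g a, Generic (bracket τ κ c) a → Generic (bracket τ κ c) (A g a)) ∧
      IsRepresentation (bracket τ κ c) A ρ ∧
      GeneratorMaps (bracket τ κ c) A ρ ∧
      RespectsCurves (bracket τ κ c) A ρ ∧
      (∀ a, A (σ₁ * σ₁) a = { a with e1 := a.e5, e2 := a.e6, e3 := a.e7, e4 := a.e8,
                                     e5 := a.e1, e6 := a.e2, e7 := a.e3, e8 := a.e4 }) ∧
      (∀ a, Generic (bracket τ κ c) a → IsMap56 (bracket τ κ c) a (ρ (σ₁ * σ₁) a)) := by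
  have hb := addFormula_bracket τ κ c hτ
  refine ⟨CocyclePerm.permHom.comp (extHom hb), rep hb, hb.parameterAction_perm,
    fun s _ h => hb.constraints_perm s h, fun s a h => ((extHom hb s).map_iff a).2 h,
    hb.isRepresentation_rep, hb.generatorMaps_rep, hb.respectsCurves_rep, fun a => ?_,
    fun _ h => hb.isMap56_rep_σ₁_mul_σ₁ h⟩
  rw [σ₁_eq, ← map_mul]
  exact (hb.perm_inr (rot * rot) a).trans (diagramPerm_rot_mul_rot a)
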